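/- **Setting.** Let $\mathcal X,\mathcal Y$ be real Hilbert spaces and let $K:\mathcal X\to\mathcal Y$ be a compact, injective linear operator with dense range. $K^+$ denotes the Moore–Penrose inverse (least-squares solution of minimal norm), and $\hat y\in\mathcal D(K^+)=\mathcal R(K)+\mathcal R(K)^\perp$. *Filter.* $(F_\alpha)_{\alpha>0}$ are piecewise continuous real functions on $[0,\|K\|^2]$ such that - $\lim_{\alpha\to0}\sup_{\varepsilon\le\lambda\le\|K\|^2}|F_\alpha(\lambda)-1/\lambda|=0$ for all $\varepsilon>0$; - there are constants $C_R,C_F$ with $\lambda|F_\alpha(\lambda)|\le C_R$ and $|F_\alpha(\lambda)|\le C_F/\alpha$ for all $\alpha>0$, $\lambda\in(0,\|K\|^2]$; - $|1-F_\alpha(\lambda)\lambda|\le C_0$ for all $\alpha>0$, $\lambda\in(0,\|K\|^2]$, with a known constant $C_0$; - the qualification $\nu_0\in(1,\infty]$ is maximal such that for every real $0\le\nu\le\nu_0$ there is $C_\nu$ with $\sup_{\lambda\in(0,\|K\|^2]}\lambda^{\nu/2}|1-F_\alpha(\lambda)\lambda|\le C_\nu\alpha^{\nu/2}$ for all $\alpha>0$.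 Put $R_\alpha:=F_\alpha(K^*K)K^*$. *Discretisation.* For each $m$ let $l^{(m)}_1,\dots,l^{(m)}_m$ be bounded linear functionals on $\mathcal Y$ with $\|l_1^{(m)}\|=\dots=\|l_m^{(m)}\|$, such that for $P_m:\mathcal Y\to\mathbb R^m$, $P_my=(l_1^{(m)}(y),\dots,l_m^{(m)}(y))$, the operator $P_mP_m^*$ is bijective; let $\sigma^{(m)}_1,\dots,\sigma_m^{(m)}>0$ be the singular values of $P_m$. Let $\delta_m^{disc},c_m,C_m$ be real numbers with $\delta_m^{disc}\to0$, $\limsup_m C_m/c_m<\infty$ and, for all sufficiently large $m$, $\delta_m^{disc}>0$, $\|\hat y-P_m^+P_m\hat y\|\le\delta_m^{disc}$ and $0<c_m\le\sigma_j^{(m)}\le C_m$ for $j=1,\dots,m$. *Noise.* The measurements are $Y_{ij}^{(m)}=l_j^{(m)}(\hat y)+\delta_{ij}^{(m)}$, $i\in\mathbb N$, $1\le j\le m$, where for each $m$ the random variables $(\delta_{ij}^{(m)})_{i,j}$ are i.i.d. with mean zero, and either 1. their law does not depend on $m$ and has finite variance (no independence between different $m$ is needed), or 2. there are $p\ge2$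 and $C_d$, independent of $m$, with $\mathbb E|\delta_{ij}^{(m)}|^{2p}\le C_d\,(\mathbb E(\delta_{ij}^{(m)})^2)^p<\infty$ for all $m,i,j$. *Algorithm.* Fix $\tau>C_0$ and $q\in(0,1)$. Let $\bar Y_n^{(m)}\in\mathbb R^m$ be the vector with entries $\frac1n\sum_{i=1}^nY_{ij}^{(m)}$, and let $$s_{m,n}^2=\frac1m\sum_{j=1}^m\frac1{n-1}\sum_{i=1}^n\Bigl(Y_{ij}^{(m)}-\frac1n\sum_{r=1}^nY_{rj}^{(m)}\Bigr)^2 .$$ Set $n_m=n(m,\delta_m^{disc})=\min\{n\ge2:\ \frac{m s_{m,n}^2}{n c_m^2}\le(\delta_m^{disc})^2\}$, $Z_m=P_m^+\bar Y^{(m)}_{n_m}$, and $\alpha_m=q^k$ for the smallest $k\in\{0,1,2,\dots\}$ with $\|KR_{q^k}Z_m-Z_m\|\le2\tau\delta_m^{disc}$. **Theorem.** The algorithm terminates with probability tending to $1$ as $m\to\infty$, and for every $\varepsilon>0$ $$\lim_{m\to\infty}\mathbb P\bigl(\|R_{\alpha_m}P_m^+\bar Y^{(m)}_{n(m,\delta_m^{disc})}-K^+\hat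 y\|\ge\varepsilon\bigr)=0 .$$ If moreover $K^+\hat y=(K^*K)^{\nu/2}w$ for some $0<\nu\le\nu_0-1$, $\rho>0$ and $w\in\mathcal X$ with $\|w\|\le\rho$, then $$\lim_{m\to\infty}\mathbb P\bigl(\|R_{\alpha_m}P_m^+\bar Y^{(m)}_{n(m,\delta_m^{disc})}-K^+\hat y\|\le L'\rho^{\frac1{\nu+1}}(\delta_m^{disc})^{\frac\nu{\nu+1}}\bigr)=1$$ with a constant $L'$ that depends only on $K$, the filter (with $\nu_0,C_0$), $\tau$, $q$ and $\nu$, and not on $\rho$, $w$, $\hat y$, the discretisation or the noise. (Outcomes for which the algorithm does not terminate belong to neither of the last two events.) -/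

import Mathlib

open Set Filter Topology MeasureTheory ProbabilityTheory
open scoped InnerProduct

noncomputable section

namespace InverseProblem

/-! ### Generalised inverse -/

/-- `x` minimises the residual `‖A x - y‖`. -/
def IsLeastSquares {E G : Type*} [NormedAddCommGroup E] [InnerProductSpace ℝ E]
    [NormedAddCommGroup G] [InnerProductSpace ℝ G] (A : E →L[ℝ] G) (y : G) (x : E) : Prop :=
  ∀ z : E, ‖A x - y‖ ≤ ‖A z - y‖

/-- `x` has minimal norm among the minimisers of the residual. -/
def IsMinNormLeastSquares {E G : Type*} [NormedAddCommGroup E] [InnerProductSpace ℝ E]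
    [NormedAddCommGroup G] [InnerProductSpace ℝ G] (A : E →L[ℝ] G) (y : G) (x : E) : Prop :=
  IsLeastSquares A y x ∧ ∀ z : E, IsLeastSquares A y z → ‖x‖ ≤ ‖z‖

/-- The domain `R(A) + R(A)^⊥` of the Moore-Penrose inverse. -/
def pinvDomain {E G : Type*} [NormedAddCommGroup E] [InnerProductSpace ℝ E]
    [NormedAddCommGroup G] [InnerProductSpace ℝ G] (A : E →L[ℝ] G) : Submodule ℝ G :=
  LinearMap.range (A : E →ₗ[ℝ] G) ⊔ (LinearMap.range (A : E →ₗ[ℝ] G))ᗮ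

open Classical in
/-- The Moore-Penrose inverse: the least squares solution of minimal norm
(with the value `0` where there is none). -/
def pinv {E G : Type*} [NormedAddCommGroup E] [InnerProductSpace ℝ E]
    [NormedAddCommGroup G] [InnerProductSpace ℝ G] (A : E →L[ℝ] G) (y : G) : E :=
  if h : ∃ x, IsMinNormLeastSquares A y x then h.choose else 0

/-! ### Functional calculus of a compact self-adjoint operator -/

instance eigenspace_hasOrthogonalProjection {E : Type*} [NormedAddCommGroup E]
    [InnerProductSpace ℝ E] [CompleteSpace E] (T : E →L[ℝ] E) (t : ℝ) :
    (Module.End.eigenspace (T : E →ₗ[ℝ] E) t).HasOrthogonalProjection := by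
  have h : IsClosed (Module.End.eigenspace (T : E →ₗ[ℝ] E) t : Set E) := by
    have h2 : (Module.End.eigenspace (T : E →ₗ[ℝ] E) t : Set E) = {x | T x = t • x} := by
      ext x
      simp
    rw [h2]
    exact isClosed_eq T.continuous (continuous_const_smul t)
  have := h.completeSpace_coe
  exact Submodule.HasOrthogonalProjection.ofCompleteSpace _

/-- `f(T) x = ∑ f(t) E_t x`, the sum running over the eigenvalues `t` of `T`, where `E_t` is the
orthogonal projection onto the eigenspace of `t` (it vanishes if `t` is not an eigenvalue). -/
def specFun {E : Type*} [NormedAddCommGroup E] [InnerProductSpace ℝ E] [CompleteSpace E]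
    (T : E →L[ℝ] E) (f : ℝ → ℝ) (x : E) : E :=
  ∑' t : ℝ, f t • (Module.End.eigenspace (T : E →ₗ[ℝ] E) t).starProjection x

/-- The regularisation `R_α = F_α(K^* K) K^*` generated by the filter `F`. -/
def reg {X Y : Type*} [NormedAddCommGroup X] [InnerProductSpace ℝ X] [CompleteSpace X]
    [NormedAddCommGroup Y] [InnerProductSpace ℝ Y] [CompleteSpace Y]
    (K : X →L[ℝ] Y) (F : ℝ → ℝ → ℝ) (α : ℝ) (y : Y) : X :=
  specFun (ContinuousLinearMap.adjoint K ∘L K) (F α) (ContinuousLinearMap.adjoint K y)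

/-! ### Filters -/

/-- Piecewise continuity on `[0, b]`: finitely many discontinuities, all with finite one-sided
limits. -/
def PiecewiseContinuous (f : ℝ → ℝ) (b : ℝ) : Prop :=
  (∃ S : Set ℝ, S.Finite ∧ ∀ x ∈ Icc 0 b \ S, ContinuousWithinAt f (Icc 0 b) x) ∧
    ∀ x ∈ Icc 0 b, (∃ l, Tendsto f (𝓝[Icc 0 b ∩ Iio x] x) (𝓝 l)) ∧
      ∃ r, Tendsto f (𝓝[Icc 0 b ∩ Ioi x] x) (𝓝 r)

/-- `sup_{0 < t ≤ b} t^{ν/2} |1 - F_α(t) t| ≤ C_ν α^{ν/2}` for all `α > 0` and some `C_ν`. -/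
def HasDecay (F : ℝ → ℝ → ℝ) (b ν : ℝ) : Prop :=
  ∃ Cν : ℝ, ∀ α > 0, ∀ t ∈ Ioc 0 b, t ^ (ν / 2) * |1 - F α t * t| ≤ Cν * α ^ (ν / 2)

/-- `ν₀ ∈ [0, ∞]` is the qualification of `F`: it is maximal such that the decay estimate holds
for all real `ν ∈ [0, ν₀]`. The value `⊤` is taken if the estimate holds for every `ν ≥ 0`. -/
def IsQualification (F : ℝ → ℝ → ℝ) (b : ℝ) (ν₀ : EReal) : Prop :=
  IsGreatest {κ : EReal | 0 ≤ κ ∧ ∀ ν : ℝ, 0 ≤ ν → (ν : EReal) ≤ κ → HasDecay F b ν} ν₀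

/-- `(F_α)_{α > 0}` is a regularising filter on `[0, b]` (with `b = ‖K‖²`) with qualification `ν₀`
and with `C₀` a bound for `|1 - F_α(t) t|`. -/
structure IsRegFilter (F : ℝ → ℝ → ℝ) (b : ℝ) (ν₀ : EReal) (C₀ : ℝ) : Prop where
  piecewise : ∀ α > 0, PiecewiseContinuous (F α) b
  approx : ∀ ε > 0, TendstoUniformlyOn F (fun t => 1 / t) (𝓝[>] 0) (Icc ε b)
  bounded : ∃ CR : ℝ, ∀ α > 0, ∀ t ∈ Ioc 0 b, t * |F α t| ≤ CR
  qualification : IsQualification F b ν₀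
  bound_zero : ∀ α > 0, ∀ t ∈ Ioc 0 b, |1 - F α t * t| ≤ C₀
  bound_inv : ∃ CF : ℝ, ∀ α > 0, ∀ t ∈ Ioc 0 b, |F α t| ≤ CF / α

/-! ### Discretisation -/

/-- The discretisation operator `y ↦ (l_1 y, …, l_m y)` into `ℝ^m` with the Euclidean norm. -/
def discOp {Y : Type*} [NormedAddCommGroup Y] [InnerProductSpace ℝ Y] {m : ℕ}
    (l : Fin m → Y →L[ℝ] ℝ) : Y →L[ℝ] EuclideanSpace ℝ (Fin m) :=
  ((EuclideanSpace.equiv (Fin m) ℝ).symm : (Fin m → ℝ) →L[ℝ] EuclideanSpace ℝ (Fin m)) ∘L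
    ContinuousLinearMap.pi l

/-- `σ` is one of the (positive) singular values of `P`, that is, `σ²` is an eigenvalue of
`P P^*`. -/
def IsSingularValue {Y G : Type*} [NormedAddCommGroup Y] [InnerProductSpace ℝ Y] [CompleteSpace Y]
    [NormedAddCommGroup G] [InnerProductSpace ℝ G] [CompleteSpace G]
    (P : Y →L[ℝ] G) (σ : ℝ) : Prop :=
  0 < σ ∧ Module.End.HasEigenvalue
    ((P ∘L ContinuousLinearMap.adjoint P : G →L[ℝ] G) : G →ₗ[ℝ] G) (σ ^ 2)

/-- A discretisation scheme: for every `m` the `m` channels have equal norms and `P_m P_m^*` is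
bijective. -/
structure IsDiscScheme {Y : Type*} [NormedAddCommGroup Y] [InnerProductSpace ℝ Y] [CompleteSpace Y]
    (l : (m : ℕ) → Fin m → Y →L[ℝ] ℝ) : Prop where
  norm_eq : ∀ m i j, ‖l m i‖ = ‖l m j‖
  bijective : ∀ m, Function.Bijective
    (discOp (l m) ∘L ContinuousLinearMap.adjoint (discOp (l m)))

/-- `δd` is an asymptotic bound for the discretisation error of `y` that tends to zero (through
positive values), and `c`, `C` are asymptotic bounds for the singular values with
`limsup C_m / c_m < ∞`. -/
structure IsWellConditioned {Y : Type*} [NormedAddCommGroup Y] [InnerProductSpace ℝ Y]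
    [CompleteSpace Y] (l : (m : ℕ) → Fin m → Y →L[ℝ] ℝ) (y : Y) (δd c C : ℕ → ℝ) : Prop where
  disc_pos : ∀ᶠ m in atTop, 0 < δd m
  disc_bound : ∀ᶠ m in atTop, ‖y - pinv (discOp (l m)) (discOp (l m) y)‖ ≤ δd m
  disc_tendsto : Tendsto δd atTop (𝓝 0)
  sing_bound : ∀ᶠ m in atTop, 0 < c m ∧
    ∀ σ, IsSingularValue (discOp (l m)) σ → c m ≤ σ ∧ σ ≤ C m
  cond_bound : limsup (fun m => ((C m / c m : ℝ) : EReal)) atTop < ⊤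

/-! ### White noise -/

/-- One law for all `m`: for every `m` the errors are i.i.d., their common law does not depend on
`m`, has mean zero and finite variance. -/
structure IsFixedNoise {Ω : Type*} [MeasurableSpace Ω] (μ : Measure Ω)
    (δ : (m : ℕ) → ℕ → Fin m → Ω → ℝ) : Prop where
  indep : ∀ m, iIndepFun (fun (a : ℕ × Fin m) => δ m a.1 a.2) μ
  ident : ∀ m i j m' i' j', IdentDistrib (δ m i j) (δ m' i' j') μ μ
  memLp : ∀ m i j, MemLp (δ m i j) 2 μ
  mean_zero : ∀ m i j, ∫ ω, δ m i j ω ∂μ = 0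

/-- Laws that may vary with `m`: for every `m` the errors are i.i.d. with mean zero, and
`E|δ|^{2p} ≤ C_d (E δ²)^p` with `C_d` independent of `m`. -/
structure IsVaryingNoise {Ω : Type*} [MeasurableSpace Ω] (μ : Measure Ω)
    (δ : (m : ℕ) → ℕ → Fin m → Ω → ℝ) (p Cd : ℝ) : Prop where
  indep : ∀ m, iIndepFun (fun (a : ℕ × Fin m) => δ m a.1 a.2) μ
  ident : ∀ m i j i' j', IdentDistrib (δ m i j) (δ m i' j') μ μ
  memLp : ∀ m i j, MemLp (δ m i j) (ENNReal.ofReal (2 * p)) μ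
  mean_zero : ∀ m i j, ∫ ω, δ m i j ω ∂μ = 0
  moment : ∀ m i j, ∫ ω, |δ m i j ω| ^ (2 * p) ∂μ ≤ Cd * (∫ ω, (δ m i j ω) ^ 2 ∂μ) ^ p

/-- The admissible errors: `δ m i j` is the error of the `i`-th sample on channel `j` of `m`
(samples and channels are counted from zero). -/
def IsNoise {Ω : Type*} [MeasurableSpace Ω] (μ : Measure Ω)
    (δ : (m : ℕ) → ℕ → Fin m → Ω → ℝ) : Prop :=
  (∀ m i j, Measurable (δ m i j)) ∧
    (IsFixedNoise μ δ ∨ ∃ p Cd : ℝ, 2 ≤ p ∧ IsVaryingNoise μ δ p Cd)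

/-! ### The algorithm, for one realisation `Y i j` of the measurements -/

/-- The mean of the first `n` samples. -/
def sampleMean {m : ℕ} (Y : ℕ → Fin m → ℝ) (n : ℕ) : EuclideanSpace ℝ (Fin m) :=
  WithLp.toLp 2 fun j => (1 / (n : ℝ)) * ∑ i ∈ Finset.range n, Y i j

/-- The mean over the channels of the sample variances of the first `n` samples. -/
def sampleVariance {m : ℕ} (Y : ℕ → Fin m → ℝ) (n : ℕ) : ℝ :=
  (1 / (m : ℝ)) * ∑ j : Fin m,
    (1 / ((n : ℝ) - 1)) * ∑ i ∈ Finset.range n, (Y i j - sampleMean Y n j) ^ 2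

/-- `n = min {n' ≥ 2 : m s²_{m,n'} / (n' c²) ≤ δd²}`. -/
def IsRepetitionNumber {m : ℕ} (Y : ℕ → Fin m → ℝ) (δd c : ℝ) (n : ℕ) : Prop :=
  IsLeast {n' : ℕ | 2 ≤ n' ∧ (m : ℝ) * sampleVariance Y n' / ((n' : ℝ) * c ^ 2) ≤ δd ^ 2} n

/-- The loop that starts with `k = 0` and increases `k` by one as long as
`‖K R_{q^k} z - z‖ > 2 τ δd` stops, with this `k`. -/
def IsDiscrepancyIndex {X Y : Type*} [NormedAddCommGroup X] [InnerProductSpace ℝ X]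
    [CompleteSpace X] [NormedAddCommGroup Y] [InnerProductSpace ℝ Y] [CompleteSpace Y]
    (K : X →L[ℝ] Y) (F : ℝ → ℝ → ℝ) (τ q δd : ℝ) (z : Y) (k : ℕ) : Prop :=
  IsLeast {k' : ℕ | ‖K (reg K F (q ^ k') z) - z‖ ≤ 2 * τ * δd} k

/-- On the measurements `D` the algorithm terminates and yields the reconstruction
`x = R_{q^k} P^+ (mean of the first n samples)`, where `n` is the repetition number and `k` the
discrepancy index. There is at most one such `x`, and none if the algorithm does not terminate. -/
def IsReconstruction {X Y : Type*} [NormedAddCommGroup X] [InnerProductSpace ℝ X]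
    [CompleteSpace X] [NormedAddCommGroup Y] [InnerProductSpace ℝ Y] [CompleteSpace Y]
    (K : X →L[ℝ] Y) (F : ℝ → ℝ → ℝ) (τ q : ℝ) {m : ℕ} (P : Y →L[ℝ] EuclideanSpace ℝ (Fin m))
    (δd c : ℝ) (D : ℕ → Fin m → ℝ) (x : X) : Prop :=
  ∃ n k : ℕ, IsRepetitionNumber D δd c n ∧
    IsDiscrepancyIndex K F τ q δd (pinv P (sampleMean D n)) k ∧
    x = reg K F (q ^ k) (pinv P (sampleMean D n))

/-- The measurements `Y_{ij} = l_j(y) + δ_{ij}` at the outcome `ω`. -/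
def measurements {Y Ω : Type*} [NormedAddCommGroup Y] [InnerProductSpace ℝ Y]
    (l : (m : ℕ) → Fin m → Y →L[ℝ] ℝ) (y : Y) (δ : (m : ℕ) → ℕ → Fin m → Ω → ℝ)
    (m : ℕ) (ω : Ω) : ℕ → Fin m → ℝ :=
  fun i j => l m j y + δ m i j ω

end InverseProblem

end

/-! The argument separates a deterministic part from a probabilistic one. Write `yhat = K x₀`, which
dense range and injectivity make possible, and fix `σ > 1` with `C₀ * σ < τ`.

Deterministic part: suppose the data `z` satisfy `‖z - K x₀‖ ≤ 2 σ δ`. Since `‖K R_α - 1‖ ≤ C₀`, the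
computable residual `‖K R_α z - z‖` and the bias `‖K (x₀ - R_α K x₀)‖` differ by at most `2 C₀ σ δ`.
Hence at the stopping index the bias is `O(δ)`, and one step earlier it exceeds `2 (τ - C₀ σ) δ`.
The first fact controls the approximation error. The second bounds `δ` from above by the bias, and
so controls the propagated noise, which is of order `δ / √α`. Qualification above one makes the bias
`o(√α)`, which gives convergence (`eventually_norm_reg_sub_lt`). Under a source condition the bias
is `O(α^((ν+1)/2))`, and an interpolation between the norms of `x₀ - R_α K x₀` and of its image
under `K` gives the rate (`norm_reg_sub_le_rate`).

Probabilistic part: the data error must be at most `2 σ δ` with probability tending to one. The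
discretisation contributes at most `δ`. The noise contributes at most the norm of the averaged noise
divided by `c`, so it suffices that the squared norm of the mean at the random sample size is at
most `(1 + κ) (c δ)²`. With variance `s`, the sample size should be near `R = m s / (c δ)²`, where
the expected squared norm of the mean is `(c δ)²`. All estimates have to be uniform in the sample
size, because `R` is arbitrary for given `m`; the only source of concentration is the averaging over
the `m` channels.

Three facts give this. The scatter is bounded below simultaneously for all `n`, so the rule does not
stop early. It is bounded above at one fixed `n`, so the rule does not stop late. Finally,
Kolmogorov's maximal inequality controls the mean over a short window of sample sizes, so the
dependence between the stopping time and the mean is harmless. These are combined in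
`IsTameNoise.exists_measureReal_not_repetition`. Both noise models reduce to arrays with bounded
kurtosis: under varying laws this is the moment condition, and for a fixed law it holds after
truncation, up to a remainder of small variance. -/

namespace InverseProblem

open scoped InnerProductSpace

/-! ### Spectral decomposition and functional calculus of a compact self-adjoint operator. -/

section Spectral

variable {E : Type*} [NormedAddCommGroup E] [InnerProductSpace ℝ E] [CompleteSpace E]
  {T : E →L[ℝ] E}

/-- The component of `x` in the eigenspace of `T` for the eigenvalue `t`. -/
noncomputable def eigenPart (T : E →L[ℝ] E) (t : ℝ) : E →L[ℝ] E :=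
  (Module.End.eigenspace (T : E →ₗ[ℝ] E) t).starProjection

lemma eigenPart_mem (T : E →L[ℝ] E) (t : ℝ) (x : E) :
    eigenPart T t x ∈ Module.End.eigenspace (T : E →ₗ[ℝ] E) t :=
  Submodule.starProjection_apply_mem _ _

lemma apply_eigenPart (T : E →L[ℝ] E) (t : ℝ) (x : E) :
    T (eigenPart T t x) = t • eigenPart T t x := by
  simpa using Module.End.mem_eigenspace_iff.mp (eigenPart_mem T t x)

lemma eigenPart_eigenPart (hs : (T : E →ₗ[ℝ] E).IsSymmetric) (s t : ℝ) (x : E) :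
    eigenPart T s (eigenPart T t x) = if s = t then eigenPart T t x else 0 := by
  split_ifs with h
  · subst h
    exact Submodule.starProjection_eq_self_iff.mpr (eigenPart_mem T s x)
  · apply (Submodule.starProjection_apply_eq_zero_iff _).mpr
    rw [Submodule.mem_orthogonal]
    intro u hu
    exact hs.orthogonalFamily_eigenspaces h ⟨_, hu⟩ ⟨_, eigenPart_mem T t x⟩

lemma eigenPart_eq_zero (T : E →L[ℝ] E) {t : ℝ}
    (h : ¬ Module.End.HasEigenvalue (T : E →ₗ[ℝ] E) t) (x : E) : eigenPart T t x = 0 := by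
  rw [Module.End.hasEigenvalue_iff, not_not] at h
  have := eigenPart_mem T t x
  rw [h] at this
  simpa using this

lemma hasSum_eigenPart (hc : IsCompactOperator T) (hs : (T : E →ₗ[ℝ] E).IsSymmetric) (x : E) :
    HasSum (fun t => eigenPart T t x) x := by
  have hcomp : ∀ t, CompleteSpace (Module.End.eigenspace (T : E →ₗ[ℝ] E) t) := fun t => by
    have h2 : (Module.End.eigenspace (T : E →ₗ[ℝ] E) t : Set E) = {x | T x = t • x} := by
      ext x; simp
    have h : IsClosed (Module.End.eigenspace (T : E →ₗ[ℝ] E) t : Set E) := by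
      rw [h2]; exact isClosed_eq T.continuous (continuous_const_smul t)
    exact h.completeSpace_coe
  have hH : IsHilbertSum ℝ (fun t : ℝ => Module.End.eigenspace (T : E →ₗ[ℝ] E) t)
      fun t => (Module.End.eigenspace (T : E →ₗ[ℝ] E) t).subtypeₗᵢ := by
    refine IsHilbertSum.mkInternal _ hs.orthogonalFamily_eigenspaces ?_
    rw [top_le_iff, Submodule.topologicalClosure_eq_top_iff]
    exact ContinuousLinearMap.orthogonalComplement_iSup_eigenspaces_eq_bot hc hs
  have h1 := hH.hasSum_linearIsometryEquiv_symm (hH.linearIsometryEquiv x)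
  rw [LinearIsometryEquiv.symm_apply_apply] at h1
  set a := hH.linearIsometryEquiv x
  convert h1 using 2 with s
  -- The abstract Hilbert-sum coordinate `a s` is identified with the projection by applying
  -- `eigenPart T s` to the series; orthogonality leaves only the term `t = s`.
  have h3 : HasSum (fun t => eigenPart T s ((a t : _) : E)) (eigenPart T s x) :=
    h1.mapL (eigenPart T s)
  refine h3.unique ?_
  have h4 : eigenPart T s ((a s : _) : E) = (a s : E) :=
    Submodule.starProjection_eq_self_iff.mpr (a s).2
  have h5 := hasSum_single (f := fun t => eigenPart T s ((a t : _) : E)) s (by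
    intro t ht
    apply (Submodule.starProjection_apply_eq_zero_iff _).mpr
    rw [Submodule.mem_orthogonal]
    intro u hu
    exact hs.orthogonalFamily_eigenspaces ht.symm ⟨_, hu⟩ (a t))
  rw [h4] at h5
  exact h5

lemma hasSum_inner_eigenPart (hc : IsCompactOperator T) (hs : (T : E →ₗ[ℝ] E).IsSymmetric)
    (x y : E) : HasSum (fun t => ⟪eigenPart T t x, eigenPart T t y⟫_ℝ) ⟪x, y⟫_ℝ := by
  have h := (hasSum_eigenPart hc hs x).mapL ((innerSL ℝ).flip y)
  refine h.congr_fun fun t => ?_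
  change _ = ⟪eigenPart T t x, y⟫_ℝ
  have h2 : ⟪eigenPart T t x, y - eigenPart T t y⟫_ℝ = 0 := by
    have := Submodule.sub_starProjection_mem_orthogonal
      (K := Module.End.eigenspace (T : E →ₗ[ℝ] E) t) y
    exact Submodule.inner_right_of_mem_orthogonal (eigenPart_mem T t x) this
  rw [inner_sub_right] at h2
  linarith

lemma hasSum_norm_sq_eigenPart (hc : IsCompactOperator T) (hs : (T : E →ₗ[ℝ] E).IsSymmetric)
    (x : E) : HasSum (fun t => ‖eigenPart T t x‖ ^ 2) (‖x‖ ^ 2) := by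
  simpa only [real_inner_self_eq_norm_sq] using hasSum_inner_eigenPart hc hs x x

lemma eigenPart_apply (hc : IsCompactOperator T) (hs : (T : E →ₗ[ℝ] E).IsSymmetric)
    (t : ℝ) (x : E) : eigenPart T t (T x) = t • eigenPart T t x := by
  have h := ((hasSum_eigenPart hc hs x).mapL T).mapL (eigenPart T t)
  refine h.unique ?_
  have h2 := hasSum_single (f := fun s => eigenPart T t (T (eigenPart T s x))) t (by
    intro s hst
    rw [apply_eigenPart, map_smul, eigenPart_eigenPart hs, if_neg hst.symm, smul_zero])
  rwa [apply_eigenPart, map_smul, eigenPart_eigenPart hs, if_pos rfl] at h2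

lemma hasSum_inner_apply (hc : IsCompactOperator T) (hs : (T : E →ₗ[ℝ] E).IsSymmetric) (x : E) :
    HasSum (fun t => t * ‖eigenPart T t x‖ ^ 2) ⟪T x, x⟫_ℝ := by
  convert hasSum_inner_eigenPart hc hs (T x) x using 2 with t
  rw [eigenPart_apply hc hs, real_inner_smul_left, real_inner_self_eq_norm_sq]

/-- `specFun` is a `tsum`, hence meaningless without summability. The terms are orthogonal, so
square-summability of their norms is enough. A bound on `f` is needed only at eigenvalues, as the
other terms vanish. -/
lemma hasSum_specFun (hc : IsCompactOperator T) (hs : (T : E →ₗ[ℝ] E).IsSymmetric)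
    {f : ℝ → ℝ} {B : ℝ} (hf : ∀ t, Module.End.HasEigenvalue (T : E →ₗ[ℝ] E) t → |f t| ≤ B) (x : E) :
    HasSum (fun t => f t • eigenPart T t x) (specFun T f x) := by
  have key : Summable fun t => f t • eigenPart T t x := by
    have := hs.orthogonalFamily_eigenspaces.summable_iff_norm_sq_summable
      (fun t => (⟨f t • eigenPart T t x, Submodule.smul_mem _ _ (eigenPart_mem T t x)⟩ :
        Module.End.eigenspace (T : E →ₗ[ℝ] E) t))
    refine this.mpr ?_
    refine Summable.of_nonneg_of_le (fun t => sq_nonneg _) (fun t => ?_)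
      ((hasSum_norm_sq_eigenPart hc hs x).summable.mul_left (B ^ 2))
    by_cases ht : Module.End.HasEigenvalue (T : E →ₗ[ℝ] E) t
    · change ‖f t • eigenPart T t x‖ ^ 2 ≤ _
      rw [norm_smul, mul_pow, Real.norm_eq_abs]
      have := hf t ht
      gcongr
    · change ‖f t • eigenPart T t x‖ ^ 2 ≤ _
      rw [eigenPart_eq_zero T ht]; simp
  exact key.hasSum

lemma eigenPart_specFun (hc : IsCompactOperator T) (hs : (T : E →ₗ[ℝ] E).IsSymmetric)
    {f : ℝ → ℝ} {B : ℝ} (hf : ∀ t, Module.End.HasEigenvalue (T : E →ₗ[ℝ] E) t → |f t| ≤ B)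
    (t : ℝ) (x : E) : eigenPart T t (specFun T f x) = f t • eigenPart T t x := by
  have h := (hasSum_specFun hc hs hf x).mapL (eigenPart T t)
  refine h.unique ?_
  have h2 := hasSum_single (f := fun s => eigenPart T t (f s • eigenPart T s x)) t (by
    intro s hst
    rw [map_smul, eigenPart_eigenPart hs, if_neg hst.symm, smul_zero])
  rwa [map_smul, eigenPart_eigenPart hs, if_pos rfl] at h2

lemma specFun_add (hc : IsCompactOperator T) (hs : (T : E →ₗ[ℝ] E).IsSymmetric)
    {f : ℝ → ℝ} {B : ℝ} (hf : ∀ t, Module.End.HasEigenvalue (T : E →ₗ[ℝ] E) t → |f t| ≤ B)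
    (x y : E) : specFun T f (x + y) = specFun T f x + specFun T f y := by
  refine (hasSum_specFun hc hs hf (x + y)).unique ?_
  convert (hasSum_specFun hc hs hf x).add (hasSum_specFun hc hs hf y) using 2 with t
  rw [map_add, smul_add]

lemma norm_specFun_le (hc : IsCompactOperator T) (hs : (T : E →ₗ[ℝ] E).IsSymmetric)
    {f : ℝ → ℝ} {B : ℝ} (hB : 0 ≤ B)
    (hf : ∀ t, Module.End.HasEigenvalue (T : E →ₗ[ℝ] E) t → |f t| ≤ B)
    (x : E) : ‖specFun T f x‖ ≤ B * ‖x‖ := by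
  refine le_of_sq_le_sq ?_ (by positivity)
  rw [mul_pow]
  refine hasSum_le (fun t => ?_) (hasSum_norm_sq_eigenPart hc hs (specFun T f x))
    ((hasSum_norm_sq_eigenPart hc hs x).mul_left (B ^ 2))
  rw [eigenPart_specFun hc hs hf, norm_smul, mul_pow, Real.norm_eq_abs]
  by_cases ht : Module.End.HasEigenvalue (T : E →ₗ[ℝ] E) t
  · have := hf t ht
    gcongr
  · rw [eigenPart_eq_zero T ht]; simp

end Spectral

/-! ### The operator `K^* K` and its spectrum. -/

section Gram

variable {X Y : Type*} [NormedAddCommGroup X] [InnerProductSpace ℝ X] [CompleteSpace X]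
  [NormedAddCommGroup Y] [InnerProductSpace ℝ Y] [CompleteSpace Y] {K : X →L[ℝ] Y}

/-- The operator `K^* K`. -/
noncomputable abbrev gram (K : X →L[ℝ] Y) : X →L[ℝ] X := ContinuousLinearMap.adjoint K ∘L K

lemma gram_isCompactOperator (hK : IsCompactOperator K) : IsCompactOperator (gram K) :=
  hK.clm_comp (ContinuousLinearMap.adjoint K)

lemma inner_gram_apply (K : X →L[ℝ] Y) (x y : X) : ⟪gram K x, y⟫_ℝ = ⟪K x, K y⟫_ℝ := by
  simp [gram, ContinuousLinearMap.adjoint_inner_left]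

lemma gram_isSymmetric (K : X →L[ℝ] Y) : (gram K : X →ₗ[ℝ] X).IsSymmetric := by
  intro x y
  have h1 := inner_gram_apply K x y
  have h2 := inner_gram_apply K y x
  rw [real_inner_comm] at h2
  change ⟪gram K x, y⟫_ℝ = ⟪x, gram K y⟫_ℝ
  rw [h1, h2, real_inner_comm]

lemma hasEigenvalue_gram_mem (hinj : Function.Injective K) {t : ℝ}
    (ht : Module.End.HasEigenvalue (gram K : X →ₗ[ℝ] X) t) : t ∈ Ioc 0 (‖K‖ ^ 2) := by
  obtain ⟨v, hv⟩ := ht.exists_hasEigenvector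
  have hv0 : v ≠ 0 := hv.2
  have h1 : gram K v = t • v := hv.apply_eq_smul
  have h2 := inner_gram_apply K v v
  rw [h1, real_inner_smul_left, real_inner_self_eq_norm_sq, real_inner_self_eq_norm_sq] at h2
  have hpos : 0 < ‖v‖ ^ 2 := by positivity
  have hKv : K v ≠ 0 := fun h => hv0 (hinj (by simpa using h))
  have hKpos : 0 < ‖K v‖ ^ 2 := by positivity
  refine ⟨?_, ?_⟩
  · by_contra! h
    nlinarith
  · have : ‖K v‖ ^ 2 ≤ ‖K‖ ^ 2 * ‖v‖ ^ 2 := by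
      rw [← mul_pow]; gcongr; exact K.le_opNorm v
    rw [← h2] at this
    exact le_of_mul_le_mul_right this hpos

lemma hasSum_norm_sq_apply (hK : IsCompactOperator K) (x : X) :
    HasSum (fun t => t * ‖eigenPart (gram K) t x‖ ^ 2) (‖K x‖ ^ 2) := by
  have h := hasSum_inner_apply (gram_isCompactOperator hK) (gram_isSymmetric K) x
  rwa [inner_gram_apply, real_inner_self_eq_norm_sq] at h

end Gram

/-! ### Spectral estimates for the filter regularisation. -/

section Regularisation

variable {X Y : Type*} [NormedAddCommGroup X] [InnerProductSpace ℝ X] [CompleteSpace X]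
  [NormedAddCommGroup Y] [InnerProductSpace ℝ Y] [CompleteSpace Y] {K : X →L[ℝ] Y}
  {F : ℝ → ℝ → ℝ} {ν₀ : EReal} {C₀ : ℝ}

lemma IsRegFilter.exists_bound (hF : IsRegFilter F (‖K‖ ^ 2) ν₀ C₀) (hinj : Function.Injective K)
    {α : ℝ} (hα : 0 < α) : ∃ B, 0 ≤ B ∧
      ∀ t, Module.End.HasEigenvalue (gram K : X →ₗ[ℝ] X) t → |F α t| ≤ B := by
  obtain ⟨CF, hCF⟩ := hF.bound_inv
  refine ⟨|CF| / α, by positivity, fun t ht => ?_⟩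
  refine (hCF α hα t (hasEigenvalue_gram_mem hinj ht)).trans ?_
  gcongr
  exact le_abs_self CF

lemma reg_add (hK : IsCompactOperator K) (hinj : Function.Injective K)
    (hF : IsRegFilter F (‖K‖ ^ 2) ν₀ C₀) {α : ℝ} (hα : 0 < α) (y z : Y) :
    reg K F α (y + z) = reg K F α y + reg K F α z := by
  obtain ⟨B, -, hB⟩ := hF.exists_bound hinj hα
  simp only [reg, map_add]
  exact specFun_add (gram_isCompactOperator hK) (gram_isSymmetric K) hB _ _

lemma continuous_reg (hK : IsCompactOperator K) (hinj : Function.Injective K)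
    (hF : IsRegFilter F (‖K‖ ^ 2) ν₀ C₀) {α : ℝ} (hα : 0 < α) : Continuous (reg K F α) := by
  obtain ⟨B, hB0, hB⟩ := hF.exists_bound hinj hα
  refine AddMonoidHomClass.continuous_of_bound
    (AddMonoidHom.mk' (reg K F α) (reg_add hK hinj hF hα))
    (B * ‖ContinuousLinearMap.adjoint K‖) fun z => ?_
  refine (norm_specFun_le (gram_isCompactOperator hK) (gram_isSymmetric K) hB0 hB _).trans ?_
  rw [mul_assoc]
  gcongr
  exact ContinuousLinearMap.le_opNorm _ _

/-- On data of the form `K x` the regularisation is a spectral multiplier of `K^* K` alone. Bounds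
on all of `Y` are obtained from this case by density of the range and continuity, so no functional
calculus for `K K^*` is needed. -/
lemma eigenPart_reg_apply (hK : IsCompactOperator K) (hinj : Function.Injective K)
    (hF : IsRegFilter F (‖K‖ ^ 2) ν₀ C₀) {α : ℝ} (hα : 0 < α) (x : X) (t : ℝ) :
    eigenPart (gram K) t (reg K F α (K x)) = (F α t * t) • eigenPart (gram K) t x := by
  obtain ⟨B, -, hB⟩ := hF.exists_bound hinj hα
  have hc := gram_isCompactOperator hK
  have hs := gram_isSymmetric K
  have h1 := eigenPart_specFun hc hs hB t (gram K x)
  rw [eigenPart_apply hc hs, smul_smul] at h1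
  exact h1

lemma eigenPart_sub_reg_apply (hK : IsCompactOperator K) (hinj : Function.Injective K)
    (hF : IsRegFilter F (‖K‖ ^ 2) ν₀ C₀) {α : ℝ} (hα : 0 < α) (x : X) (t : ℝ) :
    eigenPart (gram K) t (x - reg K F α (K x)) =
      (1 - F α t * t) • eigenPart (gram K) t x := by
  rw [map_sub, eigenPart_reg_apply hK hinj hF hα, sub_smul, one_smul]

lemma hasSum_norm_sq_sub_reg (hK : IsCompactOperator K) (hinj : Function.Injective K)
    (hF : IsRegFilter F (‖K‖ ^ 2) ν₀ C₀) {α : ℝ} (hα : 0 < α) (x : X) :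
    HasSum (fun t => (1 - F α t * t) ^ 2 * ‖eigenPart (gram K) t x‖ ^ 2)
      (‖x - reg K F α (K x)‖ ^ 2) := by
  refine (hasSum_norm_sq_eigenPart (gram_isCompactOperator hK) (gram_isSymmetric K) _).congr_fun
    fun t => ?_
  rw [eigenPart_sub_reg_apply hK hinj hF hα, norm_smul, mul_pow, Real.norm_eq_abs, sq_abs]

lemma hasSum_norm_sq_apply_sub_reg (hK : IsCompactOperator K) (hinj : Function.Injective K)
    (hF : IsRegFilter F (‖K‖ ^ 2) ν₀ C₀) {α : ℝ} (hα : 0 < α) (x : X) :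
    HasSum (fun t => t * (1 - F α t * t) ^ 2 * ‖eigenPart (gram K) t x‖ ^ 2)
      (‖K (x - reg K F α (K x))‖ ^ 2) := by
  refine (hasSum_norm_sq_apply hK _).congr_fun fun t => ?_
  rw [eigenPart_sub_reg_apply hK hinj hF hα, norm_smul, mul_pow, Real.norm_eq_abs, sq_abs]
  ring

/-- Termwise comparison of sums over the spectrum need only be checked on the spectrum. -/
lemma mul_norm_sq_eigenPart_le (hinj : Function.Injective K) {f g : ℝ → ℝ}
    (h : ∀ t ∈ Ioc 0 (‖K‖ ^ 2), f t ≤ g t) (x : X) (t : ℝ) :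
    f t * ‖eigenPart (gram K) t x‖ ^ 2 ≤ g t * ‖eigenPart (gram K) t x‖ ^ 2 := by
  by_cases ht : Module.End.HasEigenvalue (gram K : X →ₗ[ℝ] X) t
  · have := h t (hasEigenvalue_gram_mem hinj ht)
    gcongr
  · rw [eigenPart_eq_zero _ ht]; simp

omit [CompleteSpace X] [CompleteSpace Y] in
lemma IsRegFilter.sq_residual_le (hF : IsRegFilter F (‖K‖ ^ 2) ν₀ C₀) {α : ℝ} (hα : 0 < α) {t : ℝ}
    (ht : t ∈ Ioc 0 (‖K‖ ^ 2)) : (1 - F α t * t) ^ 2 ≤ C₀ ^ 2 := by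
  rw [← sq_abs]
  have := hF.bound_zero α hα t ht
  gcongr

lemma norm_apply_reg_sub_le (hK : IsCompactOperator K) (hinj : Function.Injective K)
    (hdense : DenseRange K) (hF : IsRegFilter F (‖K‖ ^ 2) ν₀ C₀) (hC₀ : 0 ≤ C₀)
    {α : ℝ} (hα : 0 < α) (z : Y) : ‖K (reg K F α z) - z‖ ≤ C₀ * ‖z‖ := by
  have hcont := continuous_reg hK hinj hF hα
  refine hdense.induction_on (p := fun z => ‖K (reg K F α z) - z‖ ≤ C₀ * ‖z‖) z ?_ fun x => ?_
  · exact isClosed_le (by fun_prop) (by fun_prop)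
  · rw [← map_sub, ← norm_neg, ← map_neg, neg_sub]
    refine le_of_sq_le_sq ?_ (by positivity)
    rw [mul_pow]
    refine hasSum_le (fun t => ?_) (hasSum_norm_sq_apply_sub_reg hK hinj hF hα x)
      ((hasSum_norm_sq_apply hK x).mul_left (C₀ ^ 2))
    rw [← mul_assoc]
    refine mul_norm_sq_eigenPart_le hinj (f := fun t => t * (1 - F α t * t) ^ 2)
      (g := fun t => C₀ ^ 2 * t) (fun t ht => ?_) x t
    have := hF.sq_residual_le hα ht
    have := ht.1
    nlinarith

/-- The two filter bounds are multiplied: `(F t)² = (t |F|) |F| t ≤ C_R (C_F / α) t`, and the factor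
`t` turns the norm of `x` into that of `K x`. -/
lemma exists_norm_reg_le (hK : IsCompactOperator K) (hinj : Function.Injective K)
    (hdense : DenseRange K) (hF : IsRegFilter F (‖K‖ ^ 2) ν₀ C₀) :
    ∃ D, 0 ≤ D ∧ ∀ α > 0, ∀ z, ‖reg K F α z‖ ≤ D / √α * ‖z‖ := by
  obtain ⟨CF, hCF⟩ := hF.bound_inv
  obtain ⟨CR, hCR⟩ := hF.bounded
  refine ⟨√(|CR| * |CF|), by positivity, fun α hα z => ?_⟩
  have hcont := continuous_reg hK hinj hF hα
  refine hdense.induction_on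
    (p := fun z => ‖reg K F α z‖ ≤ √(|CR| * |CF|) / √α * ‖z‖) z ?_ fun x => ?_
  · exact isClosed_le (by fun_prop) (by fun_prop)
  · refine le_of_sq_le_sq ?_ (by positivity)
    rw [mul_pow, div_pow, Real.sq_sqrt (by positivity), Real.sq_sqrt hα.le]
    refine hasSum_le (fun t => ?_) (hasSum_norm_sq_eigenPart (gram_isCompactOperator hK)
      (gram_isSymmetric K) (reg K F α (K x)))
      ((hasSum_norm_sq_apply hK x).mul_left (|CR| * |CF| / α))
    rw [eigenPart_reg_apply hK hinj hF hα, norm_smul, mul_pow, ← mul_assoc, Real.norm_eq_abs,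
      sq_abs]
    refine mul_norm_sq_eigenPart_le hinj (f := fun t => (F α t * t) ^ 2)
      (g := fun t => |CR| * |CF| / α * t) (fun t ht => ?_) x t
    have h1 : t * |F α t| ≤ |CR| := (hCR α hα t ht).trans (le_abs_self _)
    have h2 : |F α t| ≤ |CF| / α := (hCF α hα t ht).trans (by gcongr; exact le_abs_self _)
    have ht0 := ht.1
    calc (F α t * t) ^ 2 = (t * |F α t|) * |F α t| * t := by
          rw [← sq_abs, abs_mul, abs_of_pos ht0]; ring
      _ ≤ |CR| * (|CF| / α) * t := by gcongr
      _ = |CR| * |CF| / α * t := by ring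

/-! ### Residual, bias and total error for noisy data. -/

section Discrepancy

variable (hK : IsCompactOperator K) (hinj : Function.Injective K)
    (hdense : DenseRange K) (hF : IsRegFilter F (‖K‖ ^ 2) ν₀ C₀) (hC₀ : 0 ≤ C₀)

include hK hinj hdense hF hC₀

lemma norm_residual_le (x : X) {α : ℝ} (hα : 0 < α) (z : Y) :
    ‖K (reg K F α z) - z‖ ≤ ‖K (x - reg K F α (K x))‖ + C₀ * ‖z - K x‖ := by
  have h := norm_apply_reg_sub_le hK hinj hdense hF hC₀ hα (z - K x)
  have h2 : K (reg K F α z) - z =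
      (K (reg K F α (z - K x)) - (z - K x)) - K (x - reg K F α (K x)) := by
    have : reg K F α z = reg K F α (z - K x) + reg K F α (K x) := by
      rw [← reg_add hK hinj hF hα, sub_add_cancel]
    rw [this]; simp only [map_add, map_sub]; abel
  rw [h2]
  linarith [norm_sub_le (K (reg K F α (z - K x)) - (z - K x)) (K (x - reg K F α (K x)))]

lemma norm_bias_le (x : X) {α : ℝ} (hα : 0 < α) (z : Y) :
    ‖K (x - reg K F α (K x))‖ ≤ ‖K (reg K F α z) - z‖ + C₀ * ‖z - K x‖ := by
  have h := norm_apply_reg_sub_le hK hinj hdense hF hC₀ hα (z - K x)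
  have h2 : K (x - reg K F α (K x)) =
      (K (reg K F α (z - K x)) - (z - K x)) - (K (reg K F α z) - z) := by
    have : reg K F α z = reg K F α (z - K x) + reg K F α (K x) := by
      rw [← reg_add hK hinj hF hα, sub_add_cancel]
    rw [this]; simp only [map_add, map_sub]; abel
  rw [h2]
  linarith [norm_sub_le (K (reg K F α (z - K x)) - (z - K x)) (K (reg K F α z) - z)]

omit hdense hC₀ in
lemma norm_reg_sub_le {D : ℝ} (hD : ∀ α > 0, ∀ z, ‖reg K F α z‖ ≤ D / √α * ‖z‖)
    (x : X) {α : ℝ} (hα : 0 < α) (z : Y) :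
    ‖reg K F α z - x‖ ≤ ‖x - reg K F α (K x)‖ + D / √α * ‖z - K x‖ := by
  have h := hD α hα (z - K x)
  have h2 : reg K F α z - x = reg K F α (z - K x) - (x - reg K F α (K x)) := by
    have : reg K F α z = reg K F α (z - K x) + reg K F α (K x) := by
      rw [← reg_add hK hinj hF hα, sub_add_cancel]
    rw [this]; abel
  rw [h2]
  linarith [norm_sub_le (reg K F α (z - K x)) (x - reg K F α (K x))]

end Discrepancy

end Regularisation

/-- The squared form fits the sums of squares over the spectrum and has a nonnegative constant. -/
lemma HasDecay.exists_sq_le {F : ℝ → ℝ → ℝ} {b ν : ℝ} (h : HasDecay F b ν) :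
    ∃ C, 0 ≤ C ∧ ∀ α > 0, ∀ t ∈ Ioc 0 b, t ^ ν * (1 - F α t * t) ^ 2 ≤ C * α ^ ν := by
  obtain ⟨C, hC⟩ := h
  refine ⟨C ^ 2, sq_nonneg _, fun α hα t ht => ?_⟩
  have hsq : ∀ s : ℝ, 0 < s → s ^ ν = (s ^ (ν / 2)) ^ 2 := fun s hs => by
    rw [← Real.rpow_natCast, ← Real.rpow_mul hs.le]; congr 1; push_cast; ring
  have h1 := hC α hα t ht
  rw [hsq t ht.1, hsq α hα, ← sq_abs (1 - F α t * t), ← mul_pow, ← mul_pow]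
  have : 0 ≤ t ^ (ν / 2) := Real.rpow_nonneg ht.1.le _
  gcongr

lemma IsRegFilter.exists_decay {F : ℝ → ℝ → ℝ} {b C₀ : ℝ} {ν₀ : EReal}
    (hF : IsRegFilter F b ν₀ C₀) {ν : ℝ} (h0 : 0 ≤ ν) (h : (ν : EReal) ≤ ν₀) :
    ∃ C, 0 ≤ C ∧ ∀ α > 0, ∀ t ∈ Ioc 0 b, t ^ ν * (1 - F α t * t) ^ 2 ≤ C * α ^ ν :=
  (hF.qualification.1.2 ν h0 h).exists_sq_le

lemma tendsto_rpow_nhdsGT_zero {a : ℝ} (ha : 0 < a) :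
    Tendsto (fun α : ℝ => α ^ a) (𝓝[>] 0) (𝓝 0) := by
  have := (Real.continuousAt_rpow_const 0 a (Or.inr ha.le)).tendsto
  rw [Real.zero_rpow ha.ne'] at this
  exact this.mono_left nhdsWithin_le_nhds

/-! ### Convergence of the discrepancy principle. -/

section Convergence

variable {X Y : Type*} [NormedAddCommGroup X] [InnerProductSpace ℝ X] [CompleteSpace X]
  [NormedAddCommGroup Y] [InnerProductSpace ℝ Y] [CompleteSpace Y] {K : X →L[ℝ] Y}
  {F : ℝ → ℝ → ℝ} {ν₀ : EReal} {C₀ : ℝ}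

/-- Dominated convergence over the spectrum: `C₀²` gives the majorant, and the decay estimate with
`ν = 1` sends each term to zero, since every eigenvalue is positive. -/
lemma tendsto_norm_sub_reg (hK : IsCompactOperator K) (hinj : Function.Injective K)
    (hF : IsRegFilter F (‖K‖ ^ 2) ν₀ C₀) (hν₀ : 1 < ν₀) (x : X) :
    Tendsto (fun α => ‖x - reg K F α (K x)‖) (𝓝[>] 0) (𝓝 0) := by
  have hsq : Tendsto (fun α => ‖x - reg K F α (K x)‖ ^ 2) (𝓝[>] 0) (𝓝 0) := by
    have hpos : ∀ᶠ α : ℝ in 𝓝[>] 0, 0 < α := eventually_mem_nhdsWithin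
    obtain ⟨C, hC0, hC⟩ := hF.exists_decay (ν := 1) zero_le_one (by simpa using hν₀.le)
    have key := tendsto_tsum_of_dominated_convergence (𝓕 := 𝓝[>] (0 : ℝ))
      (f := fun α t => (1 - F α t * t) ^ 2 * ‖eigenPart (gram K) t x‖ ^ 2) (g := fun _ => 0)
      ((hasSum_norm_sq_eigenPart (gram_isCompactOperator hK)
        (gram_isSymmetric K) x).summable.mul_left (C₀ ^ 2)) (fun t => ?_) ?_
    · rw [tsum_zero] at key
      refine key.congr' ?_
      filter_upwards [hpos] with α hα
      exact (hasSum_norm_sq_sub_reg hK hinj hF hα x).tsum_eq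
    · by_cases ht : Module.End.HasEigenvalue (gram K : X →ₗ[ℝ] X) t
      · have ht' := hasEigenvalue_gram_mem hinj ht
        suffices hh : Tendsto (fun α => (1 - F α t * t) ^ 2) (𝓝[>] 0) (𝓝 0) by
          simpa using hh.mul_const (‖eigenPart (gram K) t x‖ ^ 2)
        have h2 : Tendsto (fun α : ℝ => C / t * α) (𝓝[>] 0) (𝓝 0) := by
          have : Tendsto (fun α : ℝ => C / t * α) (𝓝 0) (𝓝 (C / t * 0)) := by
            apply Continuous.tendsto; fun_prop
          rw [mul_zero] at this
          exact this.mono_left nhdsWithin_le_nhds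
        refine squeeze_zero' (Eventually.of_forall fun α => sq_nonneg _) ?_ h2
        filter_upwards [hpos] with α hα
        have := hC α hα t ht'
        rw [Real.rpow_one, Real.rpow_one] at this
        rw [div_mul_eq_mul_div, le_div_iff₀ ht'.1]
        linarith
      · simp [eigenPart_eq_zero _ ht]
    · filter_upwards [hpos] with α hα t
      rw [Real.norm_of_nonneg (by positivity)]
      exact mul_norm_sq_eigenPart_le hinj (f := fun t => (1 - F α t * t) ^ 2)
        (g := fun _ => C₀ ^ 2) (fun t ht => hF.sq_residual_le hα ht) x t
  simpa using hsq.sqrt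

/-- This is where qualification strictly above one enters. The decay estimate with `ν = 1` only
bounds `t (1 - F t)² / α`, which provides the majorant; some `ν` between `1` and `ν₀` gives the
extra factor `α ^ (ν - 1)` that makes each term vanish. -/
lemma tendsto_norm_apply_sub_reg_div (hK : IsCompactOperator K) (hinj : Function.Injective K)
    (hF : IsRegFilter F (‖K‖ ^ 2) ν₀ C₀) (hν₀ : 1 < ν₀) (x : X) :
    Tendsto (fun α => ‖K (x - reg K F α (K x))‖ / √α) (𝓝[>] 0) (𝓝 0) := by
  have hsq : Tendsto (fun α => ‖K (x - reg K F α (K x))‖ ^ 2 / α) (𝓝[>] 0) (𝓝 0) := by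
    have hpos : ∀ᶠ α : ℝ in 𝓝[>] 0, 0 < α := eventually_mem_nhdsWithin
    obtain ⟨C, hC0, hC⟩ := hF.exists_decay (ν := 1) zero_le_one (by simpa using hν₀.le)
    obtain ⟨ν, hν1, hν2⟩ := EReal.exists_between_coe_real hν₀
    have hν1' : 1 < ν := by exact_mod_cast hν1
    obtain ⟨C', hC'0, hC'⟩ := hF.exists_decay (ν := ν) (by linarith) hν2.le
    have key := tendsto_tsum_of_dominated_convergence (𝓕 := 𝓝[>] (0 : ℝ))
      (f := fun α t => t * (1 - F α t * t) ^ 2 / α * ‖eigenPart (gram K) t x‖ ^ 2)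
      (g := fun _ => 0)
      ((hasSum_norm_sq_eigenPart (gram_isCompactOperator hK)
        (gram_isSymmetric K) x).summable.mul_left C) (fun t => ?_) ?_
    · rw [tsum_zero] at key
      refine key.congr' ?_
      filter_upwards [hpos] with α hα
      rw [← (hasSum_norm_sq_apply_sub_reg hK hinj hF hα x).tsum_eq, ← tsum_div_const]
      congr 1; ext t; ring
    · by_cases ht : Module.End.HasEigenvalue (gram K : X →ₗ[ℝ] X) t
      · have ht' := hasEigenvalue_gram_mem hinj ht
        have ht0 := ht'.1
        suffices hh : Tendsto (fun α => t * (1 - F α t * t) ^ 2 / α) (𝓝[>] 0) (𝓝 0) by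
          simpa using hh.mul_const (‖eigenPart (gram K) t x‖ ^ 2)
        have h2 : Tendsto (fun α : ℝ => C' / t ^ (ν - 1) * α ^ (ν - 1)) (𝓝[>] 0) (𝓝 0) := by
          simpa using (tendsto_rpow_nhdsGT_zero (sub_pos.mpr hν1')).const_mul (C' / t ^ (ν - 1))
        refine squeeze_zero' ?_ ?_ h2
        · filter_upwards [hpos] with α hα
          positivity
        filter_upwards [hpos] with α hα
        have := hC' α hα t ht'
        rw [Real.rpow_sub_one ht0.ne', Real.rpow_sub_one hα.ne']
        have htν : 0 < t ^ ν := Real.rpow_pos_of_pos ht0 _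
        calc t * (1 - F α t * t) ^ 2 / α = t / t ^ ν / α * (t ^ ν * (1 - F α t * t) ^ 2) := by
              field_simp
          _ ≤ t / t ^ ν / α * (C' * α ^ ν) := by gcongr
          _ = C' / (t ^ ν / t) * (α ^ ν / α) := by field_simp
      · simp [eigenPart_eq_zero _ ht]
    · filter_upwards [hpos] with α hα t
      by_cases ht : Module.End.HasEigenvalue (gram K : X →ₗ[ℝ] X) t
      · have ht' := hasEigenvalue_gram_mem hinj ht
        have ht0 := ht'.1
        rw [Real.norm_of_nonneg (by positivity)]
        have := hC α hα t ht'
        rw [Real.rpow_one, Real.rpow_one] at this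
        gcongr
        rw [div_le_iff₀ hα]
        exact this
      · simp [eigenPart_eq_zero _ ht]
  have := hsq.sqrt
  rw [Real.sqrt_zero] at this
  refine this.congr' ?_
  filter_upwards [eventually_mem_nhdsWithin] with α hα
  rw [Real.sqrt_div' _ (le_of_lt hα), Real.sqrt_sq (norm_nonneg _)]

lemma tendsto_pow_nhdsGT_zero {q : ℝ} (hq : q ∈ Ioo (0 : ℝ) 1) :
    Tendsto (fun k : ℕ => q ^ k) atTop (𝓝[>] 0) :=
  tendsto_nhdsWithin_iff.mpr ⟨tendsto_pow_atTop_nhds_zero_of_lt_one hq.1.le hq.2,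
    Eventually.of_forall fun k => pow_pos hq.1 k⟩

variable (hK : IsCompactOperator K) (hinj : Function.Injective K)
    (hdense : DenseRange K) (hF : IsRegFilter F (‖K‖ ^ 2) ν₀ C₀) (hν₀ : 1 < ν₀) (hC₀ : 0 ≤ C₀)
    {τ q σ : ℝ} (hq : q ∈ Ioo (0 : ℝ) 1) (hσ : C₀ * σ < τ)

include hK hinj hdense hF hν₀ hC₀ hq hσ

/-- The discrepancy principle stops if the data error is at most `2 σ δ` with `C₀ σ < τ`. -/
lemma exists_isDiscrepancyIndex (x : X) {δ : ℝ} (hδ : 0 < δ) (z : Y)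
    (hz : ‖z - K x‖ ≤ 2 * σ * δ) : ∃ k, IsDiscrepancyIndex K F τ q δ z k := by
  classical
  suffices h : ∃ k : ℕ, ‖K (reg K F (q ^ k) z) - z‖ ≤ 2 * τ * δ by
    exact ⟨Nat.find h, Nat.find_spec h, fun k hk => Nat.find_min' h hk⟩
  have h1 : Tendsto (fun α => ‖K (x - reg K F α (K x))‖) (𝓝[>] 0) (𝓝 0) := by
    have h := (((continuous_norm.comp K.continuous).tendsto 0).comp
      (tendsto_zero_iff_norm_tendsto_zero.mpr (tendsto_norm_sub_reg hK hinj hF hν₀ x)))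
    simpa [Function.comp_def] using h
  have h2 := (h1.comp (tendsto_pow_nhdsGT_zero hq)).eventually_lt_const
    (show 0 < 2 * (τ - C₀ * σ) * δ by have := sub_pos.mpr hσ; positivity)
  obtain ⟨k, hk⟩ := h2.exists
  refine ⟨k, (norm_residual_le hK hinj hdense hF hC₀ x (pow_pos hq.1 k) z).trans ?_⟩
  have : C₀ * ‖z - K x‖ ≤ C₀ * (2 * σ * δ) := by gcongr
  simp only [Function.comp_apply] at hk
  linarith

omit hν₀ hσ in
/-- Away from the first step, the bias at the previous step exceeds a multiple of the noise. -/
lemma lt_norm_bias_of_isDiscrepancyIndex (x : X) {δ : ℝ} (z : Y)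
    (hz : ‖z - K x‖ ≤ 2 * σ * δ) {k : ℕ} (hk : IsDiscrepancyIndex K F τ q δ z (k + 1)) :
    2 * (τ - C₀ * σ) * δ < ‖K (x - reg K F (q ^ k) (K x))‖ := by
  have h1 : ¬ ‖K (reg K F (q ^ k) z) - z‖ ≤ 2 * τ * δ := fun h => by
    have := hk.2 h
    omega
  have h2 := norm_residual_le hK hinj hdense hF hC₀ x (pow_pos hq.1 k) z
  have : C₀ * ‖z - K x‖ ≤ C₀ * (2 * σ * δ) := by gcongr
  linarith

omit hν₀ hσ in
lemma norm_bias_le_of_isDiscrepancyIndex (x : X) {δ : ℝ} (z : Y)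
    (hz : ‖z - K x‖ ≤ 2 * σ * δ) {k : ℕ} (hk : IsDiscrepancyIndex K F τ q δ z k) :
    ‖K (x - reg K F (q ^ k) (K x))‖ ≤ 2 * (τ + C₀ * σ) * δ := by
  have h1 : ‖K (reg K F (q ^ k) z) - z‖ ≤ 2 * τ * δ := hk.1
  have h2 := norm_bias_le hK hinj hdense hF hC₀ x (pow_pos hq.1 k) z
  have : C₀ * ‖z - K x‖ ≤ C₀ * (2 * σ * δ) := by gcongr
  linarith

/-- The discrepancy principle is a convergent regularisation method. -/
theorem eventually_norm_reg_sub_lt (hσ0 : 0 < σ) (x : X) {ε : ℝ} (hε : 0 < ε) :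
    ∀ᶠ δ in 𝓝[>] (0 : ℝ), ∀ z, ‖z - K x‖ ≤ 2 * σ * δ → ∀ k,
      IsDiscrepancyIndex K F τ q δ z k → ‖reg K F (q ^ k) z - x‖ < ε := by
  obtain ⟨D, hD0, hD⟩ := exists_norm_reg_le hK hinj hdense hF
  have hκ := sub_pos.mpr hσ
  have hq0 := hq.1
  set κ := τ - C₀ * σ
  have hη : 0 < ε / 2 / (D * σ / (√q * κ) + 1) := by positivity
  -- `η` is tuned so that the propagated noise is at most `ε / 2`; the summand `1` keeps it well
  -- defined and positive even if `D = 0`.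
  set η := ε / 2 / (D * σ / (√q * κ) + 1) with hηdef
  have e1 := (((tendsto_norm_sub_reg hK hinj hF hν₀ x).comp
    (tendsto_pow_nhdsGT_zero hq)).eventually_lt_const (show 0 < ε / 2 by positivity))
  have e2 := (((tendsto_norm_apply_sub_reg_div hK hinj hF hν₀ x).comp
    (tendsto_pow_nhdsGT_zero hq)).eventually_lt_const hη)
  obtain ⟨k₀, hk₀⟩ := eventually_atTop.mp (e1.and e2)
  -- For a fixed index `k` the parameter `q ^ k` does not shrink. Either the bias there is nonzero,
  -- and stopping at `k` is impossible for small `δ`; or it is zero, and by injectivity only the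
  -- propagated noise remains, which is a fixed multiple of `δ`. Finitely many such `k` are handled
  -- together.
  have hsmall : ∀ k : ℕ, ∀ᶠ δ in 𝓝[>] (0 : ℝ), ∀ z, ‖z - K x‖ ≤ 2 * σ * δ →
      IsDiscrepancyIndex K F τ q δ z k → ‖reg K F (q ^ k) z - x‖ < ε := by
    intro k
    have hlin : ∀ a : ℝ, Tendsto (fun δ : ℝ => a * δ) (𝓝[>] 0) (𝓝 0) := fun a => by
      have : Tendsto (fun δ : ℝ => a * δ) (𝓝 0) (𝓝 (a * 0)) := by
        apply Continuous.tendsto; fun_prop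
      rw [mul_zero] at this
      exact this.mono_left nhdsWithin_le_nhds
    by_cases h0 : K (x - reg K F (q ^ k) (K x)) = 0
    · have h0' : x - reg K F (q ^ k) (K x) = 0 := hinj (by rw [h0, map_zero])
      filter_upwards [(hlin (D / √(q ^ k) * (2 * σ))).eventually_lt_const hε] with δ hδ z hz _
      refine (norm_reg_sub_le hK hinj hF hD x (pow_pos hq.1 k) z).trans_lt ?_
      rw [h0', norm_zero, zero_add]
      refine lt_of_le_of_lt ?_ hδ
      rw [mul_assoc (D / √(q ^ k))]
      gcongr
    · have hpos : 0 < ‖K (x - reg K F (q ^ k) (K x))‖ := norm_pos_iff.mpr h0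
      filter_upwards [(hlin (2 * (τ + C₀ * σ))).eventually_lt_const hpos] with δ hδ z hz hk
      have := norm_bias_le_of_isDiscrepancyIndex hK hinj hdense hF hC₀ hq x z hz hk
      linarith
  have hall := (Finset.eventually_all (Finset.range (k₀ + 1))).mpr fun k _ => hsmall k
  filter_upwards [hall, eventually_mem_nhdsWithin] with δ h hδ z hz k hk
  by_cases hkk : k < k₀ + 1
  · exact h k (Finset.mem_range.mpr hkk) z hz hk
  obtain ⟨j, rfl⟩ : ∃ j, k = j + 1 := ⟨k - 1, by omega⟩
  have hj : k₀ ≤ j := by omega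
  have b1 := (hk₀ (j + 1) (by omega)).1
  have b2 := (hk₀ j hj).2
  simp only [Function.comp_apply] at b1 b2
  have hqj : 0 < q ^ j := pow_pos hq0 j
  have hsj : 0 < √(q ^ j) := Real.sqrt_pos.mpr hqj
  rw [div_lt_iff₀ hsj] at b2
  have b3 := lt_norm_bias_of_isDiscrepancyIndex hK hinj hdense hF hC₀ hq x z hz hk
  refine (norm_reg_sub_le hK hinj hF hD x (pow_pos hq0 _) z).trans_lt ?_
  -- The index `j = k - 1` failed the test, so `δ` is below the bias at `q ^ j`, which is less than
  -- `η * √(q ^ j)`. Passing from `q ^ j` to `q ^ k` costs only the factor `√q`.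
  have hδ' : δ ≤ η * √(q ^ j) / (2 * κ) := by
    rw [le_div_iff₀ (by positivity)]
    linarith
  have hsq : √(q ^ (j + 1)) = √q * √(q ^ j) := by
    rw [pow_succ', Real.sqrt_mul hq0.le]
  have hsqq : 0 < √q := Real.sqrt_pos.mpr hq0
  have : D / √(q ^ (j + 1)) * ‖z - K x‖ ≤ ε / 2 := by
    calc D / √(q ^ (j + 1)) * ‖z - K x‖ ≤ D / √(q ^ (j + 1)) * (2 * σ * δ) := by gcongr
      _ ≤ D / √(q ^ (j + 1)) * (2 * σ * (η * √(q ^ j) / (2 * κ))) := by gcongr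
      _ = D * σ / (√q * κ) * η := by rw [hsq]; field_simp
      _ ≤ (D * σ / (√q * κ) + 1) * η := by gcongr; linarith
      _ = ε / 2 := by rw [hηdef]; field_simp
  linarith

end Convergence

/-! ### Convergence rate under a source condition. -/

section Rate

variable {X Y : Type*} [NormedAddCommGroup X] [InnerProductSpace ℝ X] [CompleteSpace X]
  [NormedAddCommGroup Y] [InnerProductSpace ℝ Y] [CompleteSpace Y] {K : X →L[ℝ] Y}
  {F : ℝ → ℝ → ℝ} {ν₀ : EReal} {C₀ : ℝ}

lemma eigenPart_specFun_rpow (hK : IsCompactOperator K) (hinj : Function.Injective K)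
    {ν : ℝ} (hν : 0 < ν) (w : X) (t : ℝ) :
    ‖eigenPart (gram K) t (specFun (gram K) (fun t => t ^ (ν / 2)) w)‖ ^ 2 =
      t ^ ν * ‖eigenPart (gram K) t w‖ ^ 2 := by
  by_cases ht : Module.End.HasEigenvalue (gram K : X →ₗ[ℝ] X) t
  · have ht0 := (hasEigenvalue_gram_mem hinj ht).1
    rw [eigenPart_specFun (gram_isCompactOperator hK) (gram_isSymmetric K)
      (B := (‖K‖ ^ 2) ^ (ν / 2)), norm_smul, mul_pow, Real.norm_eq_abs, sq_abs,
      ← Real.rpow_natCast, ← Real.rpow_mul ht0.le]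
    · congr 2; push_cast; ring
    · intro s hs
      have := hasEigenvalue_gram_mem hinj hs
      rw [abs_of_nonneg (Real.rpow_nonneg this.1.le _)]
      exact Real.rpow_le_rpow this.1.le this.2 (by positivity)
  · simp [eigenPart_eq_zero _ ht]

lemma norm_sq_bias_le_of_source (hK : IsCompactOperator K) (hinj : Function.Injective K)
    (hF : IsRegFilter F (‖K‖ ^ 2) ν₀ C₀) {ν ρ C : ℝ} (hν : 0 < ν) (hC0 : 0 ≤ C)
    (hC : ∀ α > 0, ∀ t ∈ Ioc 0 (‖K‖ ^ 2),
      t ^ (ν + 1) * (1 - F α t * t) ^ 2 ≤ C * α ^ (ν + 1))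
    {x w : X} (hw : ‖w‖ ≤ ρ) (hx : x = specFun (gram K) (fun t => t ^ (ν / 2)) w)
    {α : ℝ} (hα : 0 < α) :
    ‖K (x - reg K F α (K x))‖ ^ 2 ≤ C * α ^ (ν + 1) * ρ ^ 2 := by
  have hαν : 0 < α ^ (ν + 1) := Real.rpow_pos_of_pos hα _
  have : ‖K (x - reg K F α (K x))‖ ^ 2 ≤ C * α ^ (ν + 1) * ‖w‖ ^ 2 := by
    refine hasSum_le (fun t => ?_) (hasSum_norm_sq_apply_sub_reg hK hinj hF hα x)
      ((hasSum_norm_sq_eigenPart (gram_isCompactOperator hK)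
        (gram_isSymmetric K) w).mul_left (C * α ^ (ν + 1)))
    rw [hx, eigenPart_specFun_rpow hK hinj hν, ← mul_assoc]
    refine mul_norm_sq_eigenPart_le hinj (f := fun t => t * (1 - F α t * t) ^ 2 * t ^ ν)
      (g := fun _ => C * α ^ (ν + 1)) (fun t ht => ?_) w t
    have := hC α hα t ht
    rw [Real.rpow_add_one ht.1.ne'] at this
    linarith
  refine this.trans ?_
  gcongr

/-- An interpolation inequality between the weak and the strong norm of the bias. -/
lemma norm_sq_sub_reg_le_of_source (hK : IsCompactOperator K) (hinj : Function.Injective K)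
    (hF : IsRegFilter F (‖K‖ ^ 2) ν₀ C₀) {ν ρ : ℝ} (hν : 0 < ν)
    {x w : X} (hw : ‖w‖ ≤ ρ) (hx : x = specFun (gram K) (fun t => t ^ (ν / 2)) w)
    {α : ℝ} (hα : 0 < α) {θ : ℝ} (hθ : 0 < θ) :
    ‖x - reg K F α (K x)‖ ^ 2 ≤
      θ ^ ν * C₀ ^ 2 * ρ ^ 2 + ‖K (x - reg K F α (K x))‖ ^ 2 / θ := by
  have hθν : 0 < θ ^ ν := Real.rpow_pos_of_pos hθ _
  have : ‖x - reg K F α (K x)‖ ^ 2 ≤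
      θ ^ ν * C₀ ^ 2 * ‖w‖ ^ 2 + θ⁻¹ * ‖K (x - reg K F α (K x))‖ ^ 2 := by
    refine hasSum_le (fun t => ?_) (hasSum_norm_sq_sub_reg hK hinj hF hα x)
      (((hasSum_norm_sq_eigenPart (gram_isCompactOperator hK)
        (gram_isSymmetric K) w).mul_left (θ ^ ν * C₀ ^ 2)).add
        ((hasSum_norm_sq_apply_sub_reg hK hinj hF hα x).mul_left θ⁻¹))
    rw [hx, eigenPart_specFun_rpow hK hinj hν]
    have h := mul_norm_sq_eigenPart_le hinj (f := fun t => (1 - F α t * t) ^ 2 * t ^ ν)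
      (g := fun t => θ ^ ν * C₀ ^ 2 + θ⁻¹ * (t * (1 - F α t * t) ^ 2 * t ^ ν)) (fun t ht => ?_) w t
    · linarith
    have ht0 := ht.1
    have htν : 0 < t ^ ν := Real.rpow_pos_of_pos ht0 _
    -- The spectrum is split at `θ`: below it the source factor `t ^ ν` is at most `θ ^ ν`, above it
    -- `1 ≤ t / θ` trades the strong norm for the weak one.
    rcases le_total t θ with h | h
    · have h1 : t ^ ν ≤ θ ^ ν := Real.rpow_le_rpow ht0.le h hν.le
      have h2 := hF.sq_residual_le hα ht
      have h3 : 0 ≤ θ⁻¹ * (t * (1 - F α t * t) ^ 2 * t ^ ν) := by positivity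
      calc (1 - F α t * t) ^ 2 * t ^ ν ≤ C₀ ^ 2 * θ ^ ν := by gcongr
        _ ≤ _ := by linarith
    · have h1 : 1 ≤ θ⁻¹ * t := by rwa [inv_mul_eq_div, one_le_div hθ]
      calc (1 - F α t * t) ^ 2 * t ^ ν = 1 * ((1 - F α t * t) ^ 2 * t ^ ν) := by ring
        _ ≤ θ⁻¹ * t * ((1 - F α t * t) ^ 2 * t ^ ν) := by gcongr
        _ ≤ θ ^ ν * C₀ ^ 2 + θ⁻¹ * (t * (1 - F α t * t) ^ 2 * t ^ ν) := by
          have : 0 ≤ θ ^ ν * C₀ ^ 2 := by positivity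
          linarith
  refine this.trans ?_
  rw [inv_mul_eq_div]
  gcongr

/-- The constant in the convergence rate of the discrepancy principle. -/
noncomputable def rateConst (C₀ D C τ σ q ν : ℝ) : ℝ :=
  √(C₀ ^ 2 + (2 * (τ + C₀ * σ)) ^ 2) + 2 * σ * D +
    2 * σ * D / √q * (√C / (2 * (τ - C₀ * σ))) ^ (1 / (ν + 1))

/-- The convergence rate of the discrepancy principle under a source condition. -/
theorem norm_reg_sub_le_rate (hK : IsCompactOperator K) (hinj : Function.Injective K)
    (hdense : DenseRange K) (hF : IsRegFilter F (‖K‖ ^ 2) ν₀ C₀) (hC₀ : 0 ≤ C₀)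
    {τ q σ : ℝ} (hq : q ∈ Ioo (0 : ℝ) 1) (hσ : C₀ * σ < τ) (hσ0 : 0 < σ)
    {D : ℝ} (hD0 : 0 ≤ D) (hD : ∀ α > 0, ∀ z, ‖reg K F α z‖ ≤ D / √α * ‖z‖)
    {ν ρ C : ℝ} (hν : 0 < ν) (hC0 : 0 ≤ C)
    (hC : ∀ α > 0, ∀ t ∈ Ioc 0 (‖K‖ ^ 2),
      t ^ (ν + 1) * (1 - F α t * t) ^ 2 ≤ C * α ^ (ν + 1))
    {x w : X} (hw : ‖w‖ ≤ ρ) (hx : x = specFun (gram K) (fun t => t ^ (ν / 2)) w)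
    {δ : ℝ} (hδ : 0 < δ) (hδρ : δ ≤ ρ) {z : Y} (hz : ‖z - K x‖ ≤ 2 * σ * δ) {k : ℕ}
    (hk : IsDiscrepancyIndex K F τ q δ z k) :
    ‖reg K F (q ^ k) z - x‖ ≤
      rateConst C₀ D C τ σ q ν * ρ ^ (1 / (ν + 1)) * δ ^ (ν / (ν + 1)) := by
  have hρ : 0 < ρ := hδ.trans_le hδρ
  have hν1 : 0 < ν + 1 := by linarith
  have hq0 := hq.1
  have hκ : 0 < τ - C₀ * σ := sub_pos.mpr hσ
  -- In the variable `u` the target rate is `ρ * u ^ ν` and `δ` is `u` times that. Taking `θ = u²`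
  -- in the interpolation makes both of its terms of order `(ρ * u ^ ν)²`.
  obtain ⟨u, hu0, hu⟩ : ∃ u : ℝ, 0 < u ∧ δ = ρ * u ^ (ν + 1) := by
    refine ⟨(δ / ρ) ^ (1 / (ν + 1)), Real.rpow_pos_of_pos (by positivity) _, ?_⟩
    rw [← Real.rpow_mul (by positivity), one_div_mul_cancel hν1.ne', Real.rpow_one]
    field_simp
  have huν : 0 < u ^ ν := Real.rpow_pos_of_pos hu0 _
  have hu1 : u ≤ 1 := by
    by_contra! h
    have := Real.one_lt_rpow h hν1
    nlinarith
  have hgoal : ρ ^ (1 / (ν + 1)) * δ ^ (ν / (ν + 1)) = ρ * u ^ ν := by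
    rw [hu, Real.mul_rpow hρ.le (by positivity), ← Real.rpow_mul hu0.le, ← mul_assoc,
      ← Real.rpow_add hρ, mul_div_cancel₀ _ hν1.ne', ← add_div, add_comm 1 ν,
      div_self hν1.ne', Real.rpow_one]
  rw [mul_assoc, hgoal]
  have hδu : δ = ρ * u ^ ν * u := by rw [hu, Real.rpow_add_one hu0.ne']; ring
  have hbias : ‖x - reg K F (q ^ k) (K x)‖ ≤
      √(C₀ ^ 2 + (2 * (τ + C₀ * σ)) ^ 2) * (ρ * u ^ ν) := by
    refine le_of_sq_le_sq ?_ (by positivity)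
    rw [mul_pow, Real.sq_sqrt (by positivity)]
    refine (norm_sq_sub_reg_le_of_source hK hinj hF hν hw hx (pow_pos hq0 k)
      (pow_pos hu0 2)).trans ?_
    have h1 := norm_bias_le_of_isDiscrepancyIndex hK hinj hdense hF hC₀ hq x z hz hk
    have h2 : (u ^ 2) ^ ν = (u ^ ν) ^ 2 := by
      rw [← Real.rpow_natCast, ← Real.rpow_natCast, ← Real.rpow_mul hu0.le,
        ← Real.rpow_mul hu0.le, mul_comm]
    rw [h2]
    have h3 : ‖K (x - reg K F (q ^ k) (K x))‖ ^ 2 / u ^ 2 ≤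
        (2 * (τ + C₀ * σ)) ^ 2 * (ρ * u ^ ν) ^ 2 := by
      rw [div_le_iff₀ (by positivity)]
      calc ‖K (x - reg K F (q ^ k) (K x))‖ ^ 2 ≤ (2 * (τ + C₀ * σ) * δ) ^ 2 := by gcongr
        _ = _ := by rw [hδu]; ring
    nlinarith
  have hnoise : D / √(q ^ k) * ‖z - K x‖ ≤ (2 * σ * D +
      2 * σ * D / √q * (√C / (2 * (τ - C₀ * σ))) ^ (1 / (ν + 1))) * (ρ * u ^ ν) := by
    have hG : 0 ≤ (√C / (2 * (τ - C₀ * σ))) ^ (1 / (ν + 1)) := by positivity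
    -- If the loop stops at once there is no earlier index to bound `δ`. Then `α = 1`, and `δ ≤ ρ`,
    -- that is `u ≤ 1`, suffices, with a constant free of `ρ`.
    rcases k with _ | j
    · calc D / √(q ^ 0) * ‖z - K x‖ ≤ D / √(q ^ 0) * (2 * σ * δ) := by gcongr
        _ = 2 * σ * D * (ρ * u ^ ν) * u := by rw [hδu]; simp; ring
        _ ≤ 2 * σ * D * (ρ * u ^ ν) * 1 := by gcongr
        _ ≤ _ := by
          rw [add_mul, mul_one]
          have : 0 ≤ 2 * σ * D / √q * (√C / (2 * (τ - C₀ * σ))) ^ (1 / (ν + 1)) *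
            (ρ * u ^ ν) := by positivity
          linarith
    · have h1 := lt_norm_bias_of_isDiscrepancyIndex hK hinj hdense hF hC₀ hq x z hz hk
      have hqj : 0 < q ^ j := pow_pos hq0 j
      have hs : 0 < √(q ^ j) := Real.sqrt_pos.mpr hqj
      have hsqq : 0 < √q := Real.sqrt_pos.mpr hq0
      have h2 := norm_sq_bias_le_of_source hK hinj hF hν hC0 hC hw hx hqj
      have h3 : ‖K (x - reg K F (q ^ j) (K x))‖ ≤ √C * √(q ^ j) ^ (ν + 1) * ρ := by
        refine le_of_sq_le_sq (h2.trans_eq ?_) (by positivity)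
        rw [mul_pow, mul_pow, Real.sq_sqrt hC0, ← Real.rpow_natCast (_ ^ (ν + 1)),
          ← Real.rpow_mul hs.le, mul_comm (ν + 1), Real.rpow_mul hs.le, Real.rpow_natCast,
          Real.sq_sqrt hqj.le]
      have h4 : u ^ (ν + 1) ≤ √C / (2 * (τ - C₀ * σ)) * √(q ^ j) ^ (ν + 1) := by
        rw [div_mul_eq_mul_div, le_div_iff₀ (by positivity)]
        have : 2 * (τ - C₀ * σ) * δ ≤ √C * √(q ^ j) ^ (ν + 1) * ρ := by linarith
        rw [hu] at this
        refine le_of_mul_le_mul_right ?_ hρ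
        linarith
      -- The lower and upper bounds for the bias at `q ^ j` show that `√α` is at least a multiple of
      -- `u`, so `δ / √α` is of order `δ / u = ρ * u ^ ν`.
      have h5 : u ≤ (√C / (2 * (τ - C₀ * σ))) ^ (1 / (ν + 1)) * √(q ^ j) := by
        have := Real.rpow_le_rpow (by positivity) h4 (show 0 ≤ 1 / (ν + 1) by positivity)
        rwa [Real.mul_rpow (by positivity) (by positivity), ← Real.rpow_mul hu0.le,
          ← Real.rpow_mul hs.le, mul_one_div_cancel hν1.ne', Real.rpow_one, Real.rpow_one] at this
      have hsq : √(q ^ (j + 1)) = √q * √(q ^ j) := by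
        rw [pow_succ', Real.sqrt_mul hq0.le]
      calc D / √(q ^ (j + 1)) * ‖z - K x‖ ≤ D / √(q ^ (j + 1)) * (2 * σ * δ) := by gcongr
        _ = 2 * σ * D / √q * (ρ * u ^ ν) / √(q ^ j) * u := by
          rw [hδu, hsq]; field_simp
        _ ≤ 2 * σ * D / √q * (ρ * u ^ ν) / √(q ^ j) *
            ((√C / (2 * (τ - C₀ * σ))) ^ (1 / (ν + 1)) * √(q ^ j)) := by gcongr
        _ = 2 * σ * D / √q * (√C / (2 * (τ - C₀ * σ))) ^ (1 / (ν + 1)) * (ρ * u ^ ν) := by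
          field_simp
        _ ≤ _ := by
          rw [add_mul]
          have : 0 ≤ 2 * σ * D * (ρ * u ^ ν) := by positivity
          linarith
  have := norm_reg_sub_le hK hinj hF hD x (pow_pos hq0 k) z
  rw [rateConst]
  linarith

end Rate

/-! ### The generalised inverses of `K` and of the discretisation operator. -/

section GeneralisedInverse

lemma pinv_apply_self {X Y : Type*} [NormedAddCommGroup X] [InnerProductSpace ℝ X]
    [NormedAddCommGroup Y] [InnerProductSpace ℝ Y] {K : X →L[ℝ] Y}
    (hinj : Function.Injective K) (x : X) : pinv K (K x) = x := by
  have hls : ∀ z, IsLeastSquares K (K x) z → z = x := fun z hz => by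
    have := hz x
    rw [sub_self, norm_zero, norm_le_zero_iff, sub_eq_zero] at this
    exact hinj this
  have h : ∃ z, IsMinNormLeastSquares K (K x) z :=
    ⟨x, fun z => by simp, fun z hz => by rw [hls z hz]⟩
  rw [pinv, dif_pos h]
  exact hls _ h.choose_spec.1

lemma exists_eq_apply_of_mem_pinvDomain {X Y : Type*} [NormedAddCommGroup X]
    [InnerProductSpace ℝ X] [NormedAddCommGroup Y] [InnerProductSpace ℝ Y] [CompleteSpace Y]
    {K : X →L[ℝ] Y} (hdense : DenseRange K) {y : Y} (hy : y ∈ pinvDomain K) :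
    ∃ x, y = K x := by
  have h : (LinearMap.range (K : X →ₗ[ℝ] Y))ᗮ = ⊥ := by
    rw [← Submodule.topologicalClosure_eq_top_iff, ← Submodule.dense_iff_topologicalClosure_eq_top]
    exact hdense
  rw [pinvDomain, h, sup_bot_eq] at hy
  obtain ⟨x, hx⟩ := hy
  exact ⟨x, hx.symm⟩

variable {Y G : Type*} [NormedAddCommGroup Y] [InnerProductSpace ℝ Y] [CompleteSpace Y]
  [NormedAddCommGroup G] [InnerProductSpace ℝ G] [CompleteSpace G]

/-- `P^* u` is orthogonal to the kernel of `P`, so by Pythagoras it is the unique solution of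
minimal norm. Uniqueness is essential because `pinv` is defined by choice. When `P P^*` is
surjective this describes `pinv P` completely, and makes it additive. -/
lemma pinv_apply_gram {P : Y →L[ℝ] G} (u : G) :
    pinv P (P (ContinuousLinearMap.adjoint P u)) = ContinuousLinearMap.adjoint P u := by
  set y := ContinuousLinearMap.adjoint P u with hy
  have hpyth : ∀ z, P z = P y → ‖z‖ ^ 2 = ‖y‖ ^ 2 + ‖z - y‖ ^ 2 := fun z hz => by
    have h0 : ⟪y, z - y⟫_ℝ = 0 := by
      rw [hy, ContinuousLinearMap.adjoint_inner_left, map_sub, hz, sub_self, inner_zero_right]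
    have := norm_add_sq_real y (z - y)
    rw [h0, add_sub_cancel] at this
    linarith
  have hls : ∀ z, IsLeastSquares P (P y) z → P z = P y := fun z hz => by
    have := hz y
    rwa [sub_self, norm_zero, norm_le_zero_iff, sub_eq_zero] at this
  have h : ∃ z, IsMinNormLeastSquares P (P y) z := by
    refine ⟨y, fun z => by simp, fun z hz => ?_⟩
    have := hpyth z (hls z hz)
    exact le_of_sq_le_sq (by nlinarith [sq_nonneg ‖z - y‖]) (norm_nonneg _)
  rw [pinv, dif_pos h]
  have h1 := h.choose_spec.1
  have h2 := h.choose_spec.2 y (fun z => by simp)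
  have h3 := hpyth _ (hls _ h1)
  have h4 : ‖h.choose - y‖ ^ 2 ≤ 0 := by
    have : ‖h.choose‖ ^ 2 ≤ ‖y‖ ^ 2 := by gcongr
    linarith
  have h5 : ‖h.choose - y‖ = 0 := by
    nlinarith [norm_nonneg (h.choose - y), sq_nonneg ‖h.choose - y‖,
      pow_eq_zero_iff (two_ne_zero) |>.mp (le_antisymm h4 (sq_nonneg _))]
  exact sub_eq_zero.mp (norm_eq_zero.mp h5)

lemma pinv_add {P : Y →L[ℝ] G}
    (hP : Function.Surjective (P ∘L ContinuousLinearMap.adjoint P)) (v w : G) :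
    pinv P (v + w) = pinv P v + pinv P w := by
  obtain ⟨a, rfl⟩ := hP v
  obtain ⟨b, rfl⟩ := hP w
  rw [← map_add]
  simp only [ContinuousLinearMap.comp_apply]
  rw [pinv_apply_gram, pinv_apply_gram, pinv_apply_gram, map_add]

/-- With `S = P P^*` and `v = S u`, the squared norm of `P⁺ v` is `⟪S u, u⟫`, and in an eigenbasis
of `S`, whose eigenvalues are at least `c²`, `c² ⟪S u, u⟫ ≤ ‖S u‖²`. -/
lemma norm_pinv_le [FiniteDimensional ℝ G] {P : Y →L[ℝ] G}
    (hP : Function.Bijective (P ∘L ContinuousLinearMap.adjoint P)) {c : ℝ} (hc : 0 < c)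
    (hσ : ∀ σ, IsSingularValue P σ → c ≤ σ) (v : G) : ‖pinv P v‖ ≤ ‖v‖ / c := by
  obtain ⟨u, rfl⟩ := hP.2 v
  set S : G →ₗ[ℝ] G := ((P ∘L ContinuousLinearMap.adjoint P : G →L[ℝ] G) : G →ₗ[ℝ] G) with hS
  have hinner : ∀ a b : G, ⟪S a, b⟫_ℝ =
      ⟪ContinuousLinearMap.adjoint P a, ContinuousLinearMap.adjoint P b⟫_ℝ := fun a b => by
    rw [ContinuousLinearMap.adjoint_inner_right]; rfl
  have hsymm : S.IsSymmetric := fun a b => by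
    rw [hinner, real_inner_comm, ← hinner b a, real_inner_comm]
  have hnorm : ‖pinv P ((P ∘L ContinuousLinearMap.adjoint P) u)‖ ^ 2 = ⟪S u, u⟫_ℝ := by
    rw [ContinuousLinearMap.comp_apply, pinv_apply_gram, hinner, real_inner_self_eq_norm_sq]
  have hev : ∀ i, c ^ 2 ≤ hsymm.eigenvalues rfl i := fun i => by
    have h1 := hsymm.hasEigenvalue_eigenvalues rfl i
    obtain ⟨e, he⟩ := h1.exists_hasEigenvector
    have he0 : 0 < ‖e‖ ^ 2 := by have := he.2; positivity
    have h2 := hinner e e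
    rw [he.apply_eq_smul, real_inner_smul_left, real_inner_self_eq_norm_sq,
      real_inner_self_eq_norm_sq] at h2
    have hpos : 0 < hsymm.eigenvalues rfl i := by
      have h3 : 0 ≤ hsymm.eigenvalues rfl i := by
        by_contra! h
        exact absurd h2 (((mul_neg_of_neg_of_pos h he0).trans_le (sq_nonneg _)).ne)
      refine lt_of_le_of_ne h3 fun h => ?_
      have h4 : S e = 0 := by rw [he.apply_eq_smul]; simp [← h]
      exact he.2 (hP.1 (by rw [map_zero]; exact h4))
    have := hσ (√(hsymm.eigenvalues rfl i)) ⟨Real.sqrt_pos.mpr hpos, by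
      rw [Real.sq_sqrt hpos.le]; exact h1⟩
    calc c ^ 2 ≤ √(hsymm.eigenvalues rfl i) ^ 2 := by gcongr
      _ = _ := Real.sq_sqrt hpos.le
  have hco : ∀ i, ⟪hsymm.eigenvectorBasis rfl i, S u⟫_ℝ =
      hsymm.eigenvalues rfl i * ⟪hsymm.eigenvectorBasis rfl i, u⟫_ℝ := fun i => by
    rw [← hsymm, hsymm.apply_eigenvectorBasis, real_inner_smul_left]; rfl
  have key : c ^ 2 * ⟪S u, u⟫_ℝ ≤ ‖S u‖ ^ 2 := by
    rw [← (hsymm.eigenvectorBasis rfl).sum_inner_mul_inner (S u) u,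
      ← (hsymm.eigenvectorBasis rfl).sum_sq_norm_inner_right (S u), Finset.mul_sum]
    refine Finset.sum_le_sum fun i _ => ?_
    rw [real_inner_comm, Real.norm_eq_abs, sq_abs, hco]
    have h1 := hev i
    have h2 : 0 ≤ hsymm.eigenvalues rfl i := (sq_nonneg c).trans h1
    have h3 := mul_le_mul_of_nonneg_right h1
      (mul_nonneg h2 (sq_nonneg ⟪hsymm.eigenvectorBasis rfl i, u⟫_ℝ))
    linarith
  refine le_of_sq_le_sq ?_ (by positivity)
  rw [hnorm, div_pow, le_div_iff₀ (by positivity)]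
  have : (P ∘L ContinuousLinearMap.adjoint P) u = S u := rfl
  rw [this]
  linarith

end GeneralisedInverse

/-! ### Algebra of sums of squared deviations. -/

section Samples

/-- The weight keeps the constant of the main term near one, at the expense of the small
perturbation `y`. -/
lemma sq_add_le_of_pos {κ : ℝ} (hκ : 0 < κ) (x y : ℝ) :
    (x + y) ^ 2 ≤ (1 + κ) * x ^ 2 + (1 + 1 / κ) * y ^ 2 := by
  have h : (1 + κ) * x ^ 2 + (1 + 1 / κ) * y ^ 2 - (x + y) ^ 2 = (κ * x - y) ^ 2 / κ := by
    field_simp; ring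
  have : 0 ≤ (κ * x - y) ^ 2 / κ := by positivity
  linarith

variable {ι : Type*} (s : Finset ι)

lemma sum_sub_mean_sq (x : ι → ℝ) :
    ∑ i ∈ s, (x i - (∑ i ∈ s, x i) / s.card) ^ 2 =
      ∑ i ∈ s, x i ^ 2 - (∑ i ∈ s, x i) ^ 2 / s.card := by
  rcases s.eq_empty_or_nonempty with rfl | hs
  · simp
  have hc : (s.card : ℝ) ≠ 0 := by exact_mod_cast hs.card_pos.ne'
  simp only [sub_sq, Finset.sum_add_distrib, Finset.sum_sub_distrib, Finset.sum_const,
    nsmul_eq_mul, ← Finset.sum_mul, ← Finset.mul_sum]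
  field_simp
  ring

lemma sum_sub_mean_sq_le (x : ι → ℝ) (c : ℝ) :
    ∑ i ∈ s, (x i - (∑ i ∈ s, x i) / s.card) ^ 2 ≤ ∑ i ∈ s, (x i - c) ^ 2 := by
  rcases s.eq_empty_or_nonempty with rfl | hs
  · simp
  have hc : 0 < (s.card : ℝ) := by exact_mod_cast hs.card_pos
  rw [sum_sub_mean_sq]
  simp only [sub_sq, Finset.sum_add_distrib, Finset.sum_sub_distrib, Finset.sum_const,
    nsmul_eq_mul, ← Finset.sum_mul, ← Finset.mul_sum]
  have : 0 ≤ (∑ i ∈ s, x i - s.card * c) ^ 2 / s.card := by positivity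
  have h2 : (∑ i ∈ s, x i - s.card * c) ^ 2 / s.card =
    (∑ i ∈ s, x i) ^ 2 / s.card - 2 * (∑ i ∈ s, x i) * c + s.card * c ^ 2 := by
    field_simp
    ring
  linarith

lemma sum_sum_sub_sq (x : ι → ℝ) :
    ∑ i ∈ s, ∑ k ∈ s, (x i - x k) ^ 2 =
      2 * s.card * ∑ i ∈ s, (x i - (∑ i ∈ s, x i) / s.card) ^ 2 := by
  rcases s.eq_empty_or_nonempty with rfl | hs
  · simp
  have hc : (s.card : ℝ) ≠ 0 := by exact_mod_cast hs.card_pos.ne'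
  rw [sum_sub_mean_sq]
  simp only [sub_sq, Finset.sum_add_distrib, Finset.sum_sub_distrib, Finset.sum_const,
    nsmul_eq_mul, ← Finset.sum_mul, ← Finset.mul_sum]
  field_simp
  ring

/-- By `sum_sum_sub_sq` the squared deviations are determined by the pairwise differences, so a
pathwise contraction, such as truncation, decreases them. -/
lemma sum_sub_mean_sq_le_of_contraction {x y : ι → ℝ} (h : ∀ i k, |y i - y k| ≤ |x i - x k|) :
    ∑ i ∈ s, (y i - (∑ i ∈ s, y i) / s.card) ^ 2 ≤
      ∑ i ∈ s, (x i - (∑ i ∈ s, x i) / s.card) ^ 2 := by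
  rcases s.eq_empty_or_nonempty with rfl | hs
  · simp
  have hc : 0 < 2 * (s.card : ℝ) := by have := hs.card_pos; positivity
  refine le_of_mul_le_mul_left ?_ hc
  rw [← sum_sum_sub_sq, ← sum_sum_sub_sq]
  exact Finset.sum_le_sum fun i _ => Finset.sum_le_sum fun k _ => sq_le_sq.mpr (h i k)

end Samples

/-! ### Scatter and channel means of an array of samples. -/

section Arrays

variable {m : ℕ}

/-- The sum of the squares of the first `n` samples over all channels. -/
def sumSq (x : ℕ → Fin m → ℝ) (n : ℕ) : ℝ :=
  ∑ j, ∑ i ∈ Finset.range n, x i j ^ 2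

/-- `n` times the squared norm of the vector of channel means. -/
noncomputable def meanSq (x : ℕ → Fin m → ℝ) (n : ℕ) : ℝ :=
  ∑ j, (∑ i ∈ Finset.range n, x i j) ^ 2 / n

/-- The sum of the squared deviations from the channel means. -/
noncomputable def scatter (x : ℕ → Fin m → ℝ) (n : ℕ) : ℝ :=
  ∑ j, ∑ i ∈ Finset.range n, (x i j - (∑ i ∈ Finset.range n, x i j) / n) ^ 2

lemma meanSq_nonneg (x : ℕ → Fin m → ℝ) (n : ℕ) : 0 ≤ meanSq x n :=
  Finset.sum_nonneg fun _ _ => by positivity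

lemma scatter_nonneg (x : ℕ → Fin m → ℝ) (n : ℕ) : 0 ≤ scatter x n :=
  Finset.sum_nonneg fun _ _ => by positivity

lemma scatter_eq (x : ℕ → Fin m → ℝ) (n : ℕ) : scatter x n = sumSq x n - meanSq x n := by
  rw [scatter, sumSq, meanSq, ← Finset.sum_sub_distrib]
  refine Finset.sum_congr rfl fun j _ => ?_
  simpa using sum_sub_mean_sq (Finset.range n) (fun i => x i j)

lemma scatter_le_sumSq (x : ℕ → Fin m → ℝ) (n : ℕ) : scatter x n ≤ sumSq x n := by
  have := meanSq_nonneg x n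
  rw [scatter_eq]; linarith

/-- The mean of the first `n` samples minimises the sum of their squared deviations, so replacing it
by the mean of `n + 1` samples does not decrease the sum; the additional term is nonnegative. -/
lemma scatter_mono (x : ℕ → Fin m → ℝ) : Monotone (scatter x) := by
  refine monotone_nat_of_le_succ fun n => Finset.sum_le_sum fun j _ => ?_
  have h := sum_sub_mean_sq_le (Finset.range n) (fun i => x i j)
    ((∑ i ∈ Finset.range (n + 1), x i j) / (n + 1 : ℕ))
  rw [Finset.card_range] at h
  refine h.trans (Finset.sum_le_sum_of_subset_of_nonneg ?_ fun _ _ _ => sq_nonneg _)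
  exact Finset.range_subset_range.mpr n.le_succ

lemma scatter_le_of_contraction {x y : ℕ → Fin m → ℝ}
    (h : ∀ i k j, |y i j - y k j| ≤ |x i j - x k j|) (n : ℕ) : scatter y n ≤ scatter x n :=
  Finset.sum_le_sum fun j _ => by
    simpa using sum_sub_mean_sq_le_of_contraction (Finset.range n)
      (x := fun i => x i j) (y := fun i => y i j) fun i k => h i k j

lemma scatter_const_add (a : Fin m → ℝ) (x : ℕ → Fin m → ℝ) (n : ℕ) :
    scatter (fun i j => a j + x i j) n = scatter x n := by
  refine le_antisymm (scatter_le_of_contraction (fun i k j => ?_) n)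
    (scatter_le_of_contraction (fun i k j => ?_) n) <;> simp

lemma scatter_add_le {κ : ℝ} (hκ : 0 < κ) (x y : ℕ → Fin m → ℝ) (n : ℕ) :
    scatter (fun i j => x i j + y i j) n ≤
      (1 + κ) * scatter x n + (1 + 1 / κ) * scatter y n := by
  simp only [scatter, Finset.mul_sum, ← Finset.sum_add_distrib]
  refine Finset.sum_le_sum fun j _ => Finset.sum_le_sum fun i _ => ?_
  rw [Finset.sum_add_distrib, add_div, add_sub_add_comm]
  exact sq_add_le_of_pos hκ _ _

lemma meanSq_add_le {κ : ℝ} (hκ : 0 < κ) (x y : ℕ → Fin m → ℝ) (n : ℕ) :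
    meanSq (fun i j => x i j + y i j) n ≤
      (1 + κ) * meanSq x n + (1 + 1 / κ) * meanSq y n := by
  simp only [meanSq, Finset.mul_sum, ← Finset.sum_add_distrib]
  refine Finset.sum_le_sum fun j _ => ?_
  rw [Finset.sum_add_distrib, ← mul_div_assoc, ← mul_div_assoc, ← add_div]
  gcongr
  exact sq_add_le_of_pos hκ _ _

lemma mul_sampleVariance (hm : 0 < m) (x : ℕ → Fin m → ℝ) {n : ℕ} :
    m * sampleVariance x n = scatter x n / ((n : ℝ) - 1) := by
  have hm' : (m : ℝ) ≠ 0 := by exact_mod_cast hm.ne'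
  rw [sampleVariance, scatter, Finset.sum_div, ← mul_assoc, mul_one_div_cancel hm', one_mul]
  refine Finset.sum_congr rfl fun j _ => ?_
  rw [one_div_mul_eq_div]
  simp only [sampleMean, one_div_mul_eq_div]

lemma norm_sq_sampleMean (x : ℕ → Fin m → ℝ) {n : ℕ} :
    ‖sampleMean x n‖ ^ 2 = meanSq x n / n := by
  rw [EuclideanSpace.norm_sq_eq, meanSq, Finset.sum_div]
  refine Finset.sum_congr rfl fun j _ => ?_
  simp only [sampleMean, one_div_mul_eq_div, Real.norm_eq_abs, sq_abs]
  rw [div_pow, div_div, ← sq]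

lemma sampleMean_const_add (a : Fin m → ℝ) (x : ℕ → Fin m → ℝ) {n : ℕ} (hn : 0 < n) :
    sampleMean (fun i j => a j + x i j) n = WithLp.toLp 2 a + sampleMean x n := by
  have hn' : (n : ℝ) ≠ 0 := by exact_mod_cast hn.ne'
  ext j
  simp only [sampleMean, PiLp.add_apply, Finset.sum_add_distrib, Finset.sum_const,
    Finset.card_range, nsmul_eq_mul]
  field_simp

end Arrays

/-! ### Second and fourth moments of sums of independent variables. -/

section Moments

variable {Ω : Type*} [MeasurableSpace Ω] {μ : Measure Ω} [IsProbabilityMeasure μ]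

section Sums

variable {ι : Type*} {X : ι → Ω → ℝ}

lemma integral_sum_sq (hX : iIndepFun X μ) (h2 : ∀ i, MemLp (X i) 2 μ)
    (h0 : ∀ i, ∫ ω, X i ω ∂μ = 0) (t : Finset ι) :
    ∫ ω, (∑ i ∈ t, X i ω) ^ 2 ∂μ = ∑ i ∈ t, ∫ ω, X i ω ^ 2 ∂μ := by
  have hv := IndepFun.variance_sum (s := t) (fun i _ => h2 i)
    (fun i _ j _ hij => hX.indepFun hij)
  have hmean : ∫ ω, (∑ i ∈ t, X i) ω ∂μ = 0 := by
    simp only [Finset.sum_apply]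
    rw [integral_finsetSum _ fun i _ => (h2 i).integrable one_le_two]
    exact Finset.sum_eq_zero fun i _ => h0 i
  rw [variance_of_integral_eq_zero (Finset.aemeasurable_sum _ fun i _ => (h2 i).1.aemeasurable)
    hmean] at hv
  simp only [Finset.sum_apply] at hv
  rw [hv]
  exact Finset.sum_congr rfl fun i _ => variance_of_integral_eq_zero (h2 i).1.aemeasurable (h0 i)

lemma integral_sq_sum_sub_le {Z : ι → Ω → ℝ} {t : Finset ι} {a M : ℝ}
    (hZ : ∀ i ∈ t, MemLp (Z i) 2 μ)
    (hind : Set.Pairwise ↑t fun i j => IndepFun (Z i) (Z j) μ)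
    (hmean : ∀ i ∈ t, ∫ ω, Z i ω ∂μ = a) (hM : ∀ i ∈ t, ∫ ω, Z i ω ^ 2 ∂μ ≤ M) :
    ∫ ω, (∑ i ∈ t, Z i ω - t.card * a) ^ 2 ∂μ ≤ t.card * M := by
  have hv := IndepFun.variance_sum hZ hind
  have hm : ∫ ω, (∑ i ∈ t, Z i) ω ∂μ = t.card * a := by
    simp only [Finset.sum_apply]
    rw [integral_finsetSum _ fun i hi => (hZ i hi).integrable one_le_two,
      Finset.sum_congr rfl hmean, Finset.sum_const, nsmul_eq_mul]
  rw [variance_eq_integral (Finset.aemeasurable_sum _ fun i hi => (hZ i hi).1.aemeasurable),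
    hm] at hv
  simp only [Finset.sum_apply] at hv
  rw [hv, ← nsmul_eq_mul, ← Finset.sum_const]
  refine Finset.sum_le_sum fun i hi => (variance_le_expectation_sq (hZ i hi).1).trans ?_
  exact hM i hi

omit [IsProbabilityMeasure μ] in
lemma integrable_pow_mul_pow {f g : Ω → ℝ} (hf : MemLp f 4 μ) (hg : MemLp g 4 μ) {a b : ℕ}
    (hab : a + b = 4) : Integrable (fun ω => f ω ^ a * g ω ^ b) μ := by
  have h4 : ∀ {f : Ω → ℝ}, MemLp f 4 μ → Integrable (fun ω => f ω ^ 4) μ := fun hf => by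
    have := hf.integrable_norm_pow (p := 4) (by norm_num)
    refine this.congr (Eventually.of_forall fun ω => ?_)
    simp only [Real.norm_eq_abs]
    exact Even.pow_abs (by decide) _
  refine ((h4 hf).add (h4 hg)).mono' ((hf.1.pow a).mul (hg.1.pow b))
    (Eventually.of_forall fun ω => ?_)
  simp only [Pi.add_apply, Real.norm_eq_abs, abs_mul, abs_pow]
  rw [← Even.pow_abs (by decide : Even 4) (f ω), ← Even.pow_abs (by decide : Even 4) (g ω)]
  have hf0 := abs_nonneg (f ω)
  have hg0 := abs_nonneg (g ω)
  rcases le_total |f ω| |g ω| with h | h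
  · calc |f ω| ^ a * |g ω| ^ b ≤ |g ω| ^ a * |g ω| ^ b := by gcongr
      _ = |g ω| ^ 4 := by rw [← pow_add, hab]
      _ ≤ _ := by have := pow_nonneg hf0 4; linarith
  · calc |f ω| ^ a * |g ω| ^ b ≤ |f ω| ^ a * |f ω| ^ b := by gcongr
      _ = |f ω| ^ 4 := by rw [← pow_add, hab]
      _ ≤ _ := by have := pow_nonneg hg0 4; linarith

/-- In the expansion of `(A + X k)⁴` the terms of odd degree in `X k` vanish by independence and
centring. The middle term adds `6 |t| s²`, which is at most `3 ((|t| + 1)² - |t|²) s²`. -/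
lemma integral_sum_pow_four_le (hX : iIndepFun X μ) (hmeas : ∀ i, Measurable (X i))
    (h4 : ∀ i, MemLp (X i) 4 μ) (h0 : ∀ i, ∫ ω, X i ω ∂μ = 0) {s M : ℝ}
    (h2 : ∀ i, ∫ ω, X i ω ^ 2 ∂μ = s) (hM : ∀ i, ∫ ω, X i ω ^ 4 ∂μ ≤ M) (t : Finset ι) :
    ∫ ω, (∑ i ∈ t, X i ω) ^ 4 ∂μ ≤ 3 * (t.card : ℝ) ^ 2 * s ^ 2 + t.card * M := by
  classical
  have h42 : ∀ i, MemLp (X i) 2 μ := fun i => (h4 i).mono_exponent (by norm_num)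
  induction t using Finset.induction_on with
  | empty => simp
  | insert k t hk ih =>
    have hA : MemLp (fun ω => ∑ i ∈ t, X i ω) 4 μ := memLp_finsetSum _ fun i _ => h4 i
    have hind : IndepFun (fun ω => ∑ i ∈ t, X i ω) (X k) μ := by
      have := hX.indepFun_finsetSum_of_notMem hmeas hk
      convert this using 1
      ext ω; simp
    set A : Ω → ℝ := fun ω => ∑ i ∈ t, X i ω with hAdef
    have hexp : ∀ ω, (∑ i ∈ insert k t, X i ω) ^ 4 = A ω ^ 4 * X k ω ^ 0 +
        4 * (A ω ^ 3 * X k ω ^ 1) + 6 * (A ω ^ 2 * X k ω ^ 2) + 4 * (A ω ^ 1 * X k ω ^ 3)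
        + A ω ^ 0 * X k ω ^ 4 := fun ω => by
      rw [Finset.sum_insert hk]; simp only [hAdef]; ring
    have hi : ∀ {a b : ℕ}, a + b = 4 → Integrable (fun ω => A ω ^ a * X k ω ^ b) μ :=
      fun h => integrable_pow_mul_pow hA (h4 k) h
    have hprod : ∀ a b : ℕ, ∫ ω, A ω ^ a * X k ω ^ b ∂μ =
        (∫ ω, A ω ^ a ∂μ) * ∫ ω, X k ω ^ b ∂μ := fun a b => by
      have := hind.comp (φ := fun x => x ^ a) (ψ := fun x => x ^ b) (by fun_prop) (by fun_prop)
      exact this.integral_fun_mul_eq_mul_integral (hA.1.pow a) ((h4 k).1.pow b)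
    have hA1 : ∫ ω, A ω ^ 1 ∂μ = 0 := by
      simp only [pow_one, hAdef]
      rw [integral_finsetSum _ fun i _ => (h42 i).integrable one_le_two]
      exact Finset.sum_eq_zero fun i _ => h0 i
    have hA2 : ∫ ω, A ω ^ 2 ∂μ = t.card * s := by
      rw [hAdef, integral_sum_sq hX h42 h0, Finset.sum_congr rfl fun i _ => h2 i,
        Finset.sum_const, nsmul_eq_mul]
    have hX1 : ∫ ω, X k ω ^ 1 ∂μ = 0 := by simpa using h0 k
    simp only [hexp]
    rw [integral_add, integral_add, integral_add, integral_add, integral_const_mul,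
      integral_const_mul, integral_const_mul, hprod 3 1, hprod 2 2, hprod 1 3, hA1, hX1, hA2, h2]
    · simp only [pow_zero, mul_one, one_mul, mul_zero, zero_mul, add_zero]
      rw [Finset.card_insert_of_notMem hk]
      push_cast
      have := hM k
      have hs : 0 ≤ s ^ 2 := sq_nonneg s
      nlinarith
    all_goals
      repeat' apply Integrable.add
    all_goals first
      | exact hi rfl
      | exact (hi rfl).const_mul _

end Sums

end Moments

/-! ### Markov and Chebyshev bounds for scatter and channel means. -/

section Concentration

variable {Ω : Type*} [MeasurableSpace Ω] {μ : Measure Ω} [IsProbabilityMeasure μ]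

omit [IsProbabilityMeasure μ] in
lemma measureReal_le_div_of_integral_le {f : Ω → ℝ} (hf0 : ∀ ω, 0 ≤ f ω) (hf : Integrable f μ)
    {V c : ℝ} (hV : ∫ ω, f ω ∂μ ≤ V) (hc : 0 < c) : μ.real {ω | c ≤ f ω} ≤ V / c := by
  rw [le_div_iff₀ hc, mul_comm]
  exact (mul_meas_ge_le_integral_of_nonneg (Eventually.of_forall hf0) hf c).trans hV

lemma measureReal_le_div_sq_of_integral_sq_le {f : Ω → ℝ} (hf : MemLp f 2 μ)
    {V c : ℝ} (hV : ∫ ω, f ω ^ 2 ∂μ ≤ V) (hc : 0 < c) :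
    μ.real {ω | c ≤ |f ω|} ≤ V / c ^ 2 := by
  refine le_trans (measureReal_mono fun ω hω => ?_)
    (measureReal_le_div_of_integral_le (fun ω => sq_nonneg (f ω)) hf.integrable_sq hV
      (by positivity : 0 < c ^ 2))
  simp only [mem_ofPred_eq] at hω ⊢
  rw [← sq_abs (f ω)]
  gcongr

/-- An array of independent centred random variables with common variance `s`. -/
structure IsCentredArray {m : ℕ} (μ : Measure Ω) (ξ : ℕ → Fin m → Ω → ℝ) (s : ℝ) : Prop where
  indep : iIndepFun (fun a : ℕ × Fin m => ξ a.1 a.2) μ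
  meas : ∀ i j, Measurable (ξ i j)
  memLp : ∀ i j, MemLp (ξ i j) 2 μ
  mean : ∀ i j, ∫ ω, ξ i j ω ∂μ = 0
  sq : ∀ i j, ∫ ω, ξ i j ω ^ 2 ∂μ = s

variable {m : ℕ} {ξ : ℕ → Fin m → Ω → ℝ} {s : ℝ}

namespace IsCentredArray

omit [IsProbabilityMeasure μ] in
lemma indep_row (h : IsCentredArray μ ξ s) (j : Fin m) : iIndepFun (fun i => ξ i j) μ :=
  h.indep.precomp (g := fun i : ℕ => (i, j)) fun _ _ hab => (Prod.mk.inj hab).1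

omit [IsProbabilityMeasure μ] in
lemma measurable_sum (h : IsCentredArray μ ξ s) (t : Finset ℕ) (j : Fin m) :
    Measurable fun ω => ∑ i ∈ t, ξ i j ω :=
  Finset.measurable_sum _ fun i _ => h.meas i j

omit [IsProbabilityMeasure μ] in
lemma memLp_sum (h : IsCentredArray μ ξ s) (t : Finset ℕ) (j : Fin m) :
    MemLp (fun ω => ∑ i ∈ t, ξ i j ω) 2 μ :=
  memLp_finsetSum _ fun i _ => h.memLp i j

omit [IsProbabilityMeasure μ] in
-- Sums over different channels involve disjoint sets of indices. This independence across channels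
-- makes the variance of the channel mean square grow only like `m`.
lemma indepFun_sum (h : IsCentredArray μ ξ s) (t : Finset ℕ) {j k : Fin m} (hjk : j ≠ k) :
    IndepFun (fun ω => ∑ i ∈ t, ξ i j ω) (fun ω => ∑ i ∈ t, ξ i k ω) μ := by
  have hdisj : Disjoint (t ×ˢ ({j} : Finset (Fin m))) (t ×ˢ {k}) := by
    rw [Finset.disjoint_left]
    rintro ⟨a, b⟩ h1 h2
    simp only [Finset.mem_product, Finset.mem_singleton] at h1 h2
    exact hjk (h1.2.symm.trans h2.2)
  have h1 := h.indep.indepFun_finset _ _ hdisj fun a => h.meas a.1 a.2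
  have h2 := h1.comp (φ := fun v => ∑ a, v a) (ψ := fun v => ∑ a, v a)
    (Finset.measurable_sum _ fun a _ => measurable_pi_apply a)
    (Finset.measurable_sum _ fun a _ => measurable_pi_apply a)
  have hsum : ∀ (l : Fin m), ((fun v : (t ×ˢ ({l} : Finset (Fin m)) : Finset _) → ℝ => ∑ a, v a) ∘
      fun ω (a : (t ×ˢ ({l} : Finset (Fin m)) : Finset _)) => ξ a.1.1 a.1.2 ω) =
      fun ω => ∑ i ∈ t, ξ i l ω := fun l => by
    ext ω
    simp only [Function.comp_apply]
    rw [Finset.sum_coe_sort (t ×ˢ ({l} : Finset (Fin m))) (fun a => ξ a.1 a.2 ω),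
      Finset.sum_product]
    simp
  rw [hsum j, hsum k] at h2
  exact h2

lemma integral_sum_sq (h : IsCentredArray μ ξ s) (t : Finset ℕ) (j : Fin m) :
    ∫ ω, (∑ i ∈ t, ξ i j ω) ^ 2 ∂μ = t.card * s := by
  rw [InverseProblem.integral_sum_sq (h.indep_row j) (fun i => h.memLp i j) (fun i => h.mean i j),
    Finset.sum_congr rfl fun i _ => h.sq i j, Finset.sum_const, nsmul_eq_mul]

omit [IsProbabilityMeasure μ] in
lemma integrable_meanSq (h : IsCentredArray μ ξ s) (n : ℕ) :
    Integrable (fun ω => meanSq (fun i j => ξ i j ω) n) μ :=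
  integrable_finsetSum _ fun j _ => (h.memLp_sum _ j).integrable_sq.div_const _

lemma integral_meanSq (h : IsCentredArray μ ξ s) {n : ℕ} (hn : 0 < n) :
    ∫ ω, meanSq (fun i j => ξ i j ω) n ∂μ = m * s := by
  have hn' : (n : ℝ) ≠ 0 := by exact_mod_cast hn.ne'
  simp only [meanSq]
  rw [integral_finsetSum _ fun j _ => (h.memLp_sum _ j).integrable_sq.div_const _]
  simp only [integral_div, h.integral_sum_sq, Finset.card_range, Finset.sum_const,
    Finset.card_univ, Fintype.card_fin, nsmul_eq_mul]
  field_simp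

omit [IsProbabilityMeasure μ] in
lemma integrable_sumSq (h : IsCentredArray μ ξ s) (n : ℕ) :
    Integrable (fun ω => sumSq (fun i j => ξ i j ω) n) μ :=
  integrable_finsetSum _ fun j _ => integrable_finsetSum _ fun i _ => (h.memLp i j).integrable_sq

omit [IsProbabilityMeasure μ] in
lemma integral_sumSq (h : IsCentredArray μ ξ s) (n : ℕ) :
    ∫ ω, sumSq (fun i j => ξ i j ω) n ∂μ = n * m * s := by
  simp only [sumSq]
  rw [integral_finsetSum _ fun j _ => integrable_finsetSum _ fun i _ =>
    (h.memLp i j).integrable_sq]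
  simp only [integral_finsetSum _ fun i _ => (h.memLp i _).integrable_sq, h.sq,
    Finset.card_range, Finset.sum_const, Finset.card_univ, Fintype.card_fin, nsmul_eq_mul]
  ring

/-- Markov's inequality for the squared norm of the channel means. -/
lemma measureReal_le_meanSq (h : IsCentredArray μ ξ s) {n : ℕ} (hn : 0 < n) {c : ℝ} (hc : 0 < c) :
    μ.real {ω | c ≤ meanSq (fun i j => ξ i j ω) n} ≤ m * s / c :=
  measureReal_le_div_of_integral_le (fun _ => meanSq_nonneg _ _) (h.integrable_meanSq n)
    (h.integral_meanSq hn).le hc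

/-- Markov's inequality for the sum of the squared deviations. -/
lemma measureReal_le_scatter (h : IsCentredArray μ ξ s) (n : ℕ) {c : ℝ} (hc : 0 < c) :
    μ.real {ω | c ≤ scatter (fun i j => ξ i j ω) n} ≤ n * m * s / c := by
  refine le_trans (measureReal_mono fun ω hω => ?_)
    (measureReal_le_div_of_integral_le (fun ω => ?_) (h.integrable_sumSq n)
    (h.integral_sumSq n).le hc)
  · exact le_trans hω (scatter_le_sumSq _ _)
  · exact (scatter_nonneg _ _).trans (scatter_le_sumSq _ _)

section FourthMoment

variable {B : ℝ} (h : IsCentredArray μ ξ s) (h4 : ∀ i j, MemLp (ξ i j) 4 μ)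
  (hB : ∀ i j, ∫ ω, ξ i j ω ^ 4 ∂μ ≤ B * s ^ 2)

omit [IsProbabilityMeasure μ] in
lemma memLp_sq {f : Ω → ℝ} (hf : MemLp f 4 μ) : MemLp (fun ω => f ω ^ 2) 2 μ := by
  refine (memLp_two_iff_integrable_sq (hf.1.pow 2)).mpr ?_
  refine (integrable_pow_mul_pow hf hf (a := 4) (b := 0) rfl).congr
    (Eventually.of_forall fun ω => ?_)
  simp only [pow_zero, mul_one, Pi.pow_apply]
  ring

include h h4 hB

/-- The `m` summands are independent with mean `s`, and the fourth-moment bound gives each a second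
moment of at most `(3 + B) s²`, uniformly in `n`. -/
lemma integral_meanSq_sub_sq_le {n : ℕ} (hn : 0 < n) (hB0 : 0 ≤ B) :
    ∫ ω, (meanSq (fun i j => ξ i j ω) n - m * s) ^ 2 ∂μ ≤ m * ((3 + B) * s ^ 2) := by
  have hn' : (n : ℝ) ≠ 0 := by exact_mod_cast hn.ne'
  have hn1 : (1 : ℝ) ≤ n := by exact_mod_cast hn
  have key := integral_sq_sum_sub_le (μ := μ) (t := (Finset.univ : Finset (Fin m)))
    (Z := fun j ω => (∑ i ∈ Finset.range n, ξ i j ω) ^ 2 / n) (a := s) (M := (3 + B) * s ^ 2)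
    (fun j _ => ?_) (fun j _ k _ hjk => ?_) (fun j _ => ?_) (fun j _ => ?_)
  · simpa [meanSq] using key
  · have := (memLp_sq (memLp_finsetSum (Finset.range n) fun i _ => h4 i j)).mul_const (n : ℝ)⁻¹
    simpa only [div_eq_mul_inv] using this
  · have := (h.indepFun_sum (Finset.range n) hjk).comp (φ := fun x : ℝ => x ^ 2 / (n : ℝ))
      (ψ := fun x : ℝ => x ^ 2 / (n : ℝ)) (by fun_prop) (by fun_prop)
    exact this
  · rw [integral_div, h.integral_sum_sq, Finset.card_range]
    field_simp
  · have h1 := integral_sum_pow_four_le (h.indep_row j) (fun i => h.meas i j) (fun i => h4 i j)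
      (fun i => h.mean i j) (fun i => h.sq i j) (fun i => hB i j) (Finset.range n)
    rw [Finset.card_range] at h1
    simp only [div_pow, ← pow_mul]
    rw [integral_div, div_le_iff₀ (by positivity)]
    refine h1.trans ?_
    have : (n : ℝ) * (B * s ^ 2) ≤ n ^ 2 * (B * s ^ 2) := by
      gcongr
      nlinarith
    linarith

omit h hB in
lemma memLp_meanSq_sub (n : ℕ) (a : ℝ) :
    MemLp (fun ω => meanSq (fun i j => ξ i j ω) n - a) 2 μ := by
  refine MemLp.sub (memLp_finsetSum _ fun j _ => ?_) (memLp_const a)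
  have := (memLp_sq (memLp_finsetSum (Finset.range n) fun i _ => h4 i j)).mul_const (n : ℝ)⁻¹
  simpa only [div_eq_mul_inv] using this

lemma integral_sumSq_sub_sq_le (n : ℕ) :
    ∫ ω, (sumSq (fun i j => ξ i j ω) n - n * m * s) ^ 2 ∂μ ≤ n * m * (B * s ^ 2) := by
  have key := integral_sq_sum_sub_le (μ := μ)
    (t := (Finset.univ : Finset (Fin m)) ×ˢ Finset.range n)
    (Z := fun a ω => ξ a.2 a.1 ω ^ 2) (a := s) (M := B * s ^ 2)
    (fun a _ => memLp_sq (h4 _ _)) (fun a _ b _ hab => ?_) (fun a _ => h.sq _ _) (fun a _ => ?_)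
  · simp only [Finset.card_product, Finset.card_univ, Fintype.card_fin, Finset.card_range,
      Finset.sum_product] at key
    push_cast at key
    rw [mul_comm (m : ℝ) n] at key
    exact key
  · have hne : ((a.2, a.1) : ℕ × Fin m) ≠ (b.2, b.1) := fun he =>
      hab (Prod.ext (Prod.mk.inj he).2 (Prod.mk.inj he).1)
    have := (h.indep.indepFun hne).comp (φ := fun x : ℝ => x ^ 2) (ψ := fun x : ℝ => x ^ 2)
      (by fun_prop) (by fun_prop)
    exact this
  · simp only [← pow_mul]
    exact hB _ _

omit h hB in
lemma memLp_sumSq_sub (n : ℕ) (a : ℝ) :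
    MemLp (fun ω => sumSq (fun i j => ξ i j ω) n - a) 2 μ :=
  MemLp.sub (memLp_finsetSum _ fun j _ => memLp_finsetSum _ fun i _ => memLp_sq (h4 i j))
    (memLp_const a)

lemma integral_scatter_sub_sq_le {n : ℕ} (hn : 0 < n) (hB0 : 0 ≤ B) :
    ∫ ω, (scatter (fun i j => ξ i j ω) n - ((n : ℝ) - 1) * m * s) ^ 2 ∂μ ≤
      n * m * ((4 * B + 6) * s ^ 2) := by
  have hn1 : (1 : ℝ) ≤ n := by exact_mod_cast hn
  have i1 := (memLp_sumSq_sub h4 n (n * m * s)).integrable_sq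
  have i2 := (memLp_meanSq_sub h4 n (m * s)).integrable_sq
  calc ∫ ω, (scatter (fun i j => ξ i j ω) n - ((n : ℝ) - 1) * m * s) ^ 2 ∂μ
      ≤ ∫ ω, (2 * (sumSq (fun i j => ξ i j ω) n - n * m * s) ^ 2 +
          2 * (meanSq (fun i j => ξ i j ω) n - m * s) ^ 2) ∂μ := by
        refine integral_mono_of_nonneg (Eventually.of_forall fun ω => sq_nonneg _)
          ((i1.const_mul 2).add (i2.const_mul 2)) (Eventually.of_forall fun ω => ?_)
        simp only [scatter_eq]
        nlinarith [sq_nonneg ((sumSq (fun i j => ξ i j ω) n - n * m * s) +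
          (meanSq (fun i j => ξ i j ω) n - m * s))]
    _ ≤ 2 * (n * m * (B * s ^ 2)) + 2 * (m * ((3 + B) * s ^ 2)) := by
        rw [integral_add (i1.const_mul 2) (i2.const_mul 2), integral_const_mul, integral_const_mul]
        have := integral_sumSq_sub_sq_le h h4 hB n
        have := integral_meanSq_sub_sq_le h h4 hB hn hB0
        linarith
    _ ≤ n * m * ((4 * B + 6) * s ^ 2) := by
        have : (m : ℝ) * ((3 + B) * s ^ 2) ≤ n * (m * ((3 + B) * s ^ 2)) :=
          le_mul_of_one_le_left (by positivity) hn1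
        nlinarith

/-- Chebyshev's inequality for the squared norm of the channel means. -/
lemma measureReal_le_abs_meanSq_sub {n : ℕ} (hn : 0 < n) (hm : 0 < m) (hs : 0 < s) (hB0 : 0 ≤ B)
    {ε : ℝ} (hε : 0 < ε) :
    μ.real {ω | ε * (m * s) ≤ |meanSq (fun i j => ξ i j ω) n - m * s|} ≤
      (3 + B) / ε ^ 2 / m := by
  have hm' : (0 : ℝ) < m := by exact_mod_cast hm
  refine (measureReal_le_div_sq_of_integral_sq_le (memLp_meanSq_sub h4 n (m * s))
    (integral_meanSq_sub_sq_le h h4 hB hn hB0) (by positivity)).trans_eq ?_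
  field_simp

/-- Chebyshev's inequality for the sum of the squared deviations. -/
lemma measureReal_le_abs_scatter_sub {n : ℕ} (hn : 2 ≤ n) (hm : 0 < m) (hs : 0 < s) (hB0 : 0 ≤ B)
    {ε : ℝ} (hε : 0 < ε) :
    μ.real {ω | ε * (((n : ℝ) - 1) * m * s) ≤
      |scatter (fun i j => ξ i j ω) n - ((n : ℝ) - 1) * m * s|} ≤
      4 * (4 * B + 6) / ε ^ 2 / m / n := by
  have hm' : (0 : ℝ) < m := by exact_mod_cast hm
  have hn2 : (2 : ℝ) ≤ n := by exact_mod_cast hn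
  have hn1 : (0 : ℝ) < (n : ℝ) - 1 := by linarith
  have hmem : MemLp (fun ω => scatter (fun i j => ξ i j ω) n - ((n : ℝ) - 1) * m * s) 2 μ := by
    have := (memLp_sumSq_sub h4 n (((n : ℝ) - 1) * m * s)).sub
      (memLp_meanSq_sub h4 n 0)
    refine (memLp_congr_ae (Eventually.of_forall fun ω => ?_)).mp this
    simp only [Pi.sub_apply, scatter_eq]
    ring
  refine (measureReal_le_div_sq_of_integral_sq_le hmem
    (integral_scatter_sub_sq_le h h4 hB (by omega) hB0) (by positivity)).trans ?_
  rw [div_div, div_div, div_le_div_iff₀ (by positivity) (by positivity)]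
  -- The source of the factor `4`: `n ≤ 2 (n - 1)` for `n ≥ 2`.
  have h1 : (n : ℝ) ^ 2 ≤ 4 * ((n : ℝ) - 1) ^ 2 := by nlinarith
  calc n * m * ((4 * B + 6) * s ^ 2) * (ε ^ 2 * (m * n))
      = (4 * B + 6) * (m ^ 2 * s ^ 2 * ε ^ 2) * (n : ℝ) ^ 2 := by ring
    _ ≤ (4 * B + 6) * (m ^ 2 * s ^ 2 * ε ^ 2) * (4 * ((n : ℝ) - 1) ^ 2) := by gcongr
    _ = _ := by ring

end FourthMoment

end IsCentredArray

end Concentration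

/-! ### Kolmogorov's maximal inequality for the vector of channel sums. -/

section Maximal

variable {Ω : Type*} [mΩ : MeasurableSpace Ω] {μ : Measure Ω}
  {m : ℕ} {ξ : ℕ → Fin m → Ω → ℝ} {s : ℝ}

/-- The filtration generated by the rows of an array of random variables. -/
def rowFiltration (ξ : ℕ → Fin m → Ω → ℝ) (hξ : ∀ i j, Measurable (ξ i j)) :
    Filtration ℕ mΩ where
  -- The strict inequality matters: the sum over `range n` is measurable at time `n`, while row `n`
  -- is independent of the past.
  seq n := ⨆ a ∈ {a : ℕ × Fin m | a.1 < n}, MeasurableSpace.comap (ξ a.1 a.2) inferInstance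
  mono' _ _ hnk := biSup_mono fun _ ha => lt_of_lt_of_le ha hnk
  le' _ := iSup₂_le fun a _ => (hξ a.1 a.2).comap_le

lemma measurable_rowFiltration (hξ : ∀ i j, Measurable (ξ i j)) {n i : ℕ} (hi : i < n)
    (j : Fin m) : Measurable[rowFiltration ξ hξ n] (ξ i j) := by
  rw [measurable_iff_comap_le]
  exact le_biSup (fun a : ℕ × Fin m => MeasurableSpace.comap (ξ a.1 a.2) inferInstance)
    (show ((i, j) : ℕ × Fin m) ∈ {a : ℕ × Fin m | a.1 < n} from hi)

lemma measurable_sum_rowFiltration (hξ : ∀ i j, Measurable (ξ i j)) (n : ℕ) (j : Fin m) :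
    Measurable[rowFiltration ξ hξ n] fun ω => ∑ i ∈ Finset.range n, ξ i j ω :=
  Finset.measurable_sum _ fun _ hi => measurable_rowFiltration hξ (Finset.mem_range.mp hi) j

namespace IsCentredArray

lemma indepFun_of_measurable_rowFiltration (h : IsCentredArray μ ξ s) {n : ℕ} {f : Ω → ℝ}
    (hf : Measurable[rowFiltration ξ h.meas n] f) (j : Fin m) : IndepFun f (ξ n j) μ := by
  have h1 := indep_iSup_of_disjoint (fun a : ℕ × Fin m => (h.meas a.1 a.2).comap_le) h.indep
    (S := {a | a.1 < n}) (T := {(n, j)}) (by simp)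
  rw [IndepFun_iff_Indep]
  refine indep_of_indep_of_le_left (indep_of_indep_of_le_right h1 ?_)
    (measurable_iff_comap_le.mp hf)
  exact le_biSup (fun a : ℕ × Fin m => MeasurableSpace.comap (ξ a.1 a.2) inferInstance)
    (mem_singleton ((n, j) : ℕ × Fin m))

lemma submartingale_sum_sq [IsProbabilityMeasure μ] (h : IsCentredArray μ ξ s) :
    Submartingale (fun n ω => ∑ j, (∑ i ∈ Finset.range n, ξ i j ω) ^ 2)
      (rowFiltration ξ h.meas) μ := by
  have hint : ∀ n, Integrable (fun ω => ∑ j, (∑ i ∈ Finset.range n, ξ i j ω) ^ 2) μ := fun n =>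
    integrable_finsetSum _ fun j _ => (h.memLp_sum _ j).integrable_sq
  refine submartingale_of_setIntegral_le_succ (fun n => ?_) hint fun n A hA => ?_
  · exact (Finset.measurable_sum _ fun j _ =>
      (measurable_sum_rowFiltration h.meas n j).pow_const 2).stronglyMeasurable
  have hA' : MeasurableSet A := (rowFiltration ξ h.meas).le n A hA
  have hcross : ∀ j, Integrable (fun ω => (∑ i ∈ Finset.range n, ξ i j ω) * ξ n j ω) μ :=
    fun j => (h.memLp_sum _ j).integrable_mul (h.memLp n j)
  -- The partial sum restricted to `A` depends only on the past, and `ξ n j` is independent of it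
  -- and centred; so the increment integrates over `A` to that of `∑ j, ξ n j ω ^ 2`.
  have hzero : ∀ j, ∫ ω in A, (∑ i ∈ Finset.range n, ξ i j ω) * ξ n j ω ∂μ = 0 := fun j => by
    have hm : Measurable[rowFiltration ξ h.meas n]
        (A.indicator fun ω => ∑ i ∈ Finset.range n, ξ i j ω) :=
      (measurable_sum_rowFiltration h.meas n j).indicator hA
    have hind := h.indepFun_of_measurable_rowFiltration hm j
    have hmul := hind.integral_fun_mul_eq_mul_integral
      ((h.measurable_sum _ j).indicator hA').aestronglyMeasurable (h.meas n j).aestronglyMeasurable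
    rw [h.mean, mul_zero] at hmul
    rw [← integral_indicator hA', ← hmul]
    congr 1
    ext ω
    by_cases hω : ω ∈ A <;> simp [hω]
  have hstep : ∀ ω, ∑ j, (∑ i ∈ Finset.range (n + 1), ξ i j ω) ^ 2 =
      ∑ j, (∑ i ∈ Finset.range n, ξ i j ω) ^ 2 +
        (2 * ∑ j, (∑ i ∈ Finset.range n, ξ i j ω) * ξ n j ω + ∑ j, ξ n j ω ^ 2) := fun ω => by
    rw [Finset.mul_sum, ← Finset.sum_add_distrib, ← Finset.sum_add_distrib]
    refine Finset.sum_congr rfl fun j _ => ?_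
    rw [Finset.sum_range_succ]; ring
  simp only [hstep]
  have i1 : Integrable (fun ω => 2 * ∑ j, (∑ i ∈ Finset.range n, ξ i j ω) * ξ n j ω) μ :=
    (integrable_finsetSum _ fun j _ => hcross j).const_mul 2
  have i2 : Integrable (fun ω => ∑ j, ξ n j ω ^ 2) μ :=
    integrable_finsetSum _ fun j _ => (h.memLp n j).integrable_sq
  have i3 : Integrable (fun ω => 2 * ∑ j, (∑ i ∈ Finset.range n, ξ i j ω) * ξ n j ω +
    ∑ j, ξ n j ω ^ 2) μ := i1.add i2
  rw [integral_add (hint n).integrableOn i3.integrableOn,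
    integral_add i1.integrableOn i2.integrableOn, integral_const_mul,
    integral_finsetSum _ fun j _ => (hcross j).integrableOn, Finset.sum_eq_zero fun j _ => hzero j]
  have : 0 ≤ ∫ ω in A, ∑ j, ξ n j ω ^ 2 ∂μ :=
    integral_nonneg fun ω => Finset.sum_nonneg fun j _ => sq_nonneg _
  linarith

/-- Kolmogorov's maximal inequality for arrays. -/
theorem measureReal_exists_le_sum_sq [IsProbabilityMeasure μ] (h : IsCentredArray μ ξ s)
    (N : ℕ) {c : ℝ} (hc : 0 < c) :
    μ.real {ω | ∃ n ≤ N, c ≤ ∑ j, (∑ i ∈ Finset.range n, ξ i j ω) ^ 2} ≤ N * m * s / c := by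
  have hmax := maximal_ineq h.submartingale_sum_sq
    (fun n ω => Finset.sum_nonneg fun j _ => sq_nonneg _) (ε := ⟨c, hc.le⟩) N
  set A := {ω | ((⟨c, hc.le⟩ : NNReal) : ℝ) ≤ (Finset.range (N + 1)).sup'
    Finset.nonempty_range_add_one fun k => ∑ j, (∑ i ∈ Finset.range k, ξ i j ω) ^ 2} with hA
  have hsub : {ω | ∃ n ≤ N, c ≤ ∑ j, (∑ i ∈ Finset.range n, ξ i j ω) ^ 2} ⊆ A := by
    rintro ω ⟨n, hn, hcn⟩
    rw [hA, mem_ofPred_eq, Finset.le_sup'_iff]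
    exact ⟨n, Finset.mem_range.mpr (by omega), hcn⟩
  have hint : Integrable (fun ω => ∑ j, (∑ i ∈ Finset.range N, ξ i j ω) ^ 2) μ :=
    integrable_finsetSum _ fun j _ => (h.memLp_sum _ j).integrable_sq
  have htot : ∫ ω, ∑ j, (∑ i ∈ Finset.range N, ξ i j ω) ^ 2 ∂μ = N * m * s := by
    rw [integral_finsetSum _ fun j _ => (h.memLp_sum _ j).integrable_sq]
    simp only [h.integral_sum_sq, Finset.card_range, Finset.sum_const, Finset.card_univ,
      Fintype.card_fin, nsmul_eq_mul]
    ring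
  have hnn : 0 ≤ N * m * s := by
    rw [← htot]
    exact integral_nonneg fun ω => Finset.sum_nonneg fun j _ => sq_nonneg _
  have hle : ∫ ω in A, ∑ j, (∑ i ∈ Finset.range N, ξ i j ω) ^ 2 ∂μ ≤ N * m * s := by
    rw [← htot]
    exact setIntegral_le_integral hint
      (Eventually.of_forall fun ω => Finset.sum_nonneg fun j _ => sq_nonneg _)
  refine (measureReal_mono hsub).trans ?_
  rw [le_div_iff₀ hc, mul_comm]
  have := ENNReal.toReal_mono ENNReal.ofReal_ne_top
    (hmax.trans (ENNReal.ofReal_le_ofReal hle))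
  rw [ENNReal.toReal_ofReal hnn, ENNReal.toReal_mul] at this
  exact this

lemma shift (h : IsCentredArray μ ξ s) (t : ℕ) : IsCentredArray μ (fun i => ξ (t + i)) s where
  indep := h.indep.precomp (g := fun a : ℕ × Fin m => (t + a.1, a.2)) fun a b hab => by
    simp only [Prod.mk.injEq, add_right_inj] at hab
    exact Prod.ext hab.1 hab.2
  meas i j := h.meas _ j
  memLp i j := h.memLp _ j
  mean i j := h.mean _ j
  sq i j := h.sq _ j

end IsCentredArray

end Maximal

/-! ### Concentration uniform in the sample size, for noise approximable by arrays of bounded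
kurtosis. -/

section Tame

variable {Ω : Type*} [MeasurableSpace Ω] {μ : Measure Ω}

lemma measureReal_iUnion_le_tsum [IsFiniteMeasure μ] {A : ℕ → Set Ω} {f : ℕ → ℝ}
    (hf : Summable f) (h : ∀ i, μ.real (A i) ≤ f i) : μ.real (⋃ i, A i) ≤ ∑' i, f i := by
  have hf0 : ∀ i, 0 ≤ f i := fun i => measureReal_nonneg.trans (h i)
  have h1 : μ (⋃ i, A i) ≤ ENNReal.ofReal (∑' i, f i) := by
    rw [ENNReal.ofReal_tsum_of_nonneg hf0 hf]
    refine (measure_iUnion_le A).trans (ENNReal.tsum_le_tsum fun i => ?_)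
    rw [← ofReal_measureReal]
    exact ENNReal.ofReal_le_ofReal (h i)
  have := ENNReal.toReal_mono ENNReal.ofReal_ne_top h1
  rwa [ENNReal.toReal_ofReal (tsum_nonneg hf0)] at this

/-- With fourth moments, the sample variances are bounded below uniformly in the sample size. -/
lemma exists_measureReal_scatter_lt_le {ε B : ℝ} (hε : 0 < ε) (hε1 : ε < 1) (hB0 : 0 ≤ B) :
    ∃ C : ℝ, ∀ (μ : Measure Ω) [IsProbabilityMeasure μ] (m : ℕ) (ξ : ℕ → Fin m → Ω → ℝ) (s : ℝ),
      IsCentredArray μ ξ s → (∀ i j, MemLp (ξ i j) 4 μ) →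
      (∀ i j, ∫ ω, ξ i j ω ^ 4 ∂μ ≤ B * s ^ 2) → 0 < m → 0 < s →
      μ.real {ω | ∃ n : ℕ, 2 ≤ n ∧ scatter (fun i j => ξ i j ω) n <
        (1 - ε) ^ 2 * (((n : ℝ) - 1) * m * s)} ≤ C / m := by
  -- The Chebyshev bound `D / (m n)` is not summable over `n` but is over squares, and monotonicity
  -- of the scatter fills the gaps: for `k² ≤ n < (k + 1)²` and `ε k ≥ 2` the loss from `n - 1` to
  -- `k² - 1` is at most a factor `1 - ε`. The finitely many `n` below `k₁ ^ 2` are treated one by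
  -- one.
  obtain ⟨k₀, hk₀⟩ := exists_nat_gt (2 / ε)
  set k₁ := max k₀ 2 with hk₁
  have hk₁2 : 2 ≤ k₁ := le_max_right _ _
  have hk₁ε : 2 < ε * k₁ := by
    have : (k₀ : ℝ) ≤ k₁ := by exact_mod_cast le_max_left _ _
    rw [div_lt_iff₀ hε] at hk₀
    nlinarith
  have hsum : Summable fun i : ℕ => 1 / (i : ℝ) ^ 2 := Real.summable_one_div_nat_pow.mpr one_lt_two
  have hsum' : Summable fun i : ℕ => 1 / ((k₁ + i : ℕ) : ℝ) ^ 2 := by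
    simpa only [add_comm] using (summable_nat_add_iff k₁).mpr hsum
  set D := 4 * (4 * B + 6) / ε ^ 2 with hD
  have hD0 : 0 ≤ D := by positivity
  refine ⟨k₁ ^ 2 * D + D * ∑' i : ℕ, 1 / ((k₁ + i : ℕ) : ℝ) ^ 2,
    fun μ _ m ξ s h h4 hB hm hs => ?_⟩
  have hm' : (0 : ℝ) < m := by exact_mod_cast hm
  have hcheb : ∀ n : ℕ, 2 ≤ n → _ := fun n hn => h.measureReal_le_abs_scatter_sub h4 hB hn hm hs
    hB0 hε
  set bad : ℕ → Set Ω := fun n => {ω | ε * (((n : ℝ) - 1) * m * s) ≤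
      |scatter (fun i j => ξ i j ω) n - ((n : ℝ) - 1) * m * s|} with hbad
  have hgood : ∀ n ω, ω ∉ bad n → (1 - ε) * (((n : ℝ) - 1) * m * s) ≤
      scatter (fun i j => ξ i j ω) n := fun n ω hω => by
    simp only [hbad, mem_ofPred_eq, not_le] at hω
    linarith [(abs_lt.mp hω).1]
  have hsub : {ω | ∃ n : ℕ, 2 ≤ n ∧ scatter (fun i j => ξ i j ω) n <
      (1 - ε) ^ 2 * (((n : ℝ) - 1) * m * s)} ⊆
      (⋃ n ∈ Finset.Ico 2 (k₁ ^ 2), bad n) ∪ ⋃ i, bad ((k₁ + i) ^ 2) := by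
    rintro ω ⟨n, hn, hlt⟩
    by_contra hω
    simp only [mem_union, mem_iUnion, not_or, not_exists, Finset.mem_Ico] at hω
    have hn2 : (2 : ℝ) ≤ n := by exact_mod_cast hn
    rcases lt_or_ge n (k₁ ^ 2) with hlow | hhigh
    · have h1 := hgood n ω (hω.1 n ⟨hn, hlow⟩)
      have h2 : (1 - ε) ^ 2 * (((n : ℝ) - 1) * m * s) ≤ (1 - ε) * (((n : ℝ) - 1) * m * s) := by
        have : (0 : ℝ) ≤ ((n : ℝ) - 1) * m * s := by
          have : (0 : ℝ) ≤ (n : ℝ) - 1 := by linarith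
          positivity
        gcongr
        nlinarith
      linarith
    · set k := n.sqrt
      have hkk : k₁ ≤ k := Nat.le_sqrt'.mpr hhigh
      have h1 := hgood (k ^ 2) ω (by
        have := hω.2 (k - k₁)
        rwa [Nat.add_sub_cancel' hkk] at this)
      have h2 := scatter_mono (fun i j => ξ i j ω) (Nat.sqrt_le' n)
      have h3 : n < (k + 1) ^ 2 := Nat.lt_succ_sqrt' n
      have h3' : (n : ℝ) + 1 ≤ (k + 1) ^ 2 := by exact_mod_cast h3
      have hkr : (k₁ : ℝ) ≤ k := by exact_mod_cast hkk
      have hk2 : (2 : ℝ) ≤ k := le_trans (by exact_mod_cast hk₁2) hkr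
      have h4 : 2 ≤ ε * k := hk₁ε.le.trans (by gcongr)
      have h5 : (1 - ε) * ((n : ℝ) - 1) ≤ (k : ℝ) ^ 2 - 1 := by
        have : (1 - ε) * ((n : ℝ) - 1) ≤ (1 - ε) * ((k : ℝ) ^ 2 + 2 * k - 1) := by
          gcongr
          linarith
        nlinarith
      have h6 : (1 - ε) ^ 2 * (((n : ℝ) - 1) * m * s) ≤
          (1 - ε) * ((((k ^ 2 : ℕ) : ℝ) - 1) * m * s) := by
        push_cast
        calc (1 - ε) ^ 2 * (((n : ℝ) - 1) * m * s)
            = (1 - ε) * ((1 - ε) * ((n : ℝ) - 1) * m * s) := by ring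
          _ ≤ (1 - ε) * (((k : ℝ) ^ 2 - 1) * m * s) := by
            have : 0 ≤ 1 - ε := by linarith
            gcongr
      linarith
  refine (measureReal_mono hsub).trans ((measureReal_union_le _ _).trans ?_)
  rw [add_div]
  gcongr
  · refine (measureReal_biUnion_finset_le _ _).trans ?_
    calc ∑ n ∈ Finset.Ico 2 (k₁ ^ 2), μ.real (bad n)
        ≤ ∑ n ∈ Finset.Ico 2 (k₁ ^ 2), D / m := by
          refine Finset.sum_le_sum fun n hn => ?_
          have hn2 := (Finset.mem_Ico.mp hn).1
          refine (hcheb n hn2).trans (div_le_self (by positivity) ?_)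
          exact_mod_cast (by omega : 1 ≤ n)
      _ ≤ k₁ ^ 2 * D / m := by
          rw [Finset.sum_const, Nat.card_Ico, nsmul_eq_mul, mul_div_assoc]
          gcongr
          exact_mod_cast Nat.sub_le _ _
  · have hs2 := hsum'.mul_left (D / m)
    refine (measureReal_iUnion_le_tsum hs2 fun i => ?_).trans_eq ?_
    · have h2 : 2 ≤ (k₁ + i) ^ 2 := by
        have : 2 ^ 2 ≤ (k₁ + i) ^ 2 := Nat.pow_le_pow_left (by omega) 2
        omega
      refine (hcheb _ h2).trans_eq ?_
      push_cast
      ring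
    · rw [tsum_mul_left]; ring

/-- The array `ξ` is close in mean square to an array `a` with bounded kurtosis that is a
contraction of it. -/
structure IsTameApprox {m : ℕ} (μ : Measure Ω) (ξ a : ℕ → Fin m → Ω → ℝ) (s s' r η B : ℝ) :
    Prop where
  main : IsCentredArray μ a s'
  rest : IsCentredArray μ (fun i j ω => ξ i j ω - a i j ω) r
  memLp_four : ∀ i j, MemLp (a i j) 4 μ
  pow_four : ∀ i j, ∫ ω, a i j ω ^ 4 ∂μ ≤ B * s' ^ 2
  contraction : ∀ i k j ω, |a i j ω - a k j ω| ≤ |ξ i j ω - ξ k j ω|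
  lower : (1 - η) * s ≤ s'
  upper : s' ≤ (1 + η) * s
  rest_le : r ≤ η * s

/-- Arrays of independent centred variables with variances `s m` that are uniformly square
integrable relative to `s m`. -/
structure IsTameNoise (μ : Measure Ω) (δ : (m : ℕ) → ℕ → Fin m → Ω → ℝ) (s : ℕ → ℝ) : Prop where
  array : ∀ m, IsCentredArray μ (δ m) (s m)
  approx : ∀ η > 0, ∃ B, 0 ≤ B ∧ ∀ m, 0 < s m →
    ∃ a s' r, IsTameApprox μ (δ m) a (s m) s' r η B

variable [IsProbabilityMeasure μ] {δ : (m : ℕ) → ℕ → Fin m → Ω → ℝ} {s : ℕ → ℝ}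

lemma exists_forall_ge_div_le (C : ℝ) {θ : ℝ} (hθ : 0 < θ) :
    ∃ M₀ : ℕ, 0 < M₀ ∧ ∀ m ≥ M₀, C / m ≤ θ := by
  obtain ⟨M, hM⟩ := exists_nat_gt (C / θ)
  refine ⟨max M 1, by positivity, fun m hm => ?_⟩
  have hm1 : (1 : ℝ) ≤ m := by exact_mod_cast (le_max_right _ _).trans hm
  have hmM : (M : ℝ) ≤ m := by exact_mod_cast (le_max_left _ _).trans hm
  rw [div_lt_iff₀ hθ] at hM
  rw [div_le_iff₀ (by linarith)]
  nlinarith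

namespace IsTameNoise

lemma exists_measureReal_scatter_lt (h : IsTameNoise μ δ s) {ε θ : ℝ} (hε : 0 < ε) (hε1 : ε < 1)
    (hθ : 0 < θ) : ∃ M₀ : ℕ, ∀ m ≥ M₀, 0 < s m →
      μ.real {ω | ∃ n : ℕ, 2 ≤ n ∧ scatter (fun i j => δ m i j ω) n <
        (1 - ε) * (((n : ℝ) - 1) * m * s m)} ≤ θ := by
  obtain ⟨B, hB0, hB⟩ := h.approx (ε / 4) (by positivity)
  obtain ⟨C, hC⟩ := exists_measureReal_scatter_lt_le (Ω := Ω) (ε := ε / 4) (B := B)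
    (by positivity) (by linarith) hB0
  obtain ⟨M₀, hM0, hM⟩ := exists_forall_ge_div_le C hθ
  refine ⟨M₀, fun m hm hs => ?_⟩
  obtain ⟨a, s', r, ha⟩ := hB m hs
  have hs' : 0 < s' := lt_of_lt_of_le (mul_pos (by linarith) hs) ha.lower
  refine le_trans (measureReal_mono ?_) ((hC μ m a s' ha.main ha.memLp_four ha.pow_four
    (hM0.trans_le hm) hs').trans (hM m hm))
  rintro ω ⟨n, hn, hlt⟩
  refine ⟨n, hn, ?_⟩
  have hn2 : (2 : ℝ) ≤ n := by exact_mod_cast hn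
  -- The approximating array is a pathwise contraction, so its scatter is a lower bound for all `n`
  -- at once, and no estimate of the remainder uniform in `n` is needed.
  have h1 := scatter_le_of_contraction (x := fun i j => δ m i j ω) (y := fun i j => a i j ω)
    (fun i k j => ha.contraction i k j ω) n
  refine lt_of_le_of_lt h1 (hlt.trans_le ?_)
  have hnm : 0 ≤ ((n : ℝ) - 1) * m := mul_nonneg (by linarith) (by positivity)
  calc (1 - ε) * (((n : ℝ) - 1) * m * s m)
      ≤ (1 - ε / 4) ^ 3 * (((n : ℝ) - 1) * m * s m) := by
        gcongr
        nlinarith [mul_pos hε hε, mul_nonneg (mul_pos hε hε).le (sub_pos.mpr hε1).le]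
    _ = (1 - ε / 4) ^ 2 * (((n : ℝ) - 1) * m * ((1 - ε / 4) * s m)) := by ring
    _ ≤ (1 - ε / 4) ^ 2 * (((n : ℝ) - 1) * m * s') := by
        gcongr
        exact ha.lower

lemma exists_measureReal_lt_scatter (h : IsTameNoise μ δ s) {ε θ : ℝ} (hε : 0 < ε) (hε1 : ε < 1)
    (hθ : 0 < θ) : ∃ M₀ : ℕ, ∀ m ≥ M₀, 0 < s m → ∀ n : ℕ, 2 ≤ n →
      μ.real {ω | (1 + ε) * (((n : ℝ) - 1) * m * s m) < scatter (fun i j => δ m i j ω) n} ≤ θ := by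
  -- With `κ < 1`, `(1 + κ)³ + κ² + κ = 1 + 4κ + 4κ² + κ³ ≤ 1 + 9κ`. The three factors come from
  -- splitting off the remainder, from Chebyshev, and from `s' ≤ (1 + κ) s`.
  set κ := ε / 9 with hκ
  have hκ0 : 0 < κ := by positivity
  have hκ1 : κ < 1 := by linarith
  -- The remainder has variance at most `η s`, so Markov at level `κ²` costs at most `2 η / κ² ≤ θ /
  -- 2`, the `2` coming from `n / (n - 1)`.
  set η := min κ (κ ^ 2 * θ / 4) with hη
  have hη0 : 0 < η := by positivity
  obtain ⟨B, hB0, hB⟩ := h.approx η hη0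
  obtain ⟨M₀, hM0, hM⟩ := exists_forall_ge_div_le (4 * (4 * B + 6) / κ ^ 2)
    (show 0 < θ / 2 by positivity)
  refine ⟨M₀, fun m hm hs n hn => ?_⟩
  obtain ⟨a, s', r, ha⟩ := hB m hs
  have hm0 : 0 < m := hM0.trans_le hm
  have hm' : (0 : ℝ) < m := by exact_mod_cast hm0
  have hs' : 0 < s' := lt_of_lt_of_le
    (mul_pos (by linarith [min_le_left κ (κ ^ 2 * θ / 4)]) hs) ha.lower
  have hn2 : (2 : ℝ) ≤ n := by exact_mod_cast hn
  have hn1 : (0 : ℝ) < (n : ℝ) - 1 := by linarith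
  have h1 := ha.main.measureReal_le_abs_scatter_sub ha.memLp_four ha.pow_four hn hm0 hs' hB0 hκ0
  have h2 := ha.rest.measureReal_le_scatter n
    (show 0 < κ ^ 2 * (((n : ℝ) - 1) * m * s m) by positivity)
  have hsub : {ω | (1 + ε) * (((n : ℝ) - 1) * m * s m) < scatter (fun i j => δ m i j ω) n} ⊆
      {ω | κ * (((n : ℝ) - 1) * m * s') ≤
        |scatter (fun i j => a i j ω) n - ((n : ℝ) - 1) * m * s'|} ∪
      {ω | κ ^ 2 * (((n : ℝ) - 1) * m * s m) ≤
        scatter (fun i j => δ m i j ω - a i j ω) n} := by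
    intro ω hω
    by_contra hcon
    simp only [mem_union, mem_ofPred_eq, not_or, not_le] at hcon hω
    have h3 := scatter_add_le hκ0 (fun i j => a i j ω) (fun i j => δ m i j ω - a i j ω) n
    simp only [add_sub_cancel] at h3
    have h4 := (abs_lt.mp hcon.1).2
    have h5 := hcon.2
    have hN : 0 < ((n : ℝ) - 1) * m := by positivity
    have h6 : ((n : ℝ) - 1) * m * s' ≤ (1 + κ) * (((n : ℝ) - 1) * m * s m) := by
      calc ((n : ℝ) - 1) * m * s' ≤ ((n : ℝ) - 1) * m * ((1 + κ) * s m) := by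
            gcongr
            refine ha.upper.trans ?_
            gcongr
            exact min_le_left _ _
        _ = _ := by ring
    set T := ((n : ℝ) - 1) * m * s m
    have hT : 0 < T := by positivity
    have h7 : (1 + κ) * scatter (fun i j => a i j ω) n ≤ (1 + κ) * ((1 + κ) * ((1 + κ) * T)) := by
      have : scatter (fun i j => a i j ω) n ≤ (1 + κ) * (((n : ℝ) - 1) * m * s') := by linarith
      refine mul_le_mul_of_nonneg_left (this.trans ?_) (by positivity)
      gcongr
    have h8 : (1 + 1 / κ) * scatter (fun i j => δ m i j ω - a i j ω) n ≤
        (1 + 1 / κ) * (κ ^ 2 * T) := by gcongr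
    have h9 : (1 + 1 / κ) * (κ ^ 2 * T) = (κ ^ 2 + κ) * T := by field_simp
    have h10 : (1 + κ) * ((1 + κ) * ((1 + κ) * T)) + (κ ^ 2 + κ) * T ≤ (1 + ε) * T := by
      have he : ε = 9 * κ := by rw [hκ]; ring
      have : (1 + κ) ^ 3 + (κ ^ 2 + κ) ≤ 1 + ε := by rw [he]; nlinarith
      nlinarith
    linarith
  refine (measureReal_mono hsub).trans ((measureReal_union_le _ _).trans ?_)
  have h3 : 4 * (4 * B + 6) / κ ^ 2 / m / n ≤ θ / 2 :=
    (div_le_self (by positivity) (by linarith)).trans (hM m hm)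
  have h4 : n * m * r / (κ ^ 2 * (((n : ℝ) - 1) * m * s m)) ≤ θ / 2 := by
    rw [div_le_iff₀ (by positivity)]
    have h5 : r ≤ κ ^ 2 * θ / 4 * s m :=
      ha.rest_le.trans (by gcongr; exact min_le_right _ _)
    calc n * m * r ≤ n * m * (κ ^ 2 * θ / 4 * s m) := by gcongr
      _ ≤ (2 * ((n : ℝ) - 1)) * m * (κ ^ 2 * θ / 4 * s m) := by gcongr; linarith
      _ = _ := by ring
  linarith

lemma exists_measureReal_lt_meanSq (h : IsTameNoise μ δ s) {ε θ : ℝ} (hε : 0 < ε) (hε1 : ε < 1)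
    (hθ : 0 < θ) : ∃ M₀ : ℕ, 0 < M₀ ∧ ∀ m ≥ M₀, 0 < s m → ∀ n : ℕ, 0 < n →
      μ.real {ω | (1 + ε) * (m * s m) < meanSq (fun i j => δ m i j ω) n} ≤ θ := by
  set κ := ε / 9 with hκ
  have hκ0 : 0 < κ := by positivity
  have hκ1 : κ < 1 := by linarith
  set η := min κ (κ ^ 2 * θ / 4) with hη
  have hη0 : 0 < η := by positivity
  obtain ⟨B, hB0, hB⟩ := h.approx η hη0
  obtain ⟨M₀, hM0, hM⟩ := exists_forall_ge_div_le ((3 + B) / κ ^ 2)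
    (show 0 < θ / 2 by positivity)
  refine ⟨M₀, hM0, fun m hm hs n hn => ?_⟩
  obtain ⟨a, s', r, ha⟩ := hB m hs
  have hm0 : 0 < m := hM0.trans_le hm
  have hm' : (0 : ℝ) < m := by exact_mod_cast hm0
  have hs' : 0 < s' := lt_of_lt_of_le
    (mul_pos (by linarith [min_le_left κ (κ ^ 2 * θ / 4)]) hs) ha.lower
  have h1 := ha.main.measureReal_le_abs_meanSq_sub ha.memLp_four ha.pow_four hn hm0 hs' hB0 hκ0
  have h2 := ha.rest.measureReal_le_meanSq hn (show 0 < κ ^ 2 * (m * s m) by positivity)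
  have hsub : {ω | (1 + ε) * (m * s m) < meanSq (fun i j => δ m i j ω) n} ⊆
      {ω | κ * (m * s') ≤ |meanSq (fun i j => a i j ω) n - m * s'|} ∪
      {ω | κ ^ 2 * (m * s m) ≤ meanSq (fun i j => δ m i j ω - a i j ω) n} := by
    intro ω hω
    by_contra hcon
    simp only [mem_union, mem_ofPred_eq, not_or, not_le] at hcon hω
    have h3 := meanSq_add_le hκ0 (fun i j => a i j ω) (fun i j => δ m i j ω - a i j ω) n
    simp only [add_sub_cancel] at h3
    have h4 := (abs_lt.mp hcon.1).2
    have h5 := hcon.2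
    have h6 : m * s' ≤ (1 + κ) * (m * s m) := by
      calc m * s' ≤ m * ((1 + κ) * s m) := by
            gcongr
            refine ha.upper.trans ?_
            gcongr
            exact min_le_left _ _
        _ = _ := by ring
    set T := m * s m
    have hT : 0 < T := by positivity
    have h7 : (1 + κ) * meanSq (fun i j => a i j ω) n ≤ (1 + κ) * ((1 + κ) * ((1 + κ) * T)) := by
      have : meanSq (fun i j => a i j ω) n ≤ (1 + κ) * (m * s') := by linarith
      refine mul_le_mul_of_nonneg_left (this.trans ?_) (by positivity)
      gcongr
    have h8 : (1 + 1 / κ) * meanSq (fun i j => δ m i j ω - a i j ω) n ≤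
        (1 + 1 / κ) * (κ ^ 2 * T) := by gcongr
    have h9 : (1 + 1 / κ) * (κ ^ 2 * T) = (κ ^ 2 + κ) * T := by field_simp
    have h10 : (1 + κ) * ((1 + κ) * ((1 + κ) * T)) + (κ ^ 2 + κ) * T ≤ (1 + ε) * T := by
      have he : ε = 9 * κ := by rw [hκ]; ring
      have : (1 + κ) ^ 3 + (κ ^ 2 + κ) ≤ 1 + ε := by rw [he]; nlinarith
      nlinarith
    linarith
  refine (measureReal_mono hsub).trans ((measureReal_union_le _ _).trans ?_)
  have h4 : m * r / (κ ^ 2 * (m * s m)) ≤ θ / 2 := by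
    rw [div_le_iff₀ (by positivity)]
    have h5 : r ≤ κ ^ 2 * θ / 4 * s m :=
      ha.rest_le.trans (by gcongr; exact min_le_right _ _)
    calc m * r ≤ m * (κ ^ 2 * θ / 4 * s m) := by gcongr
      _ ≤ m * (κ ^ 2 * θ / 2 * s m) := by gcongr; norm_num
      _ = _ := by ring
  linarith [hM m hm]

/-- The squared norm of the channel means is controlled uniformly over short windows of sample
sizes. -/
lemma exists_measureReal_window (h : IsTameNoise μ δ s) {ε θ : ℝ} (hε : 0 < ε) (hε1 : ε < 1)
    (hθ : 0 < θ) : ∃ ω₀ : ℝ, 0 < ω₀ ∧ ∃ M₀ : ℕ, ∀ m ≥ M₀, 0 < s m → ∀ t : ℕ, 0 < t →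
      μ.real {ω | ∃ n : ℕ, t ≤ n ∧ (n : ℝ) ≤ (1 + ω₀) * t ∧
        (1 + ε) * (m * s m) < meanSq (fun i j => δ m i j ω) n} ≤ θ := by
  set κ := ε / 5 with hκ
  have hκ0 : 0 < κ := by positivity
  have hκ1 : κ < 1 := by linarith
  obtain ⟨M₀, hM0, hM⟩ := h.exists_measureReal_lt_meanSq hκ0 hκ1 (show 0 < θ / 2 by positivity)
  -- The mean is controlled at the left end `t`, and the at most `ω₀ t` later rows by the maximal
  -- inequality. Its bound `ω₀ / κ²` equals `θ / 2` for this relative window length.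
  refine ⟨κ ^ 2 * θ / 2, by positivity, M₀, fun m hm hs t ht => ?_⟩
  set ω₀ := κ ^ 2 * θ / 2 with hω₀
  have hω₀0 : 0 < ω₀ := by positivity
  have hm' : (0 : ℝ) < m := by exact_mod_cast hM0.trans_le hm
  have ht' : (0 : ℝ) < t := by exact_mod_cast ht
  set N := ⌊ω₀ * t⌋₊ with hN
  have h1 := hM m hm hs t ht
  have h2 := ((h.array m).shift t).measureReal_exists_le_sum_sq N
    (show 0 < κ ^ 2 * (t * m * s m) by positivity)
  have hsub : {ω | ∃ n : ℕ, t ≤ n ∧ (n : ℝ) ≤ (1 + ω₀) * t ∧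
      (1 + ε) * (m * s m) < meanSq (fun i j => δ m i j ω) n} ⊆
      {ω | (1 + κ) * (m * s m) < meanSq (fun i j => δ m i j ω) t} ∪
      {ω | ∃ n ≤ N, κ ^ 2 * (t * m * s m) ≤
        ∑ j, (∑ i ∈ Finset.range n, δ m (t + i) j ω) ^ 2} := by
    rintro ω ⟨n, htn, hnt, hlt⟩
    by_contra hcon
    simp only [mem_union, mem_ofPred_eq, not_or, not_lt, not_exists, not_and, not_le] at hcon
    obtain ⟨l, rfl⟩ := Nat.exists_eq_add_of_le htn
    have hl : l ≤ N := by
      rw [hN, Nat.le_floor_iff (by positivity)]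
      push_cast at hnt
      linarith
    have h3 := hcon.2 l hl
    have h4 := hcon.1
    have h5 : meanSq (fun i j => δ m i j ω) (t + l) ≤
        (1 + κ) * meanSq (fun i j => δ m i j ω) t +
        (1 + 1 / κ) * (∑ j, (∑ i ∈ Finset.range l, δ m (t + i) j ω) ^ 2) / t := by
      simp only [meanSq, Finset.mul_sum, Finset.sum_div, ← Finset.sum_add_distrib]
      refine Finset.sum_le_sum fun j _ => ?_
      rw [Finset.sum_range_add, ← mul_div_assoc, ← add_div]
      refine div_le_div₀ ?_ (sq_add_le_of_pos hκ0 _ _) ht' ?_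
      · positivity
      · push_cast; linarith [Nat.cast_nonneg (α := ℝ) l]
    have h6 : (1 + 1 / κ) * (∑ j, (∑ i ∈ Finset.range l, δ m (t + i) j ω) ^ 2) / t ≤
        (κ ^ 2 + κ) * (m * s m) := by
      rw [div_le_iff₀ ht']
      calc (1 + 1 / κ) * (∑ j, (∑ i ∈ Finset.range l, δ m (t + i) j ω) ^ 2)
          ≤ (1 + 1 / κ) * (κ ^ 2 * (t * m * s m)) := by gcongr
        _ = _ := by field_simp
    have h7 : (1 + κ) * meanSq (fun i j => δ m i j ω) t ≤ (1 + κ) * ((1 + κ) * (m * s m)) := by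
      gcongr
    have h8 : (1 + κ) * ((1 + κ) * (m * s m)) + (κ ^ 2 + κ) * (m * s m) ≤
        (1 + ε) * (m * s m) := by
      have he : ε = 5 * κ := by rw [hκ]; ring
      have hT : 0 < m * s m := by positivity
      have : (1 + κ) ^ 2 + (κ ^ 2 + κ) ≤ 1 + ε := by rw [he]; nlinarith
      nlinarith
    linarith
  refine (measureReal_mono hsub).trans ((measureReal_union_le _ _).trans ?_)
  have h3 : N * m * s m / (κ ^ 2 * (t * m * s m)) ≤ θ / 2 := by
    rw [div_le_iff₀ (by positivity)]
    have : (N : ℝ) ≤ ω₀ * t := Nat.floor_le (by positivity)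
    calc N * m * s m ≤ ω₀ * t * m * s m := by gcongr
      _ = _ := by rw [hω₀]; ring
  linarith

end IsTameNoise

end Tame

/-! ### The random repetition number. -/

section Repetition

variable {Ω : Type*} [MeasurableSpace Ω] {μ : Measure Ω} [IsProbabilityMeasure μ]
  {δ : (m : ℕ) → ℕ → Fin m → Ω → ℝ} {s : ℕ → ℝ}

lemma isRepetitionNumber_condition_iff {m : ℕ} (hm : 0 < m) (x : ℕ → Fin m → ℝ) {c d : ℝ}
    (hc : 0 < c) {n : ℕ} (hn : 2 ≤ n) :
    (m : ℝ) * sampleVariance x n / ((n : ℝ) * c ^ 2) ≤ d ^ 2 ↔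
      scatter x n ≤ ((n : ℝ) - 1) * (n * (c * d) ^ 2) := by
  have hn2 : (2 : ℝ) ≤ n := by exact_mod_cast hn
  have hn1 : (0 : ℝ) < (n : ℝ) - 1 := by linarith
  rw [mul_sampleVariance hm, div_div, div_le_iff₀ (by positivity)]
  ring_nf

/-- The random repetition number stops at a sample size at which the mean error is not much larger
than prescribed. -/
theorem IsTameNoise.exists_measureReal_not_repetition (h : IsTameNoise μ δ s) {κ θ : ℝ}
    (hκ : 0 < κ) (hθ : 0 < θ) : ∃ M₀ : ℕ, 0 < M₀ ∧ ∀ m ≥ M₀, ∀ c d : ℝ, 0 < c → 0 < d →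
      μ.real {ω | ¬ ∃ n : ℕ, IsRepetitionNumber (fun i j => δ m i j ω) d c n ∧
        meanSq (fun i j => δ m i j ω) n / n ≤ (1 + κ) * (c * d) ^ 2} ≤ θ := by
  classical
  set ε₀ := min (κ / 4) (1 / 2) with hε₀
  have hε₀0 : 0 < ε₀ := by positivity
  have hε₀1 : ε₀ < 1 := (min_le_right _ _).trans_lt (by norm_num)
  have hθ4 : 0 < θ / 4 := by positivity
  obtain ⟨ω₀, hω₀, M₁, hM₁⟩ := h.exists_measureReal_window hε₀0 hε₀1 hθ4
  -- Small enough that the range from `(1 - ε) R` to `(1 + ε) R` fits into one window (`hεω`) and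
  -- that stopping at `(1 - ε) R` instead of `R` is absorbed by `κ` (`hεκ`).
  set ε := min (min (ε₀ / 2) (ω₀ / 8)) (1 / 8) with hε
  have hε0 : 0 < ε := by positivity
  have hεa : ε ≤ ε₀ / 2 := (min_le_left _ _).trans (min_le_left _ _)
  have hεb : ε ≤ ω₀ / 8 := (min_le_left _ _).trans (min_le_right _ _)
  have hεc : ε ≤ 1 / 8 := min_le_right _ _
  have hε1 : ε < 1 := hεc.trans_lt (by norm_num)
  have hεω : 1 + ε ≤ (1 + ω₀) * (1 - ε) := by nlinarith
  have hεκ : 1 + ε₀ ≤ (1 + κ) * (1 - ε) := by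
    have h1 : ε₀ ≤ κ / 4 := min_le_left _ _
    nlinarith
  obtain ⟨M₂, hM₂⟩ := h.exists_measureReal_scatter_lt hε0 hε1 hθ4
  obtain ⟨M₃, hM₃⟩ := h.exists_measureReal_lt_scatter hε0 hε1 hθ4
  obtain ⟨M₄, hM₄0, hM₄⟩ := h.exists_measureReal_lt_meanSq hε₀0 hε₀1 hθ4
  refine ⟨max (max M₁ M₂) (max M₃ M₄), by positivity, fun m hm c d hc hd => ?_⟩
  have hm₁ : M₁ ≤ m := ((le_max_left _ _).trans (le_max_left _ _)).trans hm
  have hm₂ : M₂ ≤ m := ((le_max_right _ _).trans (le_max_left _ _)).trans hm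
  have hm₃ : M₃ ≤ m := ((le_max_left _ _).trans (le_max_right _ _)).trans hm
  have hm₄ : M₄ ≤ m := ((le_max_right _ _).trans (le_max_right _ _)).trans hm
  have hm0 : 0 < m := hM₄0.trans_le hm₄
  have hm' : (0 : ℝ) < m := by exact_mod_cast hm0
  set D := (c * d) ^ 2 with hD
  have hD0 : 0 < D := by positivity
  have hs0 : 0 ≤ s m := by
    rw [← (h.array m).sq 0 ⟨0, hm0⟩]
    exact integral_nonneg fun ω => sq_nonneg _
  -- Without noise almost surely every sample is exact, and the rule stops at its minimum `n = 2`.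
  rcases hs0.eq_or_lt with hs | hs
  · have hzero : ∀ i j, ∀ᵐ ω ∂μ, δ m i j ω = 0 := fun i j => by
      have h1 := (h.array m).sq i j
      rw [← hs, integral_eq_zero_iff_of_nonneg (fun ω => sq_nonneg _)
        ((h.array m).memLp i j).integrable_sq] at h1
      filter_upwards [h1] with ω hω
      simpa using hω
    have hall : ∀ᵐ ω ∂μ, ∀ i j, δ m i j ω = 0 := by
      rw [ae_all_iff]; intro i; rw [ae_all_iff]; exact hzero i
    have hnull : μ {ω | ¬ ∃ n : ℕ, IsRepetitionNumber (fun i j => δ m i j ω) d c n ∧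
        meanSq (fun i j => δ m i j ω) n / n ≤ (1 + κ) * D} = 0 := by
      refine measure_mono_null ?_ (ae_iff.mp hall)
      intro ω hω
      rw [mem_ofPred_eq]
      intro h0
      refine hω ⟨2, ⟨⟨le_rfl, ?_⟩, fun n hn => hn.1⟩, ?_⟩
      · rw [isRepetitionNumber_condition_iff hm0 _ hc le_rfl]
        simp only [scatter, h0]
        norm_num
        positivity
      · simp only [meanSq, h0]
        norm_num
        positivity
    rw [measureReal_def, hnull]
    exact hθ.le
  set R := m * s m / D with hR
  have hR0 : 0 < R := by positivity
  have hRD : R * D = m * s m := by rw [hR]; field_simp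
  -- On the good event the stopping index lies between `n₀` and `n₁`.
  set n₁ := max 2 ⌈(1 + ε) * R⌉₊ with hn₁
  set n₀ := max 2 ⌈(1 - ε) * R⌉₊ with hn₀
  have hn₁2 : 2 ≤ n₁ := le_max_left _ _
  have hn₀2 : 2 ≤ n₀ := le_max_left _ _
  have hn₁R : (1 + ε) * R ≤ n₁ :=
    (Nat.le_ceil _).trans (by exact_mod_cast le_max_right _ _)
  have hn₀R : (1 - ε) * R ≤ n₀ :=
    (Nat.le_ceil _).trans (by exact_mod_cast le_max_right _ _)
  have e1 := hM₁ m hm₁ hs n₀ (by omega)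
  have e2 := hM₂ m hm₂ hs
  have e3 := hM₃ m hm₃ hs n₁ hn₁2
  have e4 := hM₄ m hm₄ hs n₁ (by omega)
  set E1 := {ω | ∃ n : ℕ, n₀ ≤ n ∧ (n : ℝ) ≤ (1 + ω₀) * n₀ ∧
        (1 + ε₀) * (m * s m) < meanSq (fun i j => δ m i j ω) n}
  set E2 := {ω | ∃ n : ℕ, 2 ≤ n ∧ scatter (fun i j => δ m i j ω) n <
        (1 - ε) * (((n : ℝ) - 1) * m * s m)}
  set E3 := {ω | (1 + ε) * (((n₁ : ℝ) - 1) * m * s m) < scatter (fun i j => δ m i j ω) n₁}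
  set E4 := {ω | (1 + ε₀) * (m * s m) < meanSq (fun i j => δ m i j ω) n₁}
  have hsub : {ω | ¬ ∃ n : ℕ, IsRepetitionNumber (fun i j => δ m i j ω) d c n ∧
      meanSq (fun i j => δ m i j ω) n / n ≤ (1 + κ) * D} ⊆ (E1 ∪ E2) ∪ (E3 ∪ E4) := by
    intro ω hω
    by_contra hcon
    simp only [E1, E2, E3, E4, mem_union, mem_ofPred_eq, not_or, not_exists, not_and,
      not_lt] at hcon
    obtain ⟨⟨g1, g2⟩, g3, g4⟩ := hcon
    refine hω ?_
    have hn₁mem : 2 ≤ n₁ ∧ (m : ℝ) * sampleVariance (fun i j => δ m i j ω) n₁ /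
        ((n₁ : ℝ) * c ^ 2) ≤ d ^ 2 := by
      refine ⟨hn₁2, ?_⟩
      rw [isRepetitionNumber_condition_iff hm0 _ hc hn₁2]
      have hpos : (0 : ℝ) ≤ (n₁ : ℝ) - 1 := by
        have : (2 : ℝ) ≤ n₁ := by exact_mod_cast hn₁2
        linarith
      calc scatter (fun i j => δ m i j ω) n₁ ≤ (1 + ε) * (((n₁ : ℝ) - 1) * m * s m) := g3
        _ = ((n₁ : ℝ) - 1) * ((1 + ε) * R * D) := by rw [mul_assoc (1 + ε), hRD]; ring
        _ ≤ ((n₁ : ℝ) - 1) * (n₁ * D) := by gcongr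
    have hcond : ∃ n, 2 ≤ n ∧ (m : ℝ) * sampleVariance (fun i j => δ m i j ω) n /
        ((n : ℝ) * c ^ 2) ≤ d ^ 2 := ⟨n₁, hn₁mem⟩
    have hspec := Nat.find_spec hcond
    have hmin : Nat.find hcond ≤ n₁ := Nat.find_min' hcond hn₁mem
    refine ⟨Nat.find hcond, ⟨hspec, fun n hn => Nat.find_min' hcond hn⟩, ?_⟩
    set n := Nat.find hcond
    have hn2 := hspec.1
    have hn2' : (2 : ℝ) ≤ n := by exact_mod_cast hn2
    have hlow : (1 - ε) * (m * s m) ≤ n * D := by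
      have h1 := g2 n hn2
      have h2 := (isRepetitionNumber_condition_iff hm0 _ hc hn2).mp hspec.2
      have h3 : ((n : ℝ) - 1) * ((1 - ε) * (m * s m)) ≤ ((n : ℝ) - 1) * (n * D) := by linarith
      exact le_of_mul_le_mul_left h3 (by linarith)
    have hnR : (1 - ε) * R ≤ n := by
      rw [hR, ← mul_div_assoc, div_le_iff₀ hD0]
      exact hlow
    have hn₀n : n₀ ≤ n := max_le hn2 (Nat.ceil_le.mpr hnR)
    have hmean : meanSq (fun i j => δ m i j ω) n ≤ (1 + ε₀) * (m * s m) := by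
      -- For small `R`, rounding can push `n₁` out of the window that starts at `n₀`, so the mean at
      -- `n₁` has its own event. An index `n ≥ 2` below `n₁` satisfies `n < (1 + ε) R` and therefore
      -- lies in the window.
      rcases hmin.eq_or_lt with heq | hlt
      · rw [heq]; exact g4
      · refine g1 n hn₀n ?_
        have h1 : n < ⌈(1 + ε) * R⌉₊ := (lt_max_iff.mp hlt).resolve_left (by omega)
        have h2 := Nat.lt_ceil.mp h1
        calc (n : ℝ) ≤ (1 + ε) * R := h2.le
          _ ≤ (1 + ω₀) * (1 - ε) * R := by gcongr
          _ = (1 + ω₀) * ((1 - ε) * R) := by ring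
          _ ≤ (1 + ω₀) * n₀ := by gcongr
    rw [div_le_iff₀ (by linarith)]
    calc meanSq (fun i j => δ m i j ω) n ≤ (1 + ε₀) * (m * s m) := hmean
      _ ≤ (1 + κ) * (1 - ε) * (m * s m) := by gcongr
      _ = (1 + κ) * ((1 - ε) * (m * s m)) := by ring
      _ ≤ (1 + κ) * (n * D) := by gcongr
      _ = _ := by ring
  refine (measureReal_mono hsub).trans ((measureReal_union_le _ _).trans ?_)
  have := measureReal_union_le (μ := μ) E1 E2
  have := measureReal_union_le (μ := μ) E3 E4
  linarith

end Repetition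

/-! ### Both noise models are tame: truncation and moment bounds. -/

section Noise

variable {Ω : Type*} [MeasurableSpace Ω] {μ : Measure Ω} [IsProbabilityMeasure μ]

/-- The truncation of a real number to `[-N, N]`. -/
noncomputable def clip (N x : ℝ) : ℝ := max (-N) (min x N)

lemma abs_clip_sub_clip_le (N x y : ℝ) : |clip N x - clip N y| ≤ |x - y| :=
  (abs_max_sub_max_le_max _ _ _ _).trans <| by
    rw [sub_self, abs_zero, max_eq_right (abs_nonneg _)]
    refine (abs_min_sub_min_le_max _ _ _ _).trans ?_
    rw [sub_self, abs_zero, max_eq_left (abs_nonneg _)]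

lemma clip_eq_self {N x : ℝ} (h : |x| ≤ N) : clip N x = x := by
  rw [clip, min_eq_left (abs_le.mp h).2, max_eq_right (abs_le.mp h).1]

lemma abs_clip_le {N : ℝ} (hN : 0 ≤ N) (x : ℝ) : |clip N x| ≤ N :=
  abs_le.mpr ⟨le_max_left _ _, max_le (by linarith) (min_le_right _ _)⟩

lemma clip_zero {N : ℝ} (hN : 0 ≤ N) : clip N 0 = 0 := clip_eq_self (by simpa using hN)

lemma abs_clip_le_abs {N : ℝ} (hN : 0 ≤ N) (x : ℝ) : |clip N x| ≤ |x| := by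
  simpa [clip_zero hN] using abs_clip_sub_clip_le N x 0

lemma abs_sub_clip_le_abs {N : ℝ} (hN : 0 ≤ N) (x : ℝ) : |x - clip N x| ≤ |x| := by
  have h : |x - clip N x| = max (|x| - N) 0 := by
    rcases le_total |x| N with h | h
    · rw [clip_eq_self h, sub_self, abs_zero, max_eq_right (by linarith)]
    · rw [max_eq_left (by linarith), clip]
      rcases abs_cases x with ⟨h1, h2⟩ | ⟨h1, h2⟩
      · rw [min_eq_right (by linarith), max_eq_right (by linarith), abs_of_nonneg (by linarith), h1]
      · rw [min_eq_left (by linarith), max_eq_left (by linarith), abs_of_nonpos (by linarith), h1]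
        ring
  rw [h]
  exact max_le (by linarith) (abs_nonneg x)

lemma measurable_clip (N : ℝ) : Measurable (clip N) := by
  unfold clip; fun_prop

omit [IsProbabilityMeasure μ] in
-- At each outcome the integrand is constant once `N ≥ |f ω|`, so dominated convergence applies.
lemma tendsto_integral_clip {f : Ω → ℝ} (hf : Measurable f) {g : ℝ → ℝ → ℝ} {l : ℝ → ℝ}
    {b : Ω → ℝ} (hb : Integrable b μ) (hg : ∀ N, Measurable (g N))
    (hgb : ∀ N : ℕ, ∀ ω, |g N (f ω)| ≤ b ω) (hl : ∀ N x, |x| ≤ N → g N x = l x) :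
    Tendsto (fun N : ℕ => ∫ ω, g N (f ω) ∂μ) atTop (𝓝 (∫ ω, l (f ω) ∂μ)) := by
  refine tendsto_integral_of_dominated_convergence b
    (fun N => ((hg N).comp hf).aestronglyMeasurable) hb
    (fun N => Eventually.of_forall fun ω => hgb N ω) (Eventually.of_forall fun ω => ?_)
  refine tendsto_const_nhds.congr' ?_
  obtain ⟨N₀, hN₀⟩ := exists_nat_ge |f ω|
  filter_upwards [eventually_ge_atTop N₀] with N hN
  exact (hl N _ (hN₀.trans (by exact_mod_cast hN))).symm

lemma exists_clip_moments {f : Ω → ℝ} (hf : Measurable f) (h2 : MemLp f 2 μ)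
    (h0 : ∫ ω, f ω ∂μ = 0) {η : ℝ} (hη : 0 < η) :
    ∃ N : ℕ, (∫ ω, clip N (f ω) ∂μ) ^ 2 < η ∧
      |∫ ω, clip N (f ω) ^ 2 ∂μ - ∫ ω, f ω ^ 2 ∂μ| < η ∧
      ∫ ω, (f ω - clip N (f ω)) ^ 2 ∂μ < η := by
  have t1 := tendsto_integral_clip (μ := μ) hf (g := clip) (l := fun x => x)
    (h2.integrable one_le_two).abs measurable_clip
    (fun N ω => abs_clip_le_abs (Nat.cast_nonneg N) _) (fun N x h => clip_eq_self h)
  have t2 := tendsto_integral_clip (μ := μ) hf (g := fun N x => clip N x ^ 2) (l := fun x => x ^ 2)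
    h2.integrable_sq (fun N => (measurable_clip N).pow_const 2) (fun N ω => by
      rw [abs_pow, ← sq_abs (f ω)]
      have := abs_clip_le_abs (Nat.cast_nonneg N) (f ω)
      gcongr) (fun N x h => by rw [clip_eq_self h])
  have t3 := tendsto_integral_clip (μ := μ) hf (g := fun N x => (x - clip N x) ^ 2)
    (l := fun _ => 0) h2.integrable_sq
    (fun N => (measurable_id.sub (measurable_clip N)).pow_const 2) (fun N ω => by
      rw [abs_pow, ← sq_abs (f ω)]
      have := abs_sub_clip_le_abs (Nat.cast_nonneg N) (f ω)
      gcongr) (fun N x h => by rw [clip_eq_self h]; ring)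
  rw [h0] at t1
  have t1' := t1.pow 2
  rw [zero_pow two_ne_zero] at t1'
  rw [integral_zero] at t3
  have t2' := (tendsto_sub_nhds_zero_iff.mpr t2).abs
  rw [abs_zero] at t2'
  have := (t1'.eventually_lt_const hη).and
    ((t2'.eventually_lt_const hη).and (t3.eventually_lt_const hη))
  exact this.exists

omit [IsProbabilityMeasure μ] in
lemma isCentredArray_comp {m : ℕ} {ξ : ℕ → Fin m → Ω → ℝ}
    (hind : iIndepFun (fun a : ℕ × Fin m => ξ a.1 a.2) μ) (hmeas : ∀ i j, Measurable (ξ i j))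
    {φ : ℝ → ℝ} (hφ : Measurable φ) {s : ℝ} (h2 : ∀ i j, MemLp (fun ω => φ (ξ i j ω)) 2 μ)
    (h0 : ∀ i j, ∫ ω, φ (ξ i j ω) ∂μ = 0) (hs : ∀ i j, ∫ ω, φ (ξ i j ω) ^ 2 ∂μ = s) :
    IsCentredArray μ (fun i j ω => φ (ξ i j ω)) s where
  indep := hind.comp (fun _ => φ) fun _ => hφ
  meas i j := hφ.comp (hmeas i j)
  memLp := h2
  mean := h0
  sq := hs

/-- The common variance of the errors on level `m`. -/
noncomputable def noiseVariance (μ : Measure Ω) (δ : (m : ℕ) → ℕ → Fin m → Ω → ℝ) (m : ℕ) : ℝ :=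
  if h : 0 < m then ∫ ω, δ m 0 ⟨0, h⟩ ω ^ 2 ∂μ else 0

/-- Each error is clipped and recentred. As the law is the same for all `m`, one clipping level
serves them all, and all moments are computed for the single variable `δ 1 0 0`. Boundedness
replaces a fourth-moment assumption. -/
lemma IsFixedNoise.isTameNoise {δ : (m : ℕ) → ℕ → Fin m → Ω → ℝ}
    (hmeas : ∀ m i j, Measurable (δ m i j)) (h : IsFixedNoise μ δ) :
    IsTameNoise μ δ (noiseVariance μ δ) := by
  have hint : ∀ {g : ℝ → ℝ}, Measurable g → ∀ m i j,
      ∫ ω, g (δ m i j ω) ∂μ = ∫ ω, g (δ 1 0 0 ω) ∂μ := fun hg m i j =>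
    ((h.ident m i j 1 0 0).comp hg).integral_eq
  have hsq : ∀ m i j, ∫ ω, δ m i j ω ^ 2 ∂μ = ∫ ω, δ 1 0 0 ω ^ 2 ∂μ := fun m i j =>
    hint (g := fun x => x ^ 2) (by fun_prop) m i j
  set s := ∫ ω, δ 1 0 0 ω ^ 2 ∂μ with hs
  have hvar : ∀ m, 0 < m → noiseVariance μ δ m = s := fun m hm => by
    rw [noiseVariance, dif_pos hm, hsq]
  refine ⟨fun m => ⟨h.indep m, hmeas m, h.memLp m, h.mean_zero m, fun i j => ?_⟩, fun η hη => ?_⟩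
  · rw [hvar m (Fin.pos j), hsq]
  by_cases hs0 : 0 < s
  swap
  · refine ⟨0, le_rfl, fun m hm => absurd hm ?_⟩
    rcases Nat.eq_zero_or_pos m with rfl | hm0
    · simp [noiseVariance]
    · rwa [hvar m hm0]
  -- The cap `1 / 2` keeps the truncated variance `s'` positive, as the kurtosis bound divides by
  -- `s' ^ 2`. Below, `η' * s / 2` is used twice: for the change of the second moment and for the
  -- square of the new mean.
  set η' := min η (1 / 2) with hη'
  have hη'0 : 0 < η' := by positivity
  obtain ⟨N, hN1, hN2, hN3⟩ := exists_clip_moments (hmeas 1 0 0) (h.memLp 1 0 0)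
    (h.mean_zero 1 0 0) (show 0 < η' * s / 2 by positivity)
  set e := ∫ ω, clip N (δ 1 0 0 ω) ∂μ with he
  set s' := ∫ ω, clip N (δ 1 0 0 ω) ^ 2 ∂μ - e ^ 2 with hs'
  have hlow : (1 - η') * s ≤ s' := by linarith [(abs_lt.mp hN2).1]
  have hs'0 : 0 < s' := by
    have : η' ≤ 1 / 2 := min_le_right _ _
    nlinarith
  have hN0 : (0 : ℝ) ≤ N := Nat.cast_nonneg N
  set φ : ℝ → ℝ := fun x => clip N x - e with hφ
  have hφm : Measurable φ := (measurable_clip N).sub_const e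
  have hclip : MemLp (fun ω => clip N (δ 1 0 0 ω)) 2 μ :=
    MemLp.of_bound ((measurable_clip N).comp (hmeas 1 0 0)).aestronglyMeasurable N
      (Eventually.of_forall fun ω => abs_clip_le hN0 _)
  have hclip1 := hclip.integrable one_le_two
  have heN : |e| ≤ N := by
    have := norm_integral_le_of_norm_le_const (μ := μ) (f := fun ω => clip N (δ 1 0 0 ω)) (C := N)
      (Eventually.of_forall fun ω => abs_clip_le hN0 _)
    simpa using this
  have hφb : ∀ x, |φ x| ≤ 2 * N := fun x => by
    have := abs_sub (clip N x) e
    have := abs_clip_le hN0 x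
    linarith
  have hφLp : ∀ p m i j, MemLp (fun ω => φ (δ m i j ω)) p μ := fun p m i j =>
    MemLp.of_bound (hφm.comp (hmeas m i j)).aestronglyMeasurable (2 * N)
      (Eventually.of_forall fun ω => hφb _)
  have hφ0 : ∀ m i j, ∫ ω, φ (δ m i j ω) ∂μ = 0 := fun m i j => by
    rw [hint hφm, hφ, integral_sub hclip1 (integrable_const _)]
    simp [he]
  have hX1 := (h.memLp 1 0 0).integrable one_le_two
  refine ⟨16 * (N : ℝ) ^ 4 / s' ^ 2, by positivity, fun m hm => ?_⟩
  have hm0 : 0 < m := by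
    by_contra h0
    simp [noiseVariance, h0] at hm
  rw [hvar m hm0]
  refine ⟨fun i j ω => φ (δ m i j ω), s',
    ∫ ω, (δ 1 0 0 ω - clip N (δ 1 0 0 ω)) ^ 2 ∂μ - e ^ 2, ?_, ?_, fun i j => hφLp 4 m i j,
    fun i j => ?_, fun i k j ω => ?_, ?_, ?_, ?_⟩
  · refine isCentredArray_comp (h.indep m) (hmeas m) hφm (hφLp 2 m) (hφ0 m) fun i j => ?_
    rw [hint (g := fun x => φ x ^ 2) (hφm.pow_const 2), hs']
    have h1 : ∀ ω, φ (δ 1 0 0 ω) ^ 2 =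
      clip N (δ 1 0 0 ω) ^ 2 - (2 * e) * clip N (δ 1 0 0 ω) + e ^ 2 := fun ω => by
        simp only [hφ]; ring
    simp only [h1]
    have i1 : Integrable (fun ω => clip N (δ 1 0 0 ω) ^ 2 - (2 * e) * clip N (δ 1 0 0 ω)) μ :=
      hclip.integrable_sq.sub (hclip1.const_mul _)
    rw [integral_add i1 (integrable_const _),
      integral_sub hclip.integrable_sq (hclip1.const_mul _), integral_const_mul, ← he]
    simp
    ring
  · refine isCentredArray_comp (φ := fun x => x - φ x) (h.indep m) (hmeas m)
      (measurable_id.sub hφm) (fun i j => (h.memLp m i j).sub (hφLp 2 m i j)) (fun i j => ?_)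
      fun i j => ?_
    · rw [integral_sub ((h.memLp m i j).integrable one_le_two)
        ((hφLp 2 m i j).integrable one_le_two), h.mean_zero, hφ0, sub_zero]
    · rw [hint (g := fun x => (x - φ x) ^ 2) ((measurable_id.sub hφm).pow_const 2)]
      have h1 : ∀ ω, (δ 1 0 0 ω - φ (δ 1 0 0 ω)) ^ 2 =
        (δ 1 0 0 ω - clip N (δ 1 0 0 ω)) ^ 2 +
          (2 * e) * (δ 1 0 0 ω - clip N (δ 1 0 0 ω)) + e ^ 2 := fun ω => by
          simp only [hφ]; ring
      simp only [h1]
      have i1 := ((h.memLp 1 0 0).sub hclip).integrable_sq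
      have i2 := (hX1.sub hclip1).const_mul (2 * e)
      simp only [Pi.sub_apply] at i1 i2
      have i3 : Integrable (fun ω => (δ 1 0 0 ω - clip N (δ 1 0 0 ω)) ^ 2 +
          (2 * e) * (δ 1 0 0 ω - clip N (δ 1 0 0 ω))) μ := i1.add i2
      rw [integral_add i3 (integrable_const _), integral_add i1 i2, integral_const_mul,
        integral_sub hX1 hclip1, ← he, h.mean_zero]
      simp
      ring
  · have hb : ∀ ω, φ (δ m i j ω) ^ 4 ≤ 16 * (N : ℝ) ^ 4 := fun ω => by
      rw [← Even.pow_abs (by decide : Even 4)]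
      calc |φ (δ m i j ω)| ^ 4 ≤ (2 * (N : ℝ)) ^ 4 := by gcongr; exact hφb _
        _ = _ := by ring
    rw [div_mul_cancel₀ _ (by positivity)]
    have := integral_mono_of_nonneg (μ := μ) (f := fun ω => φ (δ m i j ω) ^ 4)
      (g := fun _ => 16 * (N : ℝ) ^ 4)
      (Eventually.of_forall fun ω => Even.pow_nonneg (by decide) _) (integrable_const _)
      (Eventually.of_forall hb)
    simpa using this
  · simp only [hφ, sub_sub_sub_cancel_right]
    exact abs_clip_sub_clip_le _ _ _
  · refine le_trans ?_ hlow
    gcongr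
    exact min_le_left _ _
  · have h1 : η' ≤ η := min_le_left _ _
    have h2 : η' * s ≤ η * s := by gcongr
    linarith [(abs_lt.mp hN2).2, sq_nonneg e, mul_pos hη'0 hs0]
  · have h1 : η' ≤ η := min_le_left _ _
    have h2 : η' * s ≤ η * s := by gcongr
    linarith [sq_nonneg e, mul_pos hη'0 hs0]

/-- No truncation is needed: with `y = δ² / s`, the inequality `y² ≤ 1 + y ^ p` for `p ≥ 2` turns
the moment condition into kurtosis at most `1 + |Cd|`. The array approximates itself with zero
remainder. -/
lemma IsVaryingNoise.isTameNoise {δ : (m : ℕ) → ℕ → Fin m → Ω → ℝ} {p Cd : ℝ} (hp : 2 ≤ p)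
    (hmeas : ∀ m i j, Measurable (δ m i j)) (h : IsVaryingNoise μ δ p Cd) :
    IsTameNoise μ δ (noiseVariance μ δ) := by
  have h4 : ∀ m i j, MemLp (δ m i j) 4 μ := fun m i j => by
    refine (h.memLp m i j).mono_exponent ?_
    rw [show (4 : ENNReal) = ENNReal.ofReal 4 by norm_num]
    exact ENNReal.ofReal_le_ofReal (by linarith)
  have h2 : ∀ m i j, MemLp (δ m i j) 2 μ := fun m i j => (h4 m i j).mono_exponent (by norm_num)
  have hsq : ∀ m i j, ∫ ω, δ m i j ω ^ 2 ∂μ = noiseVariance μ δ m := fun m i j => by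
    rw [noiseVariance, dif_pos (Fin.pos j)]
    exact ((h.ident m i j 0 ⟨0, Fin.pos j⟩).comp
      (show Measurable fun x : ℝ => x ^ 2 by fun_prop)).integral_eq
  have harr : ∀ m, IsCentredArray μ (δ m) (noiseVariance μ δ m) := fun m =>
    ⟨h.indep m, hmeas m, h2 m, h.mean_zero m, hsq m⟩
  refine ⟨harr, fun η hη => ⟨1 + |Cd|, by positivity, fun m hm => ?_⟩⟩
  set s := noiseVariance μ δ m with hs
  refine ⟨δ m, s, 0, harr m, ?_, h4 m, fun i j => ?_, fun i k j ω => le_rfl, ?_, ?_, by positivity⟩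
  · simp only [sub_self]
    exact isCentredArray_comp (φ := fun _ => 0) (h.indep m) (hmeas m) measurable_const
      (fun i j => memLp_const 0) (by simp) (by simp)
  · have hsp : 0 < s ^ p := Real.rpow_pos_of_pos hm p
    have hi : Integrable (fun ω => |δ m i j ω| ^ (2 * p)) μ := by
      have := (h.memLp m i j).integrable_norm_rpow'
      rwa [ENNReal.toReal_ofReal (by linarith)] at this
    have hpt : ∀ ω, δ m i j ω ^ 4 ≤ s ^ 2 + s ^ 2 / s ^ p * |δ m i j ω| ^ (2 * p) := fun ω => by
      set y := δ m i j ω ^ 2 / s with hy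
      have hy0 : 0 ≤ y := by positivity
      have h1 : y ^ 2 ≤ 1 + y ^ p := by
        rcases le_total y 1 with h1 | h1
        · have := Real.rpow_nonneg hy0 p
          nlinarith
        · have := Real.rpow_le_rpow_of_exponent_le h1 hp
          rw [Real.rpow_two] at this
          linarith
      have h2 : y ^ p = |δ m i j ω| ^ (2 * p) / s ^ p := by
        rw [hy, Real.div_rpow (sq_nonneg _) hm.le, Real.rpow_mul (abs_nonneg _), Real.rpow_two,
          sq_abs]
      have h3 : δ m i j ω ^ 4 = s ^ 2 * y ^ 2 := by rw [hy]; field_simp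
      rw [h3]
      calc s ^ 2 * y ^ 2 ≤ s ^ 2 * (1 + y ^ p) := by gcongr
        _ = _ := by rw [h2]; ring
    have hmom := h.moment m i j
    rw [hsq] at hmom
    calc ∫ ω, δ m i j ω ^ 4 ∂μ ≤ ∫ ω, (s ^ 2 + s ^ 2 / s ^ p * |δ m i j ω| ^ (2 * p)) ∂μ :=
          integral_mono_of_nonneg (Eventually.of_forall fun ω => Even.pow_nonneg (by decide) _)
            ((integrable_const _).add (hi.const_mul _)) (Eventually.of_forall hpt)
      _ = s ^ 2 + s ^ 2 / s ^ p * ∫ ω, |δ m i j ω| ^ (2 * p) ∂μ := by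
          rw [integral_add (integrable_const _) (hi.const_mul _), integral_const_mul]
          simp
      _ ≤ s ^ 2 + s ^ 2 / s ^ p * (|Cd| * s ^ p) := by
          gcongr
          exact hmom.trans (by gcongr; exact le_abs_self _)
      _ = (1 + |Cd|) * s ^ 2 := by field_simp
  · nlinarith
  · nlinarith

lemma IsNoise.isTameNoise {δ : (m : ℕ) → ℕ → Fin m → Ω → ℝ} (h : IsNoise μ δ) :
    IsTameNoise μ δ (noiseVariance μ δ) := by
  obtain ⟨hmeas, hfix | ⟨p, Cd, hp, hvar⟩⟩ := h
  · exact hfix.isTameNoise hmeas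
  · exact hvar.isTameNoise hp hmeas

end Noise

/-! ### From the good data event to limits of probabilities. -/

section Assembly

/-- Only monotonicity and subadditivity are used, so the events of the algorithm need not be shown
measurable. -/
lemma tendsto_measure_one_of_compl {Ω : Type*} [MeasurableSpace Ω] {μ : Measure Ω}
    [IsProbabilityMeasure μ] {G S : ℕ → Set Ω}
    (hG : Tendsto (fun m => μ (G m)ᶜ) atTop (𝓝 0)) (h : ∀ᶠ m in atTop, G m ⊆ S m) :
    Tendsto (fun m => μ (S m)) atTop (𝓝 1) := by
  have h1 : Tendsto (fun m => 1 - μ (G m)ᶜ) atTop (𝓝 1) := by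
    simpa using ENNReal.Tendsto.sub tendsto_const_nhds hG (Or.inl ENNReal.one_ne_top)
  refine tendsto_of_tendsto_of_tendsto_of_le_of_le' h1 tendsto_const_nhds ?_
    (Eventually.of_forall fun m => prob_le_one)
  filter_upwards [h] with m hm
  rw [tsub_le_iff_right, ← measure_univ (μ := μ)]
  calc μ univ = μ (G m ∪ (G m)ᶜ) := by rw [union_compl_self]
    _ ≤ μ (S m ∪ (G m)ᶜ) := measure_mono (union_subset_union_left _ hm)
    _ ≤ _ := measure_union_le _ _

lemma tendsto_measure_zero_of_compl {Ω : Type*} [MeasurableSpace Ω] {μ : Measure Ω}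
    {G S : ℕ → Set Ω} (hG : Tendsto (fun m => μ (G m)ᶜ) atTop (𝓝 0))
    (h : ∀ᶠ m in atTop, S m ⊆ (G m)ᶜ) : Tendsto (fun m => μ (S m)) atTop (𝓝 0) :=
  tendsto_of_tendsto_of_tendsto_of_le_of_le' tendsto_const_nhds hG
    (Eventually.of_forall fun _ => zero_le) (h.mono fun _ hm => measure_mono hm)

lemma IsRegFilter.const_nonneg {F : ℝ → ℝ → ℝ} {b C₀ : ℝ} {ν₀ : EReal}
    (hF : IsRegFilter F b ν₀ C₀) (hb : 0 < b) : 0 ≤ C₀ :=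
  (abs_nonneg _).trans (hF.bound_zero 1 one_pos b ⟨hb, le_rfl⟩)

/-- For `m = 1` the injective map `P P^*` on a line factors through `Y`. Nontriviality of `Y` yields
`K ≠ 0`, hence a nonempty range for the filter bounds and `0 ≤ C₀`. -/
lemma IsDiscScheme.nontrivial {Y : Type*} [NormedAddCommGroup Y] [InnerProductSpace ℝ Y]
    [CompleteSpace Y] {l : (m : ℕ) → Fin m → Y →L[ℝ] ℝ} (hl : IsDiscScheme l) :
    Nontrivial Y := by
  by_contra h
  rw [not_nontrivial_iff_subsingleton] at h
  have h1 := (hl.bijective 1).1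
    (a₁ := EuclideanSpace.single 0 (1 : ℝ)) (a₂ := 0) (by
      rw [ContinuousLinearMap.comp_apply, ContinuousLinearMap.comp_apply]
      congr 1
      exact Subsingleton.elim _ _)
  have := congrArg (fun v => v 0) h1
  simp at this

lemma norm_pos_of_denseRange {X Y : Type*} [NormedAddCommGroup X] [InnerProductSpace ℝ X]
    [NormedAddCommGroup Y] [InnerProductSpace ℝ Y] [Nontrivial Y] {K : X →L[ℝ] Y}
    (hdense : DenseRange K) : 0 < ‖K‖ := by
  refine norm_pos_iff.mpr fun h => ?_
  obtain ⟨y, hy⟩ := exists_ne (0 : Y)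
  have h1 : y ∈ closure (range K) := hdense y
  have h2 : range K ⊆ {0} := by
    rintro _ ⟨x, rfl⟩
    simp [h]
  have h3 := closure_mono h2 h1
  rw [closure_singleton] at h3
  exact hy h3

variable {Y : Type*} [NormedAddCommGroup Y] [InnerProductSpace ℝ Y] [CompleteSpace Y]
  {l : (m : ℕ) → Fin m → Y →L[ℝ] ℝ} {y : Y} {δd c C : ℕ → ℝ}
  {Ω : Type*} [MeasurableSpace Ω] {μ : Measure Ω} [IsProbabilityMeasure μ]
  {δ : (m : ℕ) → ℕ → Fin m → Ω → ℝ}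

omit [CompleteSpace Y] [MeasurableSpace Ω] in
lemma isRepetitionNumber_measurements {m : ℕ} (hm : 0 < m) {ω : Ω} {d e : ℝ} {n : ℕ} :
    IsRepetitionNumber (measurements l y δ m ω) d e n ↔
      IsRepetitionNumber (fun i j => δ m i j ω) d e n := by
  have hm' : (m : ℝ) ≠ 0 := by exact_mod_cast hm.ne'
  have h : ∀ k, (m : ℝ) * sampleVariance (measurements l y δ m ω) k =
      m * sampleVariance (fun i j => δ m i j ω) k := fun k => by
    rw [mul_sampleVariance hm, mul_sampleVariance hm]
    congr 1
    exact scatter_const_add (fun j => l m j y) (fun i j => δ m i j ω) k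
  simp only [IsRepetitionNumber, h]

/-- With high probability the repetition number exists and the reconstructed data have an error
not much larger than twice the discretisation error. -/
theorem tendsto_measure_compl_data_error (hl : IsDiscScheme l)
    (hw : IsWellConditioned l y δd c C) (hδ : IsNoise μ δ) {σ : ℝ} (hσ : 1 < σ) :
    Tendsto (fun m => μ {ω | ∃ n, IsRepetitionNumber (measurements l y δ m ω) (δd m) (c m) n ∧
      ‖pinv (discOp (l m)) (sampleMean (measurements l y δ m ω) n) - y‖ ≤ 2 * σ * δd m}ᶜ)
      atTop (𝓝 0) := by
  rw [ENNReal.tendsto_nhds_zero]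
  intro θ hθ
  obtain ⟨θ', hθ'0, hθ'⟩ := ENNReal.lt_iff_exists_real_btwn.mp hθ
  have hθ'pos : 0 < θ' := by simpa using hθ'.1
  -- With `κ = 2 (σ - 1)` the noise part of the data error is at most `√(1 + κ) δ ≤ (2 σ - 1) δ`,
  -- and the discretisation error `δ` completes `2 σ δ`.
  obtain ⟨M₀, hM₀, hM⟩ := hδ.isTameNoise.exists_measureReal_not_repetition
    (show 0 < 2 * (σ - 1) by linarith) hθ'pos
  filter_upwards [eventually_ge_atTop M₀, hw.disc_pos, hw.disc_bound, hw.sing_bound]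
    with m hm hd hdb hs
  have hm0 : 0 < m := hM₀.trans_le hm
  have h1 := hM m hm (c m) (δd m) hs.1 hd
  refine le_trans ?_ hθ'.2.le
  rw [measureReal_def] at h1
  refine (measure_mono ?_).trans ((ENNReal.le_ofReal_iff_toReal_le (measure_ne_top _ _)
    hθ'pos.le).mpr h1)
  intro ω hω hex
  obtain ⟨n, hn, hmean⟩ := hex
  refine hω ⟨n, (isRepetitionNumber_measurements hm0).mpr hn, ?_⟩
  have hn0 : 0 < n := by have := hn.1.1; omega
  have hsm : sampleMean (measurements l y δ m ω) n =
      discOp (l m) y + sampleMean (fun i j => δ m i j ω) n :=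
    sampleMean_const_add (fun j => l m j y) (fun i j => δ m i j ω) hn0
  rw [← norm_sq_sampleMean] at hmean
  rw [hsm, pinv_add (hl.bijective m).2, add_sub_right_comm]
  have h2 := norm_pinv_le (hl.bijective m) hs.1 (fun s hsing => (hs.2 s hsing).1)
    (sampleMean (fun i j => δ m i j ω) n)
  have hcd : 0 < c m * δd m := mul_pos hs.1 hd
  have h3 : ‖sampleMean (fun i j => δ m i j ω) n‖ ≤ (1 + 2 * (σ - 1)) * (c m * δd m) := by
    refine le_of_sq_le_sq (hmean.trans ?_) (mul_nonneg (by linarith) hcd.le)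
    rw [mul_pow (1 + 2 * (σ - 1))]
    exact mul_le_mul_of_nonneg_right (by nlinarith) (sq_nonneg _)
  have h4 : ‖sampleMean (fun i j => δ m i j ω) n‖ / c m ≤ (1 + 2 * (σ - 1)) * δd m := by
    rw [div_le_iff₀ hs.1]
    linarith
  rw [norm_sub_rev] at hdb
  linarith [norm_add_le (pinv (discOp (l m)) (discOp (l m) y) - y)
    (pinv (discOp (l m)) (sampleMean (fun i j => δ m i j ω) n))]

end Assembly

end InverseProblem

/-! ### The main theorem. -/

theorem theorem3p9 {X Y : Type*}
    [NormedAddCommGroup X] [InnerProductSpace ℝ X] [CompleteSpace X]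
    [NormedAddCommGroup Y] [InnerProductSpace ℝ Y] [CompleteSpace Y]
    (K : X →L[ℝ] Y) (hK : IsCompactOperator K) (hinj : Function.Injective K)
    (hdense : DenseRange K)
    (F : ℝ → ℝ → ℝ) (ν₀ : EReal) (C₀ : ℝ)
    (hF : InverseProblem.IsRegFilter F (‖K‖ ^ 2) ν₀ C₀) (hν₀ : 1 < ν₀)
    (τ q : ℝ) (hτ : C₀ < τ) (hq : q ∈ Set.Ioo (0 : ℝ) 1) :
    ∃ L' : ℝ → ℝ,
      ∀ (yhat : Y), yhat ∈ InverseProblem.pinvDomain K →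
      ∀ (l : (m : ℕ) → Fin m → Y →L[ℝ] ℝ) (δd c C : ℕ → ℝ),
        InverseProblem.IsDiscScheme l → InverseProblem.IsWellConditioned l yhat δd c C →
      ∀ (Ω : Type*) [MeasurableSpace Ω] (μ : Measure Ω) [IsProbabilityMeasure μ]
        (δ : (m : ℕ) → ℕ → Fin m → Ω → ℝ), InverseProblem.IsNoise μ δ →
      -- the algorithm terminates with probability tending to one
      Tendsto (fun m => μ {ω | ∃ x, InverseProblem.IsReconstruction K F τ q
          (InverseProblem.discOp (l m)) (δd m) (c m)
          (InverseProblem.measurements l yhat δ m ω) x}) atTop (𝓝 1) ∧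
      -- convergence in probability
      (∀ ε : ℝ, 0 < ε → Tendsto (fun m => μ {ω | ∃ x, InverseProblem.IsReconstruction K F τ q
          (InverseProblem.discOp (l m)) (δd m) (c m)
          (InverseProblem.measurements l yhat δ m ω) x ∧
          ε ≤ ‖x - InverseProblem.pinv K yhat‖}) atTop (𝓝 0)) ∧
      -- convergence rate under a source condition
      (∀ ν ρ : ℝ, 0 < ν → (ν : EReal) ≤ ν₀ - 1 → 0 < ρ →
        (∃ w : X, ‖w‖ ≤ ρ ∧ InverseProblem.pinv K yhat =
          InverseProblem.specFun (ContinuousLinearMap.adjoint K ∘L K) (fun t => t ^ (ν / 2)) w) →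
        Tendsto (fun m => μ {ω | ∃ x, InverseProblem.IsReconstruction K F τ q
          (InverseProblem.discOp (l m)) (δd m) (c m)
          (InverseProblem.measurements l yhat δ m ω) x ∧
          ‖x - InverseProblem.pinv K yhat‖ ≤
            L' ν * ρ ^ (1 / (ν + 1)) * (δd m) ^ (ν / (ν + 1))}) atTop (𝓝 1)) := by
  classical
  open InverseProblem in
  obtain ⟨D, hD0, hD⟩ := exists_norm_reg_le hK hinj hdense hF
  obtain ⟨σ, hσ, hσ1⟩ : ∃ σ : ℝ, C₀ * σ < τ ∧ 1 < σ := by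
    have h1 : Tendsto (fun σ : ℝ => C₀ * σ) (𝓝[>] 1) (𝓝 (C₀ * 1)) := by
      have : Continuous fun σ : ℝ => C₀ * σ := by fun_prop
      exact this.continuousAt.tendsto.mono_left nhdsWithin_le_nhds
    rw [mul_one] at h1
    exact ((h1.eventually_lt_const hτ).and eventually_mem_nhdsWithin).exists
  -- The decay constants are chosen for all `ν` before the data, the scheme and the noise are
  -- introduced, so `L'` cannot depend on them. The exponent `ν + 1` reflects the additional half
  -- power of `K^* K` in the bias measured through `K`, whence `ν ≤ ν₀ - 1`.
  have hdecay : ∀ ν : ℝ, ∃ C, 0 < ν → (ν : EReal) ≤ ν₀ - 1 → 0 ≤ C ∧ ∀ α > 0,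
      ∀ t ∈ Ioc 0 (‖K‖ ^ 2), t ^ (ν + 1) * (1 - F α t * t) ^ 2 ≤ C * α ^ (ν + 1) := fun ν => by
    by_cases h : 0 < ν ∧ (ν : EReal) ≤ ν₀ - 1
    · have h1 : ((ν + 1 : ℝ) : EReal) ≤ ν₀ := by
        rw [EReal.coe_add, EReal.coe_one]
        exact (EReal.le_sub_iff_add_le (Or.inl (EReal.coe_ne_bot 1)) (Or.inl (EReal.coe_ne_top 1))).mp h.2
      obtain ⟨C, hC⟩ := hF.exists_decay (by linarith [h.1]) h1
      exact ⟨C, fun _ _ => hC⟩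
    · exact ⟨0, fun h1 h2 => absurd ⟨h1, h2⟩ h⟩
  choose Cdec hCdec using hdecay
  refine ⟨fun ν => rateConst C₀ D (Cdec ν) τ σ q ν,
    fun yhat hy l δd c C hl hw Ω _ μ _ δ hδ => ?_⟩
  have := hl.nontrivial
  have hC₀ : 0 ≤ C₀ := hF.const_nonneg (pow_pos (norm_pos_of_denseRange hdense) 2)
  obtain ⟨x₀, rfl⟩ := exists_eq_apply_of_mem_pinvDomain hdense hy
  rw [pinv_apply_self hinj]
  have hG := tendsto_measure_compl_data_error hl hw hδ hσ1
  have hδd : Tendsto δd atTop (𝓝[>] 0) := tendsto_nhdsWithin_iff.mpr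
    ⟨hw.disc_tendsto, hw.disc_pos⟩
  refine ⟨tendsto_measure_one_of_compl hG ?_, fun ε hε => tendsto_measure_zero_of_compl hG ?_,
    fun ν ρ hν hνν₀ hρ hsource => tendsto_measure_one_of_compl hG ?_⟩
  · filter_upwards [hw.disc_pos] with m hd
    rintro ω ⟨n, hn, hz⟩
    obtain ⟨k, hk⟩ := exists_isDiscrepancyIndex hK hinj hdense hF hν₀ hC₀ hq hσ x₀ hd _ hz
    exact ⟨_, n, k, hn, hk, rfl⟩
  · filter_upwards [hδd.eventually (eventually_norm_reg_sub_lt hK hinj hdense hF hν₀ hC₀ hq hσ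
      (by linarith) x₀ hε)] with m hconv
    rintro ω ⟨x, ⟨n, k, hn, hk, rfl⟩, hx⟩ ⟨n', hn', hz⟩
    obtain rfl := hn.unique hn'
    exact absurd (hconv _ hz k hk) (not_lt.mpr hx)
  · obtain ⟨w, hwρ, hx₀⟩ := hsource
    obtain ⟨hCd0, hCd⟩ := hCdec ν hν hνν₀
    -- The deterministic rate needs `δ ≤ ρ`, which holds for large `m`; this keeps the constant
    -- independent of `ρ`.
    filter_upwards [hw.disc_pos, hw.disc_tendsto.eventually_lt_const hρ] with m hd hdρ
    rintro ω ⟨n, hn, hz⟩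
    obtain ⟨k, hk⟩ := exists_isDiscrepancyIndex hK hinj hdense hF hν₀ hC₀ hq hσ x₀ hd _ hz
    exact ⟨_, ⟨n, k, hn, hk, rfl⟩, norm_reg_sub_le_rate hK hinj hdense hF hC₀ hq hσ
      (by linarith) hD0 hD hν hCd0 hCd hwρ hx₀ hd hdρ.le hz hk⟩
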